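/- Let $F$ be a $p$-adic field (a nonarchimedean local field of characteristic $0$) with quadratic Hilbert symbol $(\cdot,\cdot)_F$, and let $1\le k\le n$ be integers. **Symplectic side.** Let $W$ be a symplectic space over $F$ with symplectic basis $y_1,\dots,y_n,y_1^*,\dots,y_n^*$. Put $Y_n=\mathrm{span}(y_1,\dots,y_n)$, $Y=\mathrm{span}(y_1,\dots,y_k)$, $Y^*=\mathrm{span}(y_1^*,\dots,y_k^*)$, $W_{n-k}=\mathrm{span}(y_{k+1},\dots,y_n,y_{k+1}^*,\dots,y_n^*)$, and let $I_Y:Y^*\to Y$, $y_i^*\mapsto y_i$. Let $\mathrm{Mp}(W)=\mathrm{Sp}(W)\times\{\pm1\}$ with $(g,\epsilon)(g',\epsilon')=(gg',\epsilon\epsilon'c(g,g'))$, where $c$ is Ranga Rao's normalized cocycle (relative to $Y_n$ and this basis): with $P_n$ the stabilizer of $Y_n$, $\sigma_S$ the map $y_i\mapsto y_i^*$, $y_i^*\mapsto -y_i$ for $i\in S$ fixing the other basis vectors, $x(p_1\sigma_Sp_2)=\det(p_1p_2|_{Y_n})$ and $j(p_1\sigma_Sp_2)=|S|$ for $p_1,p_2\in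 P_n$, $$c(g_1,g_2)=(x(g_1),x(g_2))_F\,(-x(g_1)x(g_2),x(g_1g_2))_F\,((-1)^l,\det \rho)_F\,(-1,-1)_F^{l(l-1)/2}\,h(\rho),$$ where $\rho$ is the Leray invariant of $(g_1^{-1}Y_n,Y_n,g_2Y_n)$ (the nondegenerate quotient of the symmetric form $(a+b,v')\mapsto\langle a,v'\rangle$ on $Y_n\cap(g_1^{-1}Y_n+g_2Y_n)$, with $a\in g_1^{-1}Y_n$, $b\in g_2Y_n$), $h(\rho)=\prod_{i<j}(d_i,d_j)_F$ is its Hasse invariant for a diagonalization $(d_i)$, and $2l=j(g_1)+j(g_2)-j(g_1g_2)-\operatorname{rank}\rho$. Let $T_W$ be the diagonal torus and $\alpha_1,\dots,\alpha_n$ the simple roots for the stabilizer of the flag $Fy_1\subset Fy_1+Fy_2\subset\cdots\subset Y_n$, with root vectors $X_{\alpha_i}:y_{i+1}\mapsto y_i,\ y_i^*\mapsto -y_{i+1}^*$ ($i<n$) and $X_{\alpha_n}:y_n^*\mapsto y_n$ (zero on the other basis vectors), and let $X_{-\alpha_i}$ be the root vector for $-\alpha_i$ such that $[X_{\alpha_i},X_{-\alpha_i}]$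 is the coroot of $\alpha_i$. Let $M\cong \mathrm{GL}(Y)\times \mathrm{Sp}(W_{n-k})$ be the Levi subgroup of the stabilizer of $Y$. **Orthogonal side.** Let $V$ be a quadratic space of dimension $2n+1$ and discriminant $1$ over $F$, with bilinear form $b_q(v,v')=q(v+v')-q(v)-q(v')$ and Witt index $r\in\{n,n-1\}$; write $V=V^+$ if $r=n$ and $V=V^-$ if $r=n-1$. Let $x_1,\dots,x_n,x_0,x_1^*,\dots,x_n^*$ be a basis with $b_q(x_i,x_j)=b_q(x_i^*,x_j^*)=0$, $b_q(x_i,x_j^*)=\delta_{ij}$ for $i,j\le r$ and with the remaining basis vectors orthogonal to $x_i,x_i^*$ for $i\le r$, and with $q(x_0)=1$ if $V=V^+$. Put $X=\mathrm{span}(x_1,\dots,x_k)$, $X^*=\mathrm{span}(x^*_1,\dots,x^*_k)$, $V_{n-k}=\mathrm{span}(x_{k+1},\dots,x_n,x_0,x_{k+1}^*,\dots,x_n^*)$, and let $I_X:X^*\to X$, $x_i^*\mapsto x_i$. For $V=V^+$ let $T_V$ be the diagonal torus and $\beta_1,\dots,\beta_n$ the simple roots for the stabilizer of the flag $Fx_1\subset\cdots\subset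 Fx_1+\cdots+Fx_n$, with root vectors $X_{\beta_i}:x_{i+1}\mapsto x_i,\ x_i^*\mapsto -x_{i+1}^*$ ($i<n$) and $X_{\beta_n}:x_0\mapsto 2x_n,\ x_n^*\mapsto -x_0$, and let $X_{-\beta_i}$ be the root vector for $-\beta_i$ with $[X_{\beta_i},X_{-\beta_i}]$ the coroot of $\beta_i$; let $L\cong\mathrm{GL}(X)\times\mathrm{SO}(V_{n-k})$ be the Levi subgroup of the stabilizer of $X$. **Langlands–Shelstad representatives.** Let $w_T$ be the element of the Weyl group of $T_W$ in $\mathrm{Sp}(W)$ (respectively $w_T'$ of $T_V$ in $\mathrm{SO}(V^+)$) which represents the nontrivial element of the relative Weyl group $N(M)/M$ (respectively $N(L)/L$) and stabilizes the set of simple roots inside $M$ (respectively $L$). For reduced decompositions $w_T=s_{\alpha_{(1)}}\cdots s_{\alpha_{(\ell)}}$ and $w'_T=s_{\beta_{(1)}}\cdots s_{\beta_{(\ell)}}$ put $$\widetilde w_P=\widetilde w_{\alpha_{(1)}}\cdots\widetilde w_{\alpha_{(\ell)}}\in\mathrm{Mp}(W),\qquad \widetilde w_Q=\widetilde w_{\beta_{(1)}}\cdots\widetilde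 w_{\beta_{(\ell)}}\in\mathrm{SO}(V^+),$$ $$\widetilde w_\alpha=(\exp(X_\alpha)\exp(-X_{-\alpha})\exp(X_\alpha),1),\qquad \widetilde w_\beta=\exp(X_\beta)\exp(-X_{-\beta})\exp(X_\beta).$$ For $V=V^-$ and $k\le n-1$, $\widetilde w_Q\in\mathrm{SO}(V^-)$ is the element corresponding to $\widetilde w_Q\in\mathrm{SO}(V^+)$ under the pure inner twist $h\mapsto fhf^{-1}$ given by an isometry $f:V^+\otimes\overline F\to V^-\otimes\overline F$ which is the identity on $X\oplus X^*$ and whose cocycle $\sigma\mapsto f^{-1}\sigma(f)$ has values in $\mathrm{SO}(V^+)(\overline F)$. **Proposition.** Let $J\in\mathrm{GL}_k(F)$ be the antidiagonal matrix whose $i$-th row has the entry $(-1)^{n+i}$ in column $k+1-i$ and zeros elsewhere. The element $\widetilde w_P$ does not depend on the reduced decomposition, and in blocks for $W=Y\oplus W_{n-k}\oplus Y^*$ $$\widetilde w_P=\left((-1)^k\begin{pmatrix}0&0&-J I_Y\\0&1&0\\J I_Y^{-1}&0&0\end{pmatrix},\ (-1,-1)_F^{k(k-1)/2}\right).$$ If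 $k\le r$, the element $\widetilde w_Q\in \mathrm{SO}(V)$ does not depend on the reduced decomposition (nor, for $V=V^-$, on $f$), and in blocks for $V=X\oplus V_{n-k}\oplus X^*$ $$\widetilde w_Q=(-1)^k\begin{pmatrix}0&0&J I_X\\0&1&0\\J I_X^{-1}&0&0\end{pmatrix}.$$ -/

import Mathlib

open scoped Matrix

/-! ### Weyl elements in a matrix group

`G` is a group of matrices through a homomorphism `ρ`. -/

section WeylElements

variable {ι F G : Type*} [Fintype ι] [DecidableEq ι] [Field F] [Group G]

/-- The elements of `G` that are block diagonal for the decomposition of the coordinate space `F^ι`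
into the coordinate subspaces given by the fibres of the labelling `lab`
(both `g` and `g⁻¹` preserve each of these subspaces). -/
def blockSubgroup {κ : Type*} (ρ : G →* Matrix ι ι F) (lab : ι → κ) : Subgroup G where
  carrier := {g | ∀ i j, lab i ≠ lab j → ρ g i j = 0 ∧ ρ g⁻¹ i j = 0}
  one_mem' := by
    intro i j h
    have hij : i ≠ j := fun e => h (by rw [e])
    simp [Matrix.one_apply_ne hij]
  mul_mem' := by
    intro a b ha hb i j h
    refine ⟨?_, ?_⟩
    · rw [map_mul, Matrix.mul_apply]
      refine Finset.sum_eq_zero fun l _ => ?_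
      by_cases hl : lab i = lab l
      · rw [(hb l j (fun e => h (hl.trans e))).1, mul_zero]
      · rw [(ha i l hl).1, zero_mul]
    · rw [mul_inv_rev, map_mul, Matrix.mul_apply]
      refine Finset.sum_eq_zero fun l _ => ?_
      by_cases hl : lab i = lab l
      · rw [(ha l j (fun e => h (hl.trans e))).2, mul_zero]
      · rw [(hb i l hl).2, zero_mul]
  inv_mem' := by
    intro a ha i j h
    rw [inv_inv]
    exact ⟨(ha i j h).2, (ha i j h).1⟩

/-- `ν` represents an element `w` of the Weyl group `N(T)/T` such that `w` normalizes the Levi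
subgroup `M`, has nontrivial class in the relative Weyl group `N(M)/M`, and stabilizes the set `Δ`
of simple roots inside `M`.  A simple root `i` is given by a root vector `X i`, and `w` maps
the root `i` to the root `j` when `Ad ν` maps the root line of `X i` into that of `X j`. -/
def RepresentsRelativeWeylElement {σ : Type*} (ρ : G →* Matrix ι ι F) (T M : Subgroup G)
    (X : σ → Matrix ι ι F) (Δ : Set σ) (ν : G) : Prop :=
  ν ∈ Subgroup.normalizer (T : Set G) ∧ ν ∈ Subgroup.normalizer (M : Set G) ∧ ν ∉ M ∧
    ∀ i ∈ Δ, ∃ j ∈ Δ, ∃ c : F, ρ ν * X i * ρ ν⁻¹ = c • X j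

/-- The word `l` is a reduced decomposition, in the Weyl group `N(T)/T`, of the class of `ν`, where
the simple reflection `s_i` is the class of `ω i`. -/
def IsReducedDecomposition {σ : Type*} (T : Subgroup G) (ω : σ → G) (l : List σ) (ν : G) : Prop :=
  (((l.map ω).prod : G) : G ⧸ T) = (ν : G ⧸ T) ∧
    ∀ l' : List σ, (((l'.map ω).prod : G) : G ⧸ T) = (ν : G ⧸ T) → l.length ≤ l'.length

/-- `exp(X) exp(-X') exp(X)` for nilpotent matrices `X`, `X'`. -/
noncomputable def tripleExp [CharZero F] (X X' : Matrix ι ι F) : Matrix ι ι F :=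
  IsNilpotent.exp X * IsNilpotent.exp (-X') * IsNilpotent.exp X

theorem exp_eq_of_cube_eq_zero [CharZero F] (X : Matrix ι ι F) (h : X ^ 3 = 0) :
    IsNilpotent.exp X = 1 + X + (2⁻¹ : F) • X ^ 2 := by
  rw [IsNilpotent.exp_eq_sum h]
  simp only [Finset.sum_range_succ, Finset.sum_range_zero, Nat.factorial]
  have : ((((0 + 1 + 1) * ((0 + 1) * 1) : ℕ) : ℚ)⁻¹ : ℚ) • X ^ 2 = (2⁻¹ : F) • X ^ 2 := by
    rw [← Rat.cast_smul_eq_qsmul F]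
    norm_num
  simpa using this

end WeylElements

/-! ### The symplectic group `Sp(W)`

`W = F^(2n)` has symplectic basis `y_1, …, y_n, y*_1, …, y*_n`, where `y_i` is the standard vector
with index `Sum.inl i` and `y*_i` the one with index `Sum.inr i` (`i : Fin n` starts at `0`), and
`⟨y_i, y*_j⟩ = δ_ij`.  Matrices act on column vectors. -/

section Symplectic

/-- The symplectic group `Sp(W)`. -/
abbrev SpGroup (n : ℕ) (F : Type*) [Field F] := Matrix.symplecticGroup (Fin n) F

/-- `Sp(W)` as a group of matrices. -/
def spMatrix (n : ℕ) (F : Type*) [Field F] :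
    SpGroup n F →* Matrix (Fin n ⊕ Fin n) (Fin n ⊕ Fin n) F :=
  (Matrix.symplecticGroup (Fin n) F).subtype

/-- The simple root vectors `X_{α_i}`: `y_{i+1} ↦ y_i`, `y*_i ↦ -y*_{i+1}` for the first `n - 1`
indices, and `y*_n ↦ y_n` for the last one. -/
def spRootVector (n : ℕ) (F : Type*) [Field F] (i : Fin n) :
    Matrix (Fin n ⊕ Fin n) (Fin n ⊕ Fin n) F :=
  if h : i.val + 1 < n then
    Matrix.fromBlocks (Matrix.single i ⟨i.val + 1, h⟩ 1) 0 0 (-Matrix.single ⟨i.val + 1, h⟩ i 1)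
  else Matrix.fromBlocks 0 (Matrix.single i i 1) 0 0

/-- The root vectors `X_{-α_i}`; these are the transposes of the `X_{α_i}`. -/
def spNegRootVector (n : ℕ) (F : Type*) [Field F] (i : Fin n) :
    Matrix (Fin n ⊕ Fin n) (Fin n ⊕ Fin n) F :=
  (spRootVector n F i)ᵀ

/-- `H = [X_{α_i}, X_{-α_i}]` is the coroot of `α_i`: `(H, X_{α_i}, X_{-α_i})` is an
`sl₂`-triple. -/
theorem spRootVector_triple (n : ℕ) (F : Type*) [Field F] (i : Fin n)
    (H X X' : Matrix (Fin n ⊕ Fin n) (Fin n ⊕ Fin n) F)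
    (hX : X = spRootVector n F i) (hX' : X' = spNegRootVector n F i) (hH : H = X * X' - X' * X) :
    H * X - X * H = 2 • X ∧ H * X' - X' * H = -(2 • X') := by
  subst hH hX hX'
  unfold spNegRootVector spRootVector
  split_ifs with h
  · have h1 : i ≠ ⟨i.val + 1, h⟩ := fun e => by simpa using congrArg Fin.val e
    constructor
    · simp [Matrix.fromBlocks_transpose, Matrix.fromBlocks_multiply, h1, h1.symm,
        mul_sub, sub_mul, two_smul]
    · simp [Matrix.fromBlocks_transpose, Matrix.fromBlocks_multiply, h1, h1.symm,
        mul_sub, sub_mul, two_smul]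
      ext (a | a) (b | b) <;> simp <;> ring
  · constructor
    · simp [Matrix.fromBlocks_transpose, Matrix.fromBlocks_multiply,
        mul_sub, sub_mul, two_smul]
    · simp [Matrix.fromBlocks_transpose, Matrix.fromBlocks_multiply,
        mul_sub, sub_mul, two_smul]
      ext (a | a) (b | b) <;> simp <;> ring

theorem spRootVector_sq (n : ℕ) (F : Type*) [Field F] (i : Fin n) : spRootVector n F i ^ 2 = 0 := by
  unfold spRootVector
  split_ifs with h
  · have h1 : i ≠ ⟨i.val + 1, h⟩ := fun e => by simpa using congrArg Fin.val e
    simp [pow_two, Matrix.fromBlocks_multiply, h1, h1.symm]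
  · simp [pow_two, Matrix.fromBlocks_multiply]

theorem spRootVector_mul_J (n : ℕ) (F : Type*) [Field F] (i : Fin n) :
    spRootVector n F i * Matrix.J (Fin n) F = -(Matrix.J (Fin n) F * (spRootVector n F i)ᵀ) := by
  unfold spRootVector
  split_ifs with h <;>
    simp [Matrix.J, Matrix.fromBlocks_multiply, Matrix.fromBlocks_transpose, Matrix.fromBlocks_neg]

theorem spNegRootVector_mul_J (n : ℕ) (F : Type*) [Field F] (i : Fin n) :
    spNegRootVector n F i * Matrix.J (Fin n) F =
      -(Matrix.J (Fin n) F * (spNegRootVector n F i)ᵀ) := by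
  unfold spNegRootVector spRootVector
  split_ifs with h <;>
    simp [Matrix.J, Matrix.fromBlocks_multiply, Matrix.fromBlocks_transpose, Matrix.fromBlocks_neg]

theorem exp_mem_symplecticGroup {n : ℕ} {F : Type*} [Field F] [CharZero F]
    (X : Matrix (Fin n ⊕ Fin n) (Fin n ⊕ Fin n) F) (h2 : X ^ 2 = 0)
    (hJ : X * Matrix.J (Fin n) F = -(Matrix.J (Fin n) F * Xᵀ)) :
    IsNilpotent.exp X ∈ Matrix.symplecticGroup (Fin n) F := by
  rw [SymplecticGroup.mem_iff, exp_eq_of_cube_eq_zero X (by rw [pow_succ, h2, zero_mul]), h2]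
  have h2' : Xᵀ * Xᵀ = 0 := by rw [← Matrix.transpose_mul, ← pow_two, h2, Matrix.transpose_zero]
  simp only [smul_zero, add_zero, Matrix.transpose_add, Matrix.transpose_one, add_mul, mul_add,
    one_mul, mul_one, hJ, neg_mul, Matrix.mul_assoc, h2', mul_zero]
  abel

/-- `ω_i = exp(X_{α_i}) exp(-X_{-α_i}) exp(X_{α_i})` in `Sp(W)`. -/
noncomputable def spOmega (n : ℕ) (F : Type*) [Field F] [CharZero F] (i : Fin n) : SpGroup n F :=
  ⟨tripleExp (spRootVector n F i) (spNegRootVector n F i), by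
    have h := exp_mem_symplecticGroup _ (spRootVector_sq n F i) (spRootVector_mul_J n F i)
    refine mul_mem (mul_mem h (exp_mem_symplecticGroup _ ?_ ?_)) h
    · rw [neg_sq, spNegRootVector, ← Matrix.transpose_pow, spRootVector_sq, Matrix.transpose_zero]
    · rw [neg_mul, spNegRootVector_mul_J, Matrix.transpose_neg, mul_neg]⟩

/-- The diagonal maximal torus `T_W`. -/
def spTorus (n : ℕ) (F : Type*) [Field F] : Subgroup (SpGroup n F) :=
  blockSubgroup (spMatrix n F) id

/-- Labels of the basis vectors for the decomposition `W = Y_k ⊕ W_{n-k} ⊕ Y_k^*`. -/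
def spLabel (n k : ℕ) : Fin n ⊕ Fin n → Fin 3
  | Sum.inl i => if i.val < k then 0 else 1
  | Sum.inr i => if i.val < k then 2 else 1

/-- The Levi subgroup `GL(Y_k) × Sp(W_{n-k})` of the stabilizer of `Y_k` in `Sp(W)`. -/
def spLevi (n k : ℕ) (F : Type*) [Field F] : Subgroup (SpGroup n F) :=
  blockSubgroup (spMatrix n F) (spLabel n k)

end Symplectic

/-! ### The metaplectic group `Mp(W)` -/

section Metaplectic

open Classical in
/-- The quadratic Hilbert symbol `(a, b)_F` of nonzero elements of a local field `F`. -/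
noncomputable def hilbertSymbol {F : Type*} [Field F] (a b : F) : ℤˣ :=
  if ∃ x y z : F, (x ≠ 0 ∨ y ≠ 0 ∨ z ≠ 0) ∧ z ^ 2 = a * x ^ 2 + b * y ^ 2 then 1 else -1

/-- The matrix of `σ_S`: `y_i ↦ y*_i`, `y*_i ↦ -y_i` for `i ∈ S`, the other basis vectors being
fixed. -/
def sigmaMatrix {n : ℕ} (F : Type*) [Field F] (S : Finset (Fin n)) :
    Matrix (Fin n ⊕ Fin n) (Fin n ⊕ Fin n) F :=
  Matrix.fromBlocks (Matrix.diagonal fun i => if i ∈ S then 0 else 1)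
    (Matrix.diagonal fun i => if i ∈ S then -1 else 0)
    (Matrix.diagonal fun i => if i ∈ S then 1 else 0)
    (Matrix.diagonal fun i => if i ∈ S then 0 else 1)

/-- The Siegel parabolic subgroup `P_n`, the stabilizer of `Y_n`. -/
def siegelParabolic (n : ℕ) (F : Type*) [Field F] : Set (SpGroup n F) :=
  {p | (spMatrix n F p).toBlocks₂₁ = 0}

/-- Ranga Rao's `x`-function: `x(p₁ σ_S p₂) = det(p₁ p₂ | Y_n)` for `p₁, p₂ ∈ P_n`.  It is
well defined up to nonzero squares; this is a representative. -/
noncomputable def raoX {n : ℕ} {F : Type*} [Field F] (g : SpGroup n F) : F :=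
  Classical.epsilon fun x => ∃ p₁ ∈ siegelParabolic n F, ∃ p₂ ∈ siegelParabolic n F,
    ∃ S : Finset (Fin n), spMatrix n F g = spMatrix n F p₁ * sigmaMatrix F S * spMatrix n F p₂ ∧
      x = (spMatrix n F (p₁ * p₂)).toBlocks₁₁.det

/-- The number `j(g) = |S|` for `g ∈ P_n σ_S P_n`, i.e. the rank of the block `Y_n → Y_n^*`. -/
noncomputable def raoJ {n : ℕ} {F : Type*} [Field F] (g : SpGroup n F) : ℕ :=
  (spMatrix n F g).toBlocks₂₁.rank

/-- The symplectic form of `W`, with `⟨y_i, y*_j⟩ = δ_ij`. -/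
def sympForm {n : ℕ} {F : Type*} [Field F] (v w : Fin n ⊕ Fin n → F) : F :=
  ∑ i, (v (Sum.inl i) * w (Sum.inr i) - v (Sum.inr i) * w (Sum.inl i))

/-- The Lagrangian subspace `Y_n = span(y_1, …, y_n)`. -/
def lagrangianY (n : ℕ) (F : Type*) [Field F] : Submodule F (Fin n ⊕ Fin n → F) :=
  Submodule.span F (Set.range fun i : Fin n => Pi.single (Sum.inl i) (1 : F))

/-- The Lagrangian subspace `g Y_n`. -/
noncomputable def translateY {n : ℕ} {F : Type*} [Field F] (g : SpGroup n F) :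
    Submodule F (Fin n ⊕ Fin n → F) :=
  (lagrangianY n F).map (Matrix.toLin' (spMatrix n F g))

/-- The space `D = Y_n ∩ (g₁⁻¹ Y_n + g₂ Y_n)`. -/
noncomputable def leraySpace {n : ℕ} {F : Type*} [Field F] (g₁ g₂ : SpGroup n F) :
    Submodule F (Fin n ⊕ Fin n → F) :=
  lagrangianY n F ⊓ (translateY g₁⁻¹ ⊔ translateY g₂)

/-- The Leray invariant of the Lagrangians `(g₁⁻¹ Y_n, Y_n, g₂ Y_n)` is the nondegenerate quotient
of the symmetric bilinear form `B(v, v') = ⟨a, v'⟩` on `D = Y_n ∩ (g₁⁻¹ Y_n + g₂ Y_n)`,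
where `v = a + b` with `a ∈ g₁⁻¹ Y_n`, `b ∈ g₂ Y_n`.
`d` lists the diagonal values `B(v_i, v_i)` for some `B`-orthogonal basis of `D`; the nonzero ones
give a diagonalization of the Leray invariant. -/
def IsLerayDiagonalization {n : ℕ} {F : Type*} [Field F] (g₁ g₂ : SpGroup n F)
    (d : Fin (Module.finrank F (leraySpace g₁ g₂)) → F) : Prop :=
  ∃ (v : Module.Basis (Fin (Module.finrank F (leraySpace g₁ g₂))) F (leraySpace g₁ g₂))
    (a b : Fin (Module.finrank F (leraySpace g₁ g₂)) → (Fin n ⊕ Fin n → F)),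
    (∀ i, a i ∈ translateY g₁⁻¹ ∧ b i ∈ translateY g₂ ∧
      (v i : Fin n ⊕ Fin n → F) = a i + b i) ∧
    ∀ i j, sympForm (a i) (v j : Fin n ⊕ Fin n → F) = if i = j then d i else 0

/-- A diagonalization of the Leray invariant, padded by zeros for the radical. -/
noncomputable def lerayDiagonal {n : ℕ} {F : Type*} [Field F] (g₁ g₂ : SpGroup n F) :
    Fin (Module.finrank F (leraySpace g₁ g₂)) → F :=
  Classical.epsilon fun d => IsLerayDiagonalization g₁ g₂ d

open Classical in
/-- The rank of the Leray invariant. -/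
noncomputable def lerayRank {n : ℕ} {F : Type*} [Field F] (g₁ g₂ : SpGroup n F) : ℕ :=
  (Finset.univ.filter fun i => lerayDiagonal g₁ g₂ i ≠ 0).card

open Classical in
/-- The determinant of the Leray invariant (a representative modulo squares). -/
noncomputable def lerayDet {n : ℕ} {F : Type*} [Field F] (g₁ g₂ : SpGroup n F) : F :=
  ∏ i, if lerayDiagonal g₁ g₂ i ≠ 0 then lerayDiagonal g₁ g₂ i else 1

open Classical in
/-- The Hasse invariant `∏_{i < j} (d_i, d_j)_F` of the Leray invariant. -/
noncomputable def lerayHasse {n : ℕ} {F : Type*} [Field F] (g₁ g₂ : SpGroup n F) : ℤˣ :=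
  ∏ i, ∏ j, if i < j ∧ lerayDiagonal g₁ g₂ i ≠ 0 ∧ lerayDiagonal g₁ g₂ j ≠ 0 then
    hilbertSymbol (lerayDiagonal g₁ g₂ i) (lerayDiagonal g₁ g₂ j) else 1

/-- The number `l = (j(g₁) + j(g₂) - j(g₁ g₂) - rank) / 2`, where the rank is that of the Leray
invariant; the quotient is always a nonnegative integer. -/
noncomputable def raoL {n : ℕ} {F : Type*} [Field F] (g₁ g₂ : SpGroup n F) : ℕ :=
  (raoJ g₁ + raoJ g₂ - raoJ (g₁ * g₂) - lerayRank g₁ g₂) / 2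

/-- Ranga Rao's normalized cocycle on `Sp(W)`:
`c(g₁, g₂) = (x(g₁), x(g₂)) (-x(g₁) x(g₂), x(g₁ g₂)) ((-1)^l, det q) (-1, -1)^{l(l-1)/2} h(q)`,
where `q` is the Leray invariant and `h(q)` its Hasse invariant. -/
noncomputable def raoCocycle {n : ℕ} {F : Type*} [Field F] (g₁ g₂ : SpGroup n F) : ℤˣ :=
  hilbertSymbol (raoX g₁) (raoX g₂) * hilbertSymbol (-(raoX g₁ * raoX g₂)) (raoX (g₁ * g₂)) *
    hilbertSymbol ((-1) ^ raoL g₁ g₂) (lerayDet g₁ g₂) *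
    hilbertSymbol (-1 : F) (-1) ^ (raoL g₁ g₂ * (raoL g₁ g₂ - 1) / 2) * lerayHasse g₁ g₂

/-- The set `Mp(W) = Sp(W) × {±1}`. -/
@[ext]
structure MpGroup (n : ℕ) (F : Type*) [Field F] where
  /-- The image in `Sp(W)`. -/
  toSp : SpGroup n F
  /-- The sign. -/
  sign : ℤˣ

noncomputable instance (n : ℕ) (F : Type*) [Field F] : One (MpGroup n F) := ⟨⟨1, 1⟩⟩

/-- The group law `(g, ε) (g', ε') = (g g', ε ε' c(g, g'))` of `Mp(W)`. -/
noncomputable instance (n : ℕ) (F : Type*) [Field F] : Mul (MpGroup n F) :=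
  ⟨fun a b => ⟨a.toSp * b.toSp, a.sign * b.sign * raoCocycle a.toSp b.toSp⟩⟩

/-- `g` is a Langlands–Shelstad representative in `Mp(W)` of the nontrivial element of the relative
Weyl group of the Levi subgroup of the stabilizer of `Y_k`: the product
`(ω_{i_1}, 1) ⋯ (ω_{i_ℓ}, 1)` over a reduced decomposition `s_{i_1} ⋯ s_{i_ℓ}` of the element `w_T`
of the Weyl group that represents it and stabilizes the simple roots inside the Levi subgroup (all
simple roots but the `k`-th). -/
def IsLSRepresentativeMp (n k : ℕ) (F : Type*) [Field F] [CharZero F] (g : MpGroup n F) : Prop :=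
  ∃ ν : SpGroup n F,
    RepresentsRelativeWeylElement (spMatrix n F) (spTorus n F) (spLevi n k F)
      (spRootVector n F) {i | i.val + 1 ≠ k} ν ∧
    ∃ l : List (Fin n), IsReducedDecomposition (spTorus n F) (spOmega n F) l ν ∧
      g = (l.map fun i => (⟨spOmega n F i, 1⟩ : MpGroup n F)).prod

/-- The `k × k` matrix `J` with entries `(-1)^{n+1}, …, (-1)^{n+k}` on the antidiagonal, from the
top right to the bottom left, extended by zero to an `n × n` matrix. -/
def antidiagJ (n k : ℕ) (F : Type*) [Field F] : Matrix (Fin n) (Fin n) F :=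
  Matrix.of fun i j => if i.val + j.val + 1 = k then (-1) ^ (n + i.val + 1) else 0

/-- The projection killing the first `k` coordinates of `F^n`. -/
def lastProj (n k : ℕ) (F : Type*) [Field F] : Matrix (Fin n) (Fin n) F :=
  Matrix.diagonal fun i => if i.val < k then 0 else 1

/-- The matrix `(-1)^k [[0, 0, -J I_Y], [0, 1, 0], [J I_Y⁻¹, 0, 0]]` relative to
`W = Y_k ⊕ W_{n-k} ⊕ Y_k^*`. -/
def wMMatrix (n k : ℕ) (F : Type*) [Field F] : Matrix (Fin n ⊕ Fin n) (Fin n ⊕ Fin n) F :=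
  (-1 : F) ^ k • Matrix.fromBlocks (lastProj n k F) (-antidiagJ n k F)
    (antidiagJ n k F) (lastProj n k F)

end Metaplectic

/-! ### The odd special orthogonal groups `SO(V)`

`V = F^(2n+1)` with basis `x_1, …, x_n, x_0, x*_1, …, x*_n`: `x_i` is the standard vector with index
`Sum.inl i`, `x_0` the one with index `Sum.inr (Sum.inl ())`, `x*_i` the one with index
`Sum.inr (Sum.inr i)`. -/

section Orthogonal

/-- The index set of the basis of `V`. -/
abbrev OrthIndex (n : ℕ) := Fin n ⊕ (Unit ⊕ Fin n)

/-- The index of `x_i`. -/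
abbrev ix {n : ℕ} (i : Fin n) : OrthIndex n := Sum.inl i

/-- The index of `x_0`. -/
abbrev ix0 {n : ℕ} : OrthIndex n := Sum.inr (Sum.inl ())

/-- The index of `x*_i`. -/
abbrev ixs {n : ℕ} (i : Fin n) : OrthIndex n := Sum.inr (Sum.inr i)

/-- `SO(V) = O(V) ∩ SL(V)` for the quadratic form `q` on `V`. -/
def SOGroup {n : ℕ} {F : Type*} [Field F] (q : QuadraticForm F (OrthIndex n → F)) :
    Subgroup (Matrix.SpecialLinearGroup (OrthIndex n) F) where
  carrier := {h | ∀ v, q ((h : Matrix (OrthIndex n) (OrthIndex n) F) *ᵥ v) = q v}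
  one_mem' := by intro v; simp
  mul_mem' := by
    intro a b ha hb v
    rw [Matrix.SpecialLinearGroup.coe_mul, ← Matrix.mulVec_mulVec, ha, hb]
  inv_mem' := by
    intro a ha v
    rw [← ha, Matrix.mulVec_mulVec, ← Matrix.SpecialLinearGroup.coe_mul, mul_inv_cancel,
      Matrix.SpecialLinearGroup.coe_one, Matrix.one_mulVec]

/-- `SO(V)` as a group of matrices. -/
def soMatrix {n : ℕ} {F : Type*} [Field F] (q : QuadraticForm F (OrthIndex n → F)) :
    SOGroup q →* Matrix (OrthIndex n) (OrthIndex n) F where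
  toFun h := ((h : Matrix.SpecialLinearGroup (OrthIndex n) F) : Matrix _ _ F)
  map_one' := rfl
  map_mul' _ _ := rfl

/-- The quadratic form of the split space `V^+`: `b_q(x_i, x*_j) = δ_ij`, `q(x_0) = 1`, all other
pairs of basis vectors being orthogonal. -/
def splitForm (n : ℕ) (F : Type*) [Field F] : QuadraticForm F (OrthIndex n → F) :=
  ∑ i : Fin n, QuadraticMap.linMulLin (LinearMap.proj (ix i)) (LinearMap.proj (ixs i)) +
    QuadraticMap.linMulLin (LinearMap.proj ix0) (LinearMap.proj ix0)

/-- The Gram matrix of `b_q(v, v') = q(v + v') - q(v) - q(v')`. -/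
def gramMatrix {n : ℕ} {F : Type*} [Field F] (q : QuadraticForm F (OrthIndex n → F)) :
    Matrix (OrthIndex n) (OrthIndex n) F :=
  Matrix.of fun a b => QuadraticMap.polar q (Pi.single a 1) (Pi.single b 1)

/-- The simple root vectors `X_{β_i}`: `x_{i+1} ↦ x_i`, `x*_i ↦ -x*_{i+1}` for the first `n - 1`
indices, and `x_0 ↦ 2 x_n`, `x*_n ↦ -x_0` for the last one. -/
def soRootVector (n : ℕ) (F : Type*) [Field F] (i : Fin n) :
    Matrix (OrthIndex n) (OrthIndex n) F :=
  if h : i.val + 1 < n then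
    Matrix.single (ix i) (ix ⟨i.val + 1, h⟩) 1 - Matrix.single (ixs ⟨i.val + 1, h⟩) (ixs i) 1
  else Matrix.single (ix i) ix0 2 - Matrix.single ix0 (ixs i) 1

/-- The root vectors `X_{-β_i}`: `x_i ↦ x_{i+1}`, `x*_{i+1} ↦ -x*_i` for the first `n - 1`
indices, and `x_n ↦ x_0`, `x_0 ↦ -2 x*_n` for the last one. -/
def soNegRootVector (n : ℕ) (F : Type*) [Field F] (i : Fin n) :
    Matrix (OrthIndex n) (OrthIndex n) F :=
  if h : i.val + 1 < n then
    Matrix.single (ix ⟨i.val + 1, h⟩) (ix i) 1 - Matrix.single (ixs i) (ixs ⟨i.val + 1, h⟩) 1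
  else Matrix.single ix0 (ix i) 1 - Matrix.single (ixs i) ix0 2

/-- `H = [X_{β_i}, X_{-β_i}]` is the coroot of `β_i`: `(H, X_{β_i}, X_{-β_i})` is an
`sl₂`-triple. -/
theorem soRootVector_triple (n : ℕ) (F : Type*) [Field F] (i : Fin n)
    (H X X' : Matrix (OrthIndex n) (OrthIndex n) F)
    (hX : X = soRootVector n F i) (hX' : X' = soNegRootVector n F i) (hH : H = X * X' - X' * X) :
    H * X - X * H = 2 • X ∧ H * X' - X' * H = -(2 • X') := by
  subst hH hX hX'
  unfold soNegRootVector soRootVector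
  split_ifs with h
  · have h1 : i ≠ ⟨i.val + 1, h⟩ := fun e => by simpa using congrArg Fin.val e
    constructor
    · simp [h1, h1.symm, mul_sub, sub_mul, mul_add, add_mul, two_smul]
      abel
    · simp [h1, h1.symm, mul_sub, sub_mul, mul_add, add_mul, two_smul]
      abel
  · constructor
    · ext a b
      simp [mul_sub, sub_mul, mul_add, add_mul, two_smul, Matrix.single_apply]
      split_ifs <;> norm_num
    · ext a b
      simp [mul_sub, sub_mul, mul_add, add_mul, two_smul, Matrix.single_apply]
      split_ifs <;> norm_num

theorem soRootVector_cube (n : ℕ) (F : Type*) [Field F] (i : Fin n) :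
    soRootVector n F i ^ 3 = 0 ∧ soNegRootVector n F i ^ 3 = 0 := by
  unfold soRootVector soNegRootVector
  split_ifs with h
  · have h1 : i ≠ ⟨i.val + 1, h⟩ := fun e => by simpa using congrArg Fin.val e
    constructor <;> simp [pow_succ, mul_sub, sub_mul, h1, h1.symm]
  · constructor <;> simp [pow_succ, mul_sub, sub_mul]

theorem splitForm_apply {n : ℕ} {F : Type*} [Field F] (v : OrthIndex n → F) :
    splitForm n F v = ∑ i, v (ix i) * v (ixs i) + v ix0 * v ix0 := by
  simp [splitForm]

theorem polar_splitForm {n : ℕ} {F : Type*} [Field F] (v w : OrthIndex n → F) :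
    QuadraticMap.polar (splitForm n F) v w =
      ∑ i, (v (ix i) * w (ixs i) + v (ixs i) * w (ix i)) + 2 * (v ix0 * w ix0) := by
  simp only [QuadraticMap.polar, splitForm_apply, Pi.add_apply]
  have : ∀ i : Fin n, (v (ix i) + w (ix i)) * (v (ixs i) + w (ixs i)) =
      v (ix i) * v (ixs i) + w (ix i) * w (ixs i) +
        (v (ix i) * w (ixs i) + v (ixs i) * w (ix i)) := fun i => by ring
  simp only [this, Finset.sum_add_distrib]
  ring

theorem polar_soRootVector {n : ℕ} {F : Type*} [Field F] (i : Fin n) (v : OrthIndex n → F) :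
    QuadraticMap.polar (splitForm n F) (soRootVector n F i *ᵥ v) v = 0 ∧
      QuadraticMap.polar (splitForm n F) (soNegRootVector n F i *ᵥ v) v = 0 := by
  unfold soRootVector soNegRootVector
  split_ifs with h
  · constructor <;>
    · simp [polar_splitForm, Matrix.sub_mulVec, Matrix.single_mulVec, Function.update_apply,
        Finset.sum_add_distrib, sub_mul, ite_mul]
      try ring
  · constructor <;>
    · simp [polar_splitForm, Matrix.sub_mulVec, Matrix.single_mulVec, Function.update_apply,
        Finset.sum_add_distrib, sub_mul, ite_mul]
      try ring

theorem map_exp_mulVec {n : ℕ} {F : Type*} [Field F] [CharZero F]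
    (q : QuadraticForm F (OrthIndex n → F)) (X : Matrix (OrthIndex n) (OrthIndex n) F)
    (h3 : X ^ 3 = 0) (hX : ∀ v, QuadraticMap.polar q (X *ᵥ v) v = 0) (v : OrthIndex n → F) :
    q (IsNilpotent.exp X *ᵥ v) = q v := by
  have hskew : ∀ v w, QuadraticMap.polar q (X *ᵥ v) w = -QuadraticMap.polar q v (X *ᵥ w) := by
    intro v w
    have h := hX (v + w)
    rw [Matrix.mulVec_add, QuadraticMap.polar_add_left, QuadraticMap.polar_add_right,
      QuadraticMap.polar_add_right, hX, hX, QuadraticMap.polar_comm q (X *ᵥ w) v] at h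
    linear_combination h
  have hself : ∀ u, q u = 2⁻¹ * QuadraticMap.polar q u u := by
    intro u
    rw [QuadraticMap.polar_self]
    simp
  have e0 : X *ᵥ (X *ᵥ (X *ᵥ v)) = 0 := by
    rw [Matrix.mulVec_mulVec, Matrix.mulVec_mulVec, ← pow_two, ← pow_succ, h3, Matrix.zero_mulVec]
  rw [exp_eq_of_cube_eq_zero X h3, Matrix.add_mulVec, Matrix.add_mulVec, Matrix.one_mulVec,
    Matrix.smul_mulVec, pow_two, ← Matrix.mulVec_mulVec, hself, hself v]
  have e1 := hX v
  have e2 := hX (X *ᵥ v)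
  have e3 := hskew v (X *ᵥ v)
  have e4 := hskew (X *ᵥ v) (X *ᵥ (X *ᵥ v))
  rw [e0, QuadraticMap.polar_zero_right] at e4
  have e5 := hskew v (X *ᵥ v)
  simp only [QuadraticMap.polar_add_left, QuadraticMap.polar_add_right,
    QuadraticMap.polar_smul_left, QuadraticMap.polar_smul_right, smul_eq_mul,
    QuadraticMap.polar_comm q v (X *ᵥ v), QuadraticMap.polar_comm q (X *ᵥ v) (X *ᵥ (X *ᵥ v)),
    QuadraticMap.polar_comm q v (X *ᵥ (X *ᵥ v))] at *
  rw [e1, e2, e4]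
  linear_combination (2⁻¹ : F) * e3

theorem det_exp_eq_one {ι F : Type*} [Fintype ι] [DecidableEq ι] [Field F] [CharZero F]
    (X : Matrix ι ι F) (h : IsNilpotent X) : (IsNilpotent.exp X).det = 1 := by
  have hN := IsNilpotent.isNilpotent_exp_sub_one h
  have h1 := Matrix.isNilpotent_charpoly_sub_pow_of_isNilpotent hN.neg
  have h2 := sub_eq_zero.mp h1.eq_zero
  have h3 := congrArg (Polynomial.eval 1) h2
  rw [Matrix.eval_charpoly] at h3
  simpa using h3

/-- `exp(X_β) exp(-X_{-β}) exp(X_β)` in `SO(V^+)` for the `i`-th simple root `β`. -/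
noncomputable def soOmega (n : ℕ) (F : Type*) [Field F] [CharZero F] (i : Fin n) :
    SOGroup (splitForm n F) :=
  ⟨⟨tripleExp (soRootVector n F i) (soNegRootVector n F i), by
      have h := soRootVector_cube n F i
      rw [tripleExp, Matrix.det_mul, Matrix.det_mul, det_exp_eq_one _ ⟨3, h.1⟩,
        det_exp_eq_one _ (IsNilpotent.neg ⟨3, h.2⟩), mul_one, mul_one]⟩, by
    intro v
    have h := soRootVector_cube n F i
    have hp := map_exp_mulVec (splitForm n F) _ h.1 fun v => (polar_soRootVector i v).1
    have hn := map_exp_mulVec (splitForm n F) (-soNegRootVector n F i)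
      (by rw [Odd.neg_pow (by decide), h.2, neg_zero])
      (fun v => by
        rw [Matrix.neg_mulVec, QuadraticMap.polar_neg_left, (polar_soRootVector i v).2, neg_zero])
    change splitForm n F (tripleExp _ _ *ᵥ v) = _
    rw [tripleExp, ← Matrix.mulVec_mulVec, ← Matrix.mulVec_mulVec, hp, hn, hp]⟩

/-- The diagonal maximal torus `T_V`. -/
def soTorus (n : ℕ) (F : Type*) [Field F] : Subgroup (SOGroup (splitForm n F)) :=
  blockSubgroup (soMatrix (splitForm n F)) id

/-- Labels of the basis vectors for the decomposition `V = X_k ⊕ V_{n-k} ⊕ X_k^*`. -/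
def soLabel (n k : ℕ) : OrthIndex n → Fin 3
  | Sum.inl i => if i.val < k then 0 else 1
  | Sum.inr (Sum.inl _) => 1
  | Sum.inr (Sum.inr i) => if i.val < k then 2 else 1

/-- The Levi subgroup `GL(X_k) × SO(V_{n-k})` of the stabilizer of `X_k` in `SO(V^+)`. -/
def soLevi (n k : ℕ) (F : Type*) [Field F] : Subgroup (SOGroup (splitForm n F)) :=
  blockSubgroup (soMatrix (splitForm n F)) (soLabel n k)

/-- `g` is a Langlands–Shelstad representative in `SO(V^+)` of the nontrivial element of the
relative Weyl group of the Levi subgroup of the stabilizer of `X_k`. -/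
def IsLSRepresentativeSO (n k : ℕ) (F : Type*) [Field F] [CharZero F]
    (g : SOGroup (splitForm n F)) : Prop :=
  ∃ ν : SOGroup (splitForm n F),
    RepresentsRelativeWeylElement (soMatrix (splitForm n F)) (soTorus n F) (soLevi n k F)
      (soRootVector n F) {i | i.val + 1 ≠ k} ν ∧
    ∃ l : List (Fin n), IsReducedDecomposition (soTorus n F) (soOmega n F) l ν ∧
      g = (l.map (soOmega n F)).prod

/-- `(V, q)` is the non-split quadratic space `V^-` of dimension `2n + 1` and discriminant `1` (the
discriminant being `(-1)^n det(½ b_q)` modulo squares), with maximal isotropic subspaces of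
dimension `r = n - 1`; the first `r` pairs `x_i, x*_i` of basis vectors are hyperbolic and
orthogonal to each other and to `x_n, x_0, x*_n`. -/
structure IsNonsplitSpace {n : ℕ} {F : Type*} [Field F]
    (q : QuadraticForm F (OrthIndex n → F)) : Prop where
  nondegenerate : (gramMatrix q).det ≠ 0
  discriminant : IsSquare ((-1) ^ n * ((2⁻¹ : F) • gramMatrix q).det)
  isotropic : ∀ U : Submodule F (OrthIndex n → F), (∀ v ∈ U, q v = 0) →
    Module.finrank F U + 1 ≤ n
  basis_left : ∀ (i : Fin n) (a : OrthIndex n), i.val + 1 < n →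
    gramMatrix q (ix i) a = if a = ixs i then 1 else 0
  basis_right : ∀ (i : Fin n) (a : OrthIndex n), i.val + 1 < n →
    gramMatrix q (ixs i) a = if a = ix i then 1 else 0

/-- `f` is an isometry `V^+ → V` over an algebraic closure, given by a matrix in the chosen bases,
which is the identity on `X_k ⊕ X_k^*` and whose associated cocycle `σ ↦ f⁻¹ σ(f)` takes values
in `SO(V^+)`: the pure inner twist `ξ : SO(V^+) → SO(V)`, `h ↦ f h f⁻¹`. -/
structure IsPureInnerTwist {n : ℕ} (k : ℕ) {F : Type*} [Field F]
    (q : QuadraticForm F (OrthIndex n → F))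
    (f : Matrix (OrthIndex n) (OrthIndex n) (AlgebraicClosure F)) : Prop where
  isometry : fᵀ * (gramMatrix q).map (algebraMap F (AlgebraicClosure F)) * f =
    (gramMatrix (splitForm n F)).map (algebraMap F (AlgebraicClosure F))
  map_X : ∀ i : Fin n, i.val < k → f *ᵥ Pi.single (ix i) 1 = Pi.single (ix i) 1
  map_Xs : ∀ i : Fin n, i.val < k → f *ᵥ Pi.single (ixs i) 1 = Pi.single (ixs i) 1
  cocycle : ∀ σ : AlgebraicClosure F ≃ₐ[F] AlgebraicClosure F, (f⁻¹ * f.map σ).det = 1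

/-- `g` is a Langlands–Shelstad representative in `SO(V)`, `V = V^-`: it corresponds to one in
`SO(V^+)` via the pure inner twist. -/
def IsLSRepresentativeNonsplit (n k : ℕ) {F : Type*} [Field F] [CharZero F]
    (q : QuadraticForm F (OrthIndex n → F)) (g : SOGroup q) : Prop :=
  ∃ f : Matrix (OrthIndex n) (OrthIndex n) (AlgebraicClosure F), IsPureInnerTwist k q f ∧
    ∃ g₀ : SOGroup (splitForm n F), IsLSRepresentativeSO n k F g₀ ∧
      f * (soMatrix _ g₀).map (algebraMap F (AlgebraicClosure F)) =
        (soMatrix q g).map (algebraMap F (AlgebraicClosure F)) * f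

/-- The matrix `(-1)^k [[0, 0, J I_X], [0, 1, 0], [J I_X⁻¹, 0, 0]]` relative to
`V = X_k ⊕ V_{n-k} ⊕ X_k^*`. -/
def wLMatrix (n k : ℕ) (F : Type*) [Field F] : Matrix (OrthIndex n) (OrthIndex n) F :=
  (-1 : F) ^ k • Matrix.fromBlocks (lastProj n k F) (Matrix.fromCols 0 (antidiagJ n k F))
    (Matrix.fromRows 0 (antidiagJ n k F)) (Matrix.fromBlocks 1 0 0 (lastProj n k F))

end Orthogonal

/-! Order the basis of `W` as y_1, …, y_n, y*_n, …, y*_1. The Weyl group acts by permutations that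
commute with y_i ↔ y*_i, and each Langlands–Shelstad letter is a monomial matrix over a simple
reflection. Everything is therefore a computation of a permutation and of the signs attached to it.

Signs in `Sp(W)`. In GL_{2n} the product of simple representatives along a reduced word has, at a
basis vector, the sign given by the number of inversions starting there, because a reduced word
never undoes an inversion. Rescaling the y*_i by `starSign` reduces `Sp(W)` to this case. The
coefficients thus depend only on the permutation (`spMatrix_prod_spOmega`), which gives independence
of the word without braid relations. In the split orthogonal group a further sign counts starred
vectors made unstarred, and x_0 changes sign once for each use of the last reflection
(`soMatrix_prod_soOmega`).

The Weyl element. A normalizer element of the torus is monomial, by conjugating a regular diagonal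
element. Permuting the simple roots of the Levi subgroup forces y_{k+1}, …, y_n to stay fixed and
y_1, …, y_k to go to consecutive depths within one half; only the identity and `weylPerm` remain
(`eq_inl_or_eq_weylPerm`), and the identity lies in the Levi subgroup. Evaluating the coefficients
at `weylPerm` gives the displayed matrices.

The metaplectic sign. Translates of Y_n by monomial elements are coordinate Lagrangians, so every
Leray form that occurs vanishes, and so does l; Rao's cocycle is reduced to two Hilbert symbols
(`raoCocycle_eq`). Modulo squares x is (-1)^m, with m the number of y_j sent to starred vectors.
Only the letter of the long root contributes, by (-1,-1)^m, and m runs through 0, …, k-1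
(`prod_spOmega_mp`).

The nonsplit space. Over the algebraic closure the two forms are isometric by a map that is the
identity on X ⊕ X^*. Equal discriminants put its determinant in F, so the cocycle has determinant
one. The split representative is the scalar (-1)^k on V_{n-k}, hence it commutes with every such map
and has the same matrix in both groups. -/

/-! ### Combinatorics of the hyperoctahedral group -/

section SignedPermutations

variable {n : ℕ}

/-- The depth of a basis vector in the ordering `y_1, …, y_n, y*_n, …, y*_1`. -/
def depth (p : Fin n ⊕ Fin n) : ℤ :=
  Sum.elim (fun i => (i.val : ℤ)) (fun i => 2 * n - 1 - i.val) p

@[simp] theorem depth_inl (i : Fin n) : depth (Sum.inl i : Fin n ⊕ Fin n) = i.val := rfl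

@[simp] theorem depth_inr (i : Fin n) :
    depth (Sum.inr i : Fin n ⊕ Fin n) = 2 * n - 1 - i.val := rfl

theorem depth_swap (p : Fin n ⊕ Fin n) : depth p.swap = 2 * n - 1 - depth p := by
  rcases p with i | i <;> simp

theorem depth_nonneg (p : Fin n ⊕ Fin n) : 0 ≤ depth p := by
  rcases p with i | i <;> simp; omega

theorem depth_lt (p : Fin n ⊕ Fin n) : depth p < 2 * n := by
  rcases p with i | i <;> simp <;> omega

theorem depth_injective : Function.Injective (depth : Fin n ⊕ Fin n → ℤ) := by
  rintro (i | i) (j | j) h <;> simp only [depth_inl, depth_inr] at h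
  · rw [Fin.ext (by omega : i.val = j.val)]
  · omega
  · omega
  · rw [Fin.ext (by omega : i.val = j.val)]

/-- The basis vector following `y_i`. -/
def below (i : Fin n) : Fin n ⊕ Fin n :=
  if h : i.val + 1 < n then Sum.inl ⟨i.val + 1, h⟩ else Sum.inr i

@[simp] theorem depth_below (i : Fin n) : depth (below i) = i.val + 1 := by
  unfold below
  split_ifs with h
  · simp
  · simp; omega

/-- The simple reflections of the hyperoctahedral group. -/
def simpleRefl (i : Fin n) : Equiv.Perm (Fin n ⊕ Fin n) :=
  if h : i.val + 1 < n then
    Equiv.sumCongr (Equiv.swap i ⟨i.val + 1, h⟩) (Equiv.swap i ⟨i.val + 1, h⟩)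
  else Equiv.swap (Sum.inl i) (Sum.inr i)

/-- In terms of depth, both kinds of simple reflection exchange i with i+1 and the mirror images of
these depths. For the last index the two pairs coincide and the cases agree. This turns identities
of signed permutations into linear arithmetic. -/
theorem depth_simpleRefl (i : Fin n) (p : Fin n ⊕ Fin n) :
    depth (simpleRefl i p) =
      if depth p = i.val then (i.val : ℤ) + 1 else if depth p = i.val + 1 then (i.val : ℤ)
      else if depth p = 2 * n - 1 - i.val then 2 * n - 2 - (i.val : ℤ)
      else if depth p = 2 * n - 2 - i.val then 2 * n - 1 - (i.val : ℤ) else depth p := by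
  unfold simpleRefl
  split_ifs with h <;> rcases p with j | j <;>
    simp only [Equiv.sumCongr_apply, Sum.map_inl, Sum.map_inr, Equiv.swap_apply_def, Fin.ext_iff,
      depth_inl, depth_inr, Sum.inl.injEq, Sum.inr.injEq, reduceCtorEq, if_false] at * <;>
    split_ifs <;> (try simp only [depth_inl, depth_inr]) <;> omega

theorem simpleRefl_swap (i : Fin n) (p : Fin n ⊕ Fin n) :
    simpleRefl i p.swap = (simpleRefl i p).swap := by
  apply depth_injective
  simp only [depth_simpleRefl, depth_swap]
  split_ifs <;> omega

theorem simpleRefl_mul_self (i : Fin n) : simpleRefl i * simpleRefl i = 1 := by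
  ext1 p
  apply depth_injective
  simp only [Equiv.Perm.mul_apply, Equiv.Perm.one_apply, depth_simpleRefl]
  split_ifs <;> omega

theorem simpleRefl_inv (i : Fin n) : (simpleRefl i)⁻¹ = simpleRefl i :=
  inv_eq_of_mul_eq_one_right (simpleRefl_mul_self i)

theorem simpleRefl_simpleRefl (i : Fin n) (p : Fin n ⊕ Fin n) :
    simpleRefl i (simpleRefl i p) = p := by
  rw [← Equiv.Perm.mul_apply, simpleRefl_mul_self, Equiv.Perm.one_apply]

theorem simpleRefl_eq_iff (i : Fin n) (p q : Fin n ⊕ Fin n) :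
    q = simpleRefl i p ↔ (p = Sum.inl i ∧ q = below i) ∨ (p = below i ∧ q = Sum.inl i) ∨
      (p = Sum.inr i ∧ q = (below i).swap) ∨ (p = (below i).swap ∧ q = Sum.inr i) ∨
      (p ≠ Sum.inl i ∧ p ≠ below i ∧ p ≠ Sum.inr i ∧ p ≠ (below i).swap ∧ q = p) := by
  simp only [← depth_injective.eq_iff, ne_eq, depth_simpleRefl, depth_inl, depth_inr, depth_below,
    depth_swap]
  split_ifs <;> omega

/-- The signed permutation given by a word in the simple reflections. -/
def wordPerm (l : List (Fin n)) : Equiv.Perm (Fin n ⊕ Fin n) := (l.map simpleRefl).prod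

@[simp] theorem wordPerm_nil : wordPerm ([] : List (Fin n)) = 1 := rfl

@[simp] theorem wordPerm_cons (i : Fin n) (l : List (Fin n)) :
    wordPerm (i :: l) = simpleRefl i * wordPerm l := by simp [wordPerm]

theorem wordPerm_append (l l' : List (Fin n)) :
    wordPerm (l ++ l') = wordPerm l * wordPerm l' := by simp [wordPerm]

theorem wordPerm_swap (l : List (Fin n)) (p : Fin n ⊕ Fin n) :
    wordPerm l p.swap = (wordPerm l p).swap := by
  induction l with
  | nil => rfl
  | cons i l ih => simp [ih, simpleRefl_swap]

theorem wordPerm_inv_swap (l : List (Fin n)) (p : Fin n ⊕ Fin n) :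
    (wordPerm l)⁻¹ p.swap = ((wordPerm l)⁻¹ p).swap := by
  rw [Equiv.Perm.inv_eq_iff_eq, wordPerm_swap, ← Equiv.Perm.mul_apply, mul_inv_cancel,
    Equiv.Perm.one_apply]

/-- A word is reduced if no shorter word gives the same signed permutation. -/
def IsReducedWord (l : List (Fin n)) : Prop :=
  ∀ l' : List (Fin n), wordPerm l' = wordPerm l → l.length ≤ l'.length

/-- The length of `w` increases under multiplication by the `i`-th simple reflection on
the left: `w⁻¹` maps the `i`-th simple root to a positive root. -/
def IsAscent (i : Fin n) (w : Equiv.Perm (Fin n ⊕ Fin n)) : Prop :=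
  depth (w⁻¹ (Sum.inl i)) < depth (w⁻¹ (below i))

/-- Apply the letters to the pair one after another. The order is reversed at some letter, and a
simple reflection reverses two depths only when it exchanges these neighbours: either j, j+1 or the
mirror pair. -/
theorem exists_flip_of_depth_lt (l : List (Fin n)) (a b : Fin n ⊕ Fin n) (hab : depth a < depth b)
    (h : depth ((wordPerm l)⁻¹ b) < depth ((wordPerm l)⁻¹ a)) :
    ∃ l₁ j l₂, l = l₁ ++ j :: l₂ ∧
      ((a = wordPerm l₁ (Sum.inl j) ∧ b = wordPerm l₁ (below j)) ∨
        (a = wordPerm l₁ (below j).swap ∧ b = wordPerm l₁ (Sum.inr j))) := by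
  induction l generalizing a b with
  | nil => simp at h; omega
  | cons j l ih =>
    rw [wordPerm_cons, mul_inv_rev, simpleRefl_inv, Equiv.Perm.mul_apply, Equiv.Perm.mul_apply] at h
    by_cases hj : depth (simpleRefl j a) < depth (simpleRefl j b)
    · obtain ⟨l₁, i, l₂, rfl, H⟩ := ih _ _ hj h
      refine ⟨j :: l₁, i, l₂, rfl, ?_⟩
      simp only [wordPerm_cons, Equiv.Perm.mul_apply]
      rcases H with ⟨h1, h2⟩ | ⟨h1, h2⟩ <;>
      simp [← h1, ← h2, simpleRefl_simpleRefl]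
    · refine ⟨[], j, l, rfl, ?_⟩
      simp only [wordPerm_nil, Equiv.Perm.one_apply, ← depth_injective.eq_iff, depth_swap,
        depth_inl, depth_inr, depth_below]
      simp only [depth_simpleRefl] at hj
      split_ifs at hj <;> omega

/-- A conjugate of a reflection is the reflection in the transported root: u carries the pairs
exchanged by s_j to those exchanged by s_i. -/
theorem simpleRefl_mul_comm_of_flip (u : Equiv.Perm (Fin n ⊕ Fin n))
    (hu : ∀ p, u p.swap = (u p).swap) (i j : Fin n)
    (h : (Sum.inl i = u (Sum.inl j) ∧ below i = u (below j)) ∨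
      (Sum.inl i = u (below j).swap ∧ below i = u (Sum.inr j))) :
    simpleRefl i * u = u * simpleRefl j := by
  ext1 p
  have h1 := (simpleRefl_eq_iff j p (simpleRefl j p)).1 rfl
  have hr : u (Sum.inr j) = (u (Sum.inl j)).swap := hu (Sum.inl j)
  have hi : (Sum.inr i : Fin n ⊕ Fin n) = (Sum.inl i : Fin n ⊕ Fin n).swap := rfl
  rw [Equiv.Perm.mul_apply, Equiv.Perm.mul_apply, eq_comm, simpleRefl_eq_iff]
  have hne : ∀ {a b : Fin n ⊕ Fin n}, a ≠ b → u a ≠ u b := fun hab => u.injective.ne hab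
  rcases h with ⟨ha, hb⟩ | ⟨ha, hb⟩
  · rw [hi, ha, hb, ← hu, ← hu]
    simp only [u.injective.eq_iff, ne_eq, Sum.swap_inl]
    simpa using h1
  · rw [hi, ha, hb, ← hu, ← hu]
    simp only [u.injective.eq_iff, ne_eq, Sum.swap_inr, Sum.swap_swap]
    tauto

/-- The exchange condition. The letter j at which the pair of the i-th root is flipped satisfies s_i
l₁ = l₁ s_j, so s_i cancels it. -/
theorem exists_shorter_word (l : List (Fin n)) (i : Fin n) (h : ¬ IsAscent i (wordPerm l)) :
    ∃ l', wordPerm l' = wordPerm (i :: l) ∧ l'.length + 1 = l.length := by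
  have hne : depth ((wordPerm l)⁻¹ (below i)) ≠ depth ((wordPerm l)⁻¹ (Sum.inl i)) := by
    rw [depth_injective.ne_iff, (wordPerm l)⁻¹.injective.ne_iff, ← depth_injective.ne_iff]
    simp
  obtain ⟨l₁, j, l₂, rfl, H⟩ := exists_flip_of_depth_lt l (Sum.inl i) (below i) (by simp)
    (lt_of_le_of_ne (not_lt.1 h) hne)
  refine ⟨l₁ ++ l₂, ?_, by simp; omega⟩
  have := simpleRefl_mul_comm_of_flip (wordPerm l₁) (wordPerm_swap l₁) i j H
  rw [wordPerm_cons, wordPerm_append, wordPerm_append, wordPerm_cons, ← mul_assoc, this, mul_assoc,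
    ← mul_assoc (simpleRefl j), simpleRefl_mul_self, one_mul]

theorem IsReducedWord.tail {i : Fin n} {l : List (Fin n)} (h : IsReducedWord (i :: l)) :
    IsReducedWord l := by
  intro l' hl'
  have := h (i :: l') (by simp [hl'])
  simpa using this

theorem IsReducedWord.isAscent {i : Fin n} {l : List (Fin n)} (h : IsReducedWord (i :: l)) :
    IsAscent i (wordPerm l) := by
  by_contra hc
  obtain ⟨l', h1, h2⟩ := exists_shorter_word l i hc
  have := h l' h1
  simp at this
  omega

/-- Induction over the final segments of a reduced word. -/
theorem IsReducedWord.rec_on {motive : List (Fin n) → Prop} (nil : motive [])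
    (cons : ∀ i l, IsAscent i (wordPerm l) → motive l → motive (i :: l))
    (l : List (Fin n)) (h : IsReducedWord l) : motive l := by
  induction l with
  | nil => exact nil
  | cons i l ih => exact cons i l h.isAscent (ih h.tail)

theorem exists_isReducedWord_of_wordPerm (l : List (Fin n)) :
    ∃ l', IsReducedWord l' ∧ wordPerm l' = wordPerm l := by
  classical
  have hex : ∃ m, ∃ l' : List (Fin n), l'.length = m ∧ wordPerm l' = wordPerm l := ⟨_, l, rfl, rfl⟩
  obtain ⟨l', h1, h2⟩ := Nat.find_spec hex
  refine ⟨l', fun l'' h => ?_, h2⟩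
  rw [h1]
  exact Nat.find_min' hex ⟨l'', rfl, h.trans h2⟩

end SignedPermutations

/-! ### Signs accumulated along reduced words -/

section Signs

variable {n : ℕ} (F : Type*) [Field F]

/-- The sign `(-1)^m`, where `m` is the number of inversions of `w` starting at `a`. -/
noncomputable def inversionSign (w : Equiv.Perm (Fin n ⊕ Fin n)) (a : Fin n ⊕ Fin n) : F :=
  ∏ b, if depth a < depth b ∧ depth (w b) < depth (w a) then -1 else 1

theorem inversionSign_one (a : Fin n ⊕ Fin n) : inversionSign F 1 a = 1 := by
  refine Finset.prod_eq_one fun b _ => if_neg ?_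
  simp only [Equiv.Perm.one_apply]
  omega

/-- At an ascent all inversions persist and only the exchanged pairs become new ones. A new
inversion starts at a exactly when w a is the earlier member of such a pair. -/
theorem inversionSign_simpleRefl_mul {i : Fin n} {w : Equiv.Perm (Fin n ⊕ Fin n)}
    (hw : ∀ p, w⁻¹ p.swap = (w⁻¹ p).swap) (h : IsAscent i w) (a : Fin n ⊕ Fin n) :
    inversionSign F (simpleRefl i * w) a =
      (if w a = Sum.inl i ∨ w a = (below i).swap then -1 else 1) * inversionSign F w a := by
  -- The ascent orders the preimages of the first pair; those of the mirror pair are ordered because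
  -- w⁻¹ commutes with `Sum.swap`.
  have key : ∀ a b : Fin n ⊕ Fin n, ((depth (w a) = i.val ∧ depth (w b) = i.val + 1) ∨
      (depth (w a) = 2 * n - 2 - i.val ∧ depth (w b) = 2 * n - 1 - i.val)) →
      depth a < depth b := by
    rintro a b (⟨ha, hb⟩ | ⟨ha, hb⟩)
    · have e1 : w a = Sum.inl i := depth_injective (by simp [ha])
      have e2 : w b = below i := depth_injective (by simp [hb])
      rw [← Equiv.Perm.eq_inv_iff_eq] at e1 e2
      rw [e1, e2]
      exact h
    · have e1 : w a = (below i).swap := depth_injective (by rw [ha, depth_swap, depth_below]; ring)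
      have e2 : w b = (Sum.inl i : Fin n ⊕ Fin n).swap :=
        depth_injective (by rw [hb, depth_swap, depth_inl])
      rw [← Equiv.Perm.eq_inv_iff_eq, hw] at e1 e2
      rw [e1, e2, depth_swap, depth_swap]
      have := h
      unfold IsAscent at this
      omega
  -- The new sign is placed at the partner b with w b = s_i (w a), so the two products can be
  -- compared factor by factor.
  have hprod : (if w a = Sum.inl i ∨ w a = (below i).swap then -1 else 1 : F) =
      ∏ b, if b = w⁻¹ (simpleRefl i (w a)) then
        (if w a = Sum.inl i ∨ w a = (below i).swap then -1 else 1 : F) else 1 := by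
    rw [Finset.prod_ite_eq' Finset.univ _ fun _ => _]
    simp
  rw [hprod, inversionSign, inversionSign, ← Finset.prod_mul_distrib]
  refine Finset.prod_congr rfl fun b _ => ?_
  have h1 := key a b
  have h2 := key b a
  have h3 : depth (w a) = depth (w b) ↔ depth a = depth b := by
    rw [depth_injective.eq_iff, depth_injective.eq_iff, w.injective.eq_iff]
  simp only [Equiv.Perm.mul_apply, Equiv.Perm.eq_inv_iff_eq]
  simp only [← depth_injective.eq_iff (a := w _), depth_simpleRefl, depth_inl, depth_swap,
    depth_below]
  have e : (simpleRefl i (w a) = w b) = (w b = simpleRefl i (w a)) := propext eq_comm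
  split_ifs <;> first | omega | simp

/-- The signs relating the basis vectors to a basis in which the Weyl group representatives act
as in `GL_{2n}`. -/
noncomputable def starSign (p : Fin n ⊕ Fin n) : F :=
  Sum.elim (fun _ => 1) (fun i => (-1) ^ (n + i.val + 1)) p

theorem starSign_mul_self (p : Fin n ⊕ Fin n) : starSign F p * starSign F p = 1 := by
  rcases p with i | i <;> simp [starSign, ← mul_pow]

/-- The coefficients of the `i`-th Langlands–Shelstad representative in `Sp(W)`. -/
noncomputable def spStep (i : Fin n) (p : Fin n ⊕ Fin n) : F :=
  if p = Sum.inl i ∨ (i.val + 1 < n ∧ p = Sum.inr i) then -1 else 1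

/-- The coefficients of the `i`-th Langlands–Shelstad representative in `SO(V)`. -/
noncomputable def soStep (i : Fin n) (p : Fin n ⊕ Fin n) : F :=
  if p = Sum.inl i ∨ p = Sum.inr i then -1 else 1

/-- The coefficients of the Langlands–Shelstad representative of `w` in `Sp(W)`. -/
noncomputable def spCoef (w : Equiv.Perm (Fin n ⊕ Fin n)) (a : Fin n ⊕ Fin n) : F :=
  starSign F a * starSign F (w a) * inversionSign F w a

/-- The coefficients of the Langlands–Shelstad representative of `w` in `SO(V)`. -/
noncomputable def soCoef (w : Equiv.Perm (Fin n ⊕ Fin n)) (a : Fin n ⊕ Fin n) : F :=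
  (if a.isRight ∧ (w a).isLeft then -1 else 1) * spCoef F w a

/-- A GL_{2n} representative has coefficient -1 on the earlier vector of each exchanged pair, and
`starSign` conjugates this into `spStep`. Its parity makes neighbouring starred vectors have
opposite signs and leaves y*_n with sign 1. -/
theorem starSign_simpleRefl (i : Fin n) (p : Fin n ⊕ Fin n) :
    starSign F (simpleRefl i p) * (if p = Sum.inl i ∨ p = (below i).swap then -1 else 1) =
      spStep F i p * starSign F p := by
  have hi := i.isLt
  have hbelow : ¬ i.val + 1 < n → n = i.val + 1 := by omega
  rcases (simpleRefl_eq_iff i p _).1 rfl with ⟨rfl, h⟩ | ⟨rfl, h⟩ | ⟨rfl, h⟩ | ⟨rfl, h⟩ |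
    ⟨h1, h2, h3, h4, h⟩
  all_goals
    rw [h]
    by_cases hn : i.val + 1 < n
    · simp_all [starSign, spStep, below, Fin.ext_iff] <;> ring
    · have := hbelow hn
      have hpow : (-1 : F) ^ (n + i.val + 1) = 1 := by
        rw [show n + i.val + 1 = 2 * n by omega, pow_mul]; simp
      simp_all [starSign, spStep, below]

theorem spCoef_one (a : Fin n ⊕ Fin n) : spCoef F 1 a = 1 := by
  simp [spCoef, inversionSign_one, starSign_mul_self]

theorem spCoef_simpleRefl_mul {i : Fin n} {w : Equiv.Perm (Fin n ⊕ Fin n)}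
    (hw : ∀ p, w⁻¹ p.swap = (w⁻¹ p).swap) (h : IsAscent i w) (a : Fin n ⊕ Fin n) :
    spCoef F (simpleRefl i * w) a = spStep F i (w a) * spCoef F w a := by
  rw [spCoef, inversionSign_simpleRefl_mul F hw h, spCoef, Equiv.Perm.mul_apply]
  linear_combination starSign F a * inversionSign F w a * starSign_simpleRefl F i (w a)

theorem soCoef_one (a : Fin n ⊕ Fin n) : soCoef F 1 a = 1 := by
  rcases a with i | i <;> simp [soCoef, spCoef_one]

/-- For the last index the two preimages are partners, with depths summing to 2n-1, so the ascent
puts the preimage of y_n in the first half. Along a reduced word, a vector that crosses the middle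
therefore never returns. -/
theorem IsAscent.isLeft {i : Fin n} {w : Equiv.Perm (Fin n ⊕ Fin n)}
    (hw : ∀ p, w⁻¹ p.swap = (w⁻¹ p).swap) (h : IsAscent i w) (hn : ¬ i.val + 1 < n) :
    ∃ j, w (Sum.inl j) = Sum.inl i ∧ w (Sum.inr j) = Sum.inr i := by
  have h' := h
  have e : below i = (Sum.inl i : Fin n ⊕ Fin n).swap := by simp [below, hn]
  rw [IsAscent, e, hw, depth_swap] at h'
  rcases hj : w⁻¹ (Sum.inl i) with j | j
  · refine ⟨j, by rw [← hj]; simp, ?_⟩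
    have := hw (Sum.inl i)
    rw [hj, Equiv.Perm.inv_eq_iff_eq] at this
    exact this.symm
  · rw [hj, depth_inr] at h'
    omega

/-- The two step functions differ only at the last starred vector under the last reflection. By
`IsAscent.isLeft` that vector comes from a starred one, so the discrepancy is recorded by the start
and end of its path alone. -/
theorem soCoef_simpleRefl_mul {i : Fin n} {w : Equiv.Perm (Fin n ⊕ Fin n)}
    (hw : ∀ p, w⁻¹ p.swap = (w⁻¹ p).swap) (h : IsAscent i w) (a : Fin n ⊕ Fin n) :
    soCoef F (simpleRefl i * w) a = soStep F i (w a) * soCoef F w a := by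
  rw [soCoef, spCoef_simpleRefl_mul F hw h, soCoef, Equiv.Perm.mul_apply, ← mul_assoc, ← mul_assoc]
  congr 1
  by_cases hn : i.val + 1 < n
  · have e : (simpleRefl i (w a)).isLeft = (w a).isLeft := by
      unfold simpleRefl
      rw [dif_pos hn]
      cases w a <;> rfl
    rw [e, mul_comm]
    congr 1
    simp [spStep, soStep, hn]
  · obtain ⟨j, h1, h2⟩ := h.isLeft hw hn
    have e : simpleRefl i = Equiv.swap (Sum.inl i) (Sum.inr i) := by simp [simpleRefl, hn]
    by_cases ha : a = Sum.inl j
    · subst ha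
      simp [h1, spStep, soStep]
    by_cases ha' : a = Sum.inr j
    · subst ha'
      simp [h2, spStep, soStep, e, hn]
    have n1 : w a ≠ Sum.inl i := fun hh => ha (w.injective (hh.trans h1.symm))
    have n2 : w a ≠ Sum.inr i := fun hh => ha' (w.injective (hh.trans h2.symm))
    rw [e, Equiv.swap_apply_of_ne_of_ne n1 n2]
    simp [spStep, soStep, n1, n2]

/-- The number of `y_j` mapped to some `y*_i`. -/
def numNeg (w : Equiv.Perm (Fin n ⊕ Fin n)) : ℕ :=
  ∑ j, if (w (Sum.inl j)).isRight then 1 else 0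

theorem numNeg_one : numNeg (1 : Equiv.Perm (Fin n ⊕ Fin n)) = 0 := by simp [numNeg]

/-- Only the last reflection mixes the two halves. At an ascent, the vector it moves out of the
first half comes from some y_j, which was not counted before. -/
theorem numNeg_simpleRefl_mul {i : Fin n} {w : Equiv.Perm (Fin n ⊕ Fin n)}
    (hw : ∀ p, w⁻¹ p.swap = (w⁻¹ p).swap) (h : IsAscent i w) :
    numNeg (simpleRefl i * w) = (if i.val + 1 < n then 0 else 1) + numNeg w := by
  by_cases hn : i.val + 1 < n
  · have e : ∀ p, (simpleRefl i p).isRight = p.isRight := by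
      intro p
      unfold simpleRefl
      rw [dif_pos hn]
      cases p <;> rfl
    simp [numNeg, e, hn]
  · obtain ⟨j, h1, h2⟩ := h.isLeft hw hn
    have e : simpleRefl i = Equiv.swap (Sum.inl i) (Sum.inr i) := by simp [simpleRefl, hn]
    rw [if_neg hn, numNeg, numNeg,
      show (1 : ℕ) = ∑ x : Fin n, if x = j then 1 else 0 by simp, ← Finset.sum_add_distrib]
    refine Finset.sum_congr rfl fun x _ => ?_
    by_cases hx : x = j
    · subst hx
      simp [h1, e]
    · have n1 : w (Sum.inl x) ≠ Sum.inl i := fun hh => hx (by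
        simpa using w.injective (hh.trans h1.symm))
      have n2 : w (Sum.inl x) ≠ Sum.inr i := fun hh => by
        simpa using w.injective (hh.trans h2.symm)
      rw [Equiv.Perm.mul_apply, e, Equiv.swap_apply_of_ne_of_ne n1 n2]
      simp [hx]

end Signs

/-! ### The nontrivial relative Weyl element as a signed permutation -/

section RelativeWeylElement

variable {n k : ℕ}

/-- The map `y_i ↦ y*_{k+1-i}`, `y*_i ↦ y_{k+1-i}` for `i ≤ k`, fixing the other basis vectors. -/
def weylMap (hkn : k ≤ n) : Fin n ⊕ Fin n → Fin n ⊕ Fin n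
  | Sum.inl i => if i.val < k then Sum.inr ⟨k - 1 - i.val, by omega⟩ else Sum.inl i
  | Sum.inr i => if i.val < k then Sum.inl ⟨k - 1 - i.val, by omega⟩ else Sum.inr i

theorem weylMap_involutive (hkn : k ≤ n) : Function.Involutive (weylMap hkn) := by
  rintro (i | i) <;> by_cases h : i.val < k <;> simp only [weylMap, h, if_true, if_false]
  · rw [if_pos (by omega)]
    simp only [Sum.inl.injEq, Fin.ext_iff]
    omega
  · rw [if_pos (by omega)]
    simp only [Sum.inr.injEq, Fin.ext_iff]
    omega

/-- The permutation of the basis vectors given by the nontrivial element of the relative Weyl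
group. -/
def weylPerm (hkn : k ≤ n) : Equiv.Perm (Fin n ⊕ Fin n) := (weylMap_involutive hkn).toPerm

@[simp] theorem weylPerm_inl (hkn : k ≤ n) (i : Fin n) : weylPerm hkn (Sum.inl i) =
    if i.val < k then Sum.inr ⟨k - 1 - i.val, by omega⟩ else Sum.inl i := rfl

@[simp] theorem weylPerm_inr (hkn : k ≤ n) (i : Fin n) : weylPerm hkn (Sum.inr i) =
    if i.val < k then Sum.inl ⟨k - 1 - i.val, by omega⟩ else Sum.inr i := rfl

theorem weylPerm_swap (hkn : k ≤ n) (p : Fin n ⊕ Fin n) :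
    weylPerm hkn p.swap = (weylPerm hkn p).swap := by
  rcases p with i | i <;> simp <;> split_ifs <;> rfl

theorem prod_ite_lt_neg_one (R : Type*) [CommRing R] (hkn : k ≤ n) :
    (∏ j : Fin n, if j.val < k then (-1 : R) else 1) = (-1) ^ k := by
  rw [Fin.prod_univ_eq_prod_range (fun j => if j < k then (-1 : R) else 1), Finset.prod_ite]
  have : (Finset.range n).filter (· < k) = Finset.range k := by ext; simp; omega
  simp [this]

theorem numNeg_weylPerm (hkn : k ≤ n) : numNeg (weylPerm hkn) = k := by
  have e : ∀ j : Fin n, (weylPerm hkn (Sum.inl j)).isRight = decide (j.val < k) := by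
    intro j
    simp only [weylPerm_inl]
    split_ifs with h <;> simp [h]
  have : (Finset.range n).filter (· < k) = Finset.range k := by ext; simp; omega
  simp only [numNeg, e, decide_eq_true_eq]
  rw [Fin.sum_univ_eq_sum_range (fun j => if j < k then 1 else 0), Finset.sum_ite]
  simp [this]

variable (F : Type*) [Field F]

/-- For i < k the inversions are with the n-k fixed y_j and with all n starred vectors, 2n-k in
total. For i ≥ k they are with the k moved starred vectors. Both counts have the parity of k. -/
theorem inversionSign_weylPerm_inl (hkn : k ≤ n) (i : Fin n) :
    inversionSign F (weylPerm hkn) (Sum.inl i) = (-1) ^ k := by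
  rw [inversionSign, Fintype.prod_sum_type]
  by_cases h : i.val < k
  · have e1 : ∀ j : Fin n, (depth (Sum.inl i : Fin n ⊕ Fin n) < depth (Sum.inl j : Fin n ⊕ Fin n) ∧
        depth (weylPerm hkn (Sum.inl j)) < depth (weylPerm hkn (Sum.inl i))) ↔ ¬ j.val < k := by
      intro j
      by_cases hj : j.val < k <;> simp [h, hj] <;> omega
    have e2 : ∀ j : Fin n, (depth (Sum.inl i : Fin n ⊕ Fin n) < depth (Sum.inr j : Fin n ⊕ Fin n) ∧
        depth (weylPerm hkn (Sum.inr j)) < depth (weylPerm hkn (Sum.inl i))) := by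
      intro j
      by_cases hj : j.val < k <;> simp [h, hj] <;> omega
    simp only [e1, e2, if_true, true_and]
    rw [← Finset.prod_mul_distrib, ← prod_ite_lt_neg_one F hkn]
    refine Finset.prod_congr rfl fun j _ => ?_
    by_cases hj : j.val < k <;> simp [hj]
  · have e1 : ∀ j : Fin n, ¬ (depth (Sum.inl i : Fin n ⊕ Fin n) <
      depth (Sum.inl j : Fin n ⊕ Fin n) ∧
        depth (weylPerm hkn (Sum.inl j)) < depth (weylPerm hkn (Sum.inl i))) := by
      intro j
      by_cases hj : j.val < k <;> simp [h, hj] <;> omega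
    have e2 : ∀ j : Fin n, (depth (Sum.inl i : Fin n ⊕ Fin n) < depth (Sum.inr j : Fin n ⊕ Fin n) ∧
        depth (weylPerm hkn (Sum.inr j)) < depth (weylPerm hkn (Sum.inl i))) ↔ j.val < k := by
      intro j
      by_cases hj : j.val < k <;> simp [h, hj] <;> omega
    simp only [e1, e2, if_false, Finset.prod_const_one, one_mul]
    exact prod_ite_lt_neg_one F hkn

theorem inversionSign_weylPerm_inr (hkn : k ≤ n) (i : Fin n) :
    inversionSign F (weylPerm hkn) (Sum.inr i) = if i.val < k then 1 else (-1) ^ k := by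
  rw [inversionSign, Fintype.prod_sum_type]
  have e1 : ∀ j : Fin n, ¬ (depth (Sum.inr i : Fin n ⊕ Fin n) < depth (Sum.inl j : Fin n ⊕ Fin n) ∧
      depth (weylPerm hkn (Sum.inl j)) < depth (weylPerm hkn (Sum.inr i))) := by
    intro j
    simp
    omega
  by_cases h : i.val < k
  · have e2 : ∀ j : Fin n, ¬ (depth (Sum.inr i : Fin n ⊕ Fin n) <
      depth (Sum.inr j : Fin n ⊕ Fin n) ∧
        depth (weylPerm hkn (Sum.inr j)) < depth (weylPerm hkn (Sum.inr i))) := by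
      intro j
      by_cases hj : j.val < k <;> simp [h, hj] <;> omega
    simp only [e1, e2, if_false, Finset.prod_const_one, one_mul, h, if_true]
  · have e2 : ∀ j : Fin n, (depth (Sum.inr i : Fin n ⊕ Fin n) < depth (Sum.inr j : Fin n ⊕ Fin n) ∧
        depth (weylPerm hkn (Sum.inr j)) < depth (weylPerm hkn (Sum.inr i))) ↔ j.val < k := by
      intro j
      by_cases hj : j.val < k <;> simp [h, hj] <;> omega
    simp only [e1, e2, if_false, Finset.prod_const_one, one_mul, h]
    exact prod_ite_lt_neg_one F hkn

theorem spCoef_weylPerm_inl (hkn : k ≤ n) (i : Fin n) : spCoef F (weylPerm hkn) (Sum.inl i) =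
    if i.val < k then -((-1) ^ (n + i.val + 1)) else (-1) ^ k := by
  rw [spCoef, inversionSign_weylPerm_inl]
  by_cases h : i.val < k
  · simp only [weylPerm_inl, h, if_true, starSign, Sum.elim_inl, Sum.elim_inr, one_mul]
    rw [← pow_add, show n + (k - 1 - i.val) + 1 + k = n + i.val + 2 * (k - i.val) by omega, pow_add,
      pow_mul, pow_succ _ (n + i.val)]
    simp
  · simp [h, starSign]

theorem spCoef_weylPerm_inr (hkn : k ≤ n) (i : Fin n) : spCoef F (weylPerm hkn) (Sum.inr i) =
    if i.val < k then (-1) ^ (n + i.val + 1) else (-1) ^ k := by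
  rw [spCoef, inversionSign_weylPerm_inr]
  by_cases h : i.val < k
  · simp [h, starSign]
  · simp [h, starSign, ← mul_pow]

theorem soCoef_weylPerm_inl (hkn : k ≤ n) (i : Fin n) : soCoef F (weylPerm hkn) (Sum.inl i) =
    if i.val < k then -((-1) ^ (n + i.val + 1)) else (-1) ^ k := by
  simp [soCoef, spCoef_weylPerm_inl]

theorem soCoef_weylPerm_inr (hkn : k ≤ n) (i : Fin n) : soCoef F (weylPerm hkn) (Sum.inr i) =
    if i.val < k then -(-1) ^ (n + i.val + 1) else (-1) ^ k := by
  rw [soCoef, spCoef_weylPerm_inr]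
  by_cases h : i.val < k <;> simp [h]

/-- The nontrivial element of the relative Weyl group is determined by its action on the simple
roots of the Levi subgroup. -/
theorem eq_inl_or_eq_weylPerm (hkn : k ≤ n) (U : Fin n → Fin n ⊕ Fin n)
    (hinj : Function.Injective U) (hswap : ∀ i j, U i ≠ (U j).swap)
    (hroot : ∀ (i : Fin n) (h : i.val + 1 < n), i.val + 1 ≠ k → ∃ (j : Fin n) (hj : j.val + 1 < n),
      (U i = Sum.inl j ∧ U ⟨i.val + 1, h⟩ = Sum.inl ⟨j.val + 1, hj⟩) ∨
        (U i = Sum.inr ⟨j.val + 1, hj⟩ ∧ U ⟨i.val + 1, h⟩ = Sum.inr j))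
    (hlast : ∀ i : Fin n, ¬ i.val + 1 < n → i.val + 1 ≠ k → U i = Sum.inl i) :
    (∀ i, U i = Sum.inl i) ∨ ∀ i, U i = weylPerm hkn (Sum.inl i) := by
  -- Neighbours go to neighbouring depths, and the pair never straddles the middle, since its image
  -- belongs again to a root of GL type.
  have hnext : ∀ (i : Fin n) (h : i.val + 1 < n), i.val + 1 ≠ k →
      depth (U ⟨i.val + 1, h⟩) = depth (U i) + 1 ∧ depth (U i) ≠ n - 1 := by
    intro i h hk
    obtain ⟨j, hj, ⟨h1, h2⟩ | ⟨h1, h2⟩⟩ := hroot i h hk <;> rw [h1, h2] <;> simp <;> omega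
  -- Descending induction from y_n, which is fixed when k < n because `hlast` then applies to it.
  have hge : ∀ m (i : Fin n), i.val + m + 1 = n → k ≤ i.val → depth (U i) = i.val := by
    intro m
    induction m with
    | zero => intro i hi hk; rw [hlast i (by omega) (by omega), depth_inl]
    | succ m ih =>
      intro i hi hk
      have h1 := (hnext i (by omega) (by omega)).1
      have h2 := ih ⟨i.val + 1, by omega⟩ (by simp; omega) (by simp; omega)
      simp only [Nat.cast_add, Nat.cast_one] at h2
      omega
  have hge' : ∀ i : Fin n, k ≤ i.val → depth (U i) = i.val :=
    fun i hi => hge (n - 1 - i.val) i (by omega) hi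
  rcases Nat.eq_zero_or_pos k with rfl | hk
  · left
    exact fun i => depth_injective (hge' i (Nat.zero_le _))
  have hn : 0 < n := by omega
  set u₀ := depth (U ⟨0, hn⟩) with hu₀
  have hlt : ∀ m (hm : m < k), depth (U ⟨m, by omega⟩) = u₀ + m := by
    intro m
    induction m with
    | zero => intro _; simp [hu₀]
    | succ m ih =>
      intro hm
      have h1 := (hnext ⟨m, by omega⟩ (by simp; omega) (by simp; omega)).1
      have h2 := ih (by omega)
      simp only at h1
      rw [h1, h2]
      push_cast
      ring
  have hside : ∀ m, m + 1 < k → u₀ + m ≠ n - 1 := by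
    intro m hm
    have h1 := (hnext ⟨m, by omega⟩ (by simp; omega) (by simp; omega)).2
    rwa [hlt m (by omega)] at h1
  have hne : ∀ m j : ℕ, m < k → k ≤ j → j < n → u₀ + m ≠ j ∧ u₀ + m ≠ 2 * n - 1 - j := by
    intro m j hm hj hjn
    have h1 := hlt m hm
    have h2 := hge' ⟨j, hjn⟩ hj
    simp only at h2
    constructor
    · intro h
      have := hinj (depth_injective (h1.trans (h.trans h2.symm)))
      simp only [Fin.mk.injEq] at this
      omega
    · intro h
      refine hswap ⟨m, by omega⟩ ⟨j, hjn⟩ (depth_injective ?_)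
      rw [depth_swap, h1, h2, h]
  have h0 : 0 ≤ u₀ := depth_nonneg _
  have hmax := depth_lt (U ⟨k - 1, by omega⟩)
  rw [hlt (k - 1) (by omega)] at hmax
  -- The images of the first k vectors fill the depths u₀, …, u₀+k-1. The depths in between are
  -- taken by the fixed vectors and their partners, and are excluded by injectivity and `hswap`.
  have hout : ∀ m < k, u₀ + m < k ∨ 2 * n - 1 - k < u₀ + m := by
    intro m hm
    by_contra hcon
    by_cases hc : u₀ + m < n
    · have := (hne m (u₀ + m).toNat hm (by omega) (by omega)).1
      omega
    · have := (hne m (2 * n - 1 - (u₀ + m)).toNat hm (by omega) (by omega)).2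
      omega
  by_cases hu : u₀ < n
  · left
    -- If u₀ were positive, the block would contain depth k. For k < n this depth is occupied, and
    -- for k = n the block would cross the middle, against `hside`.
    have hz : u₀ = 0 := by
      by_contra hz
      have h1 := hout 0 hk
      have h2 := hout (k - u₀).toNat (by omega)
      have h3 := hside (k - u₀ - 1).toNat (by omega)
      omega
    intro i
    apply depth_injective
    by_cases hi : i.val < k
    · rw [hlt i.val hi, hz, depth_inl, zero_add]
    · rw [hge' i (by omega), depth_inl]
  · right
    have hz : u₀ = 2 * n - k := by
      have h1 := hout 0 hk
      omega
    intro i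
    apply depth_injective
    rw [weylPerm_inl]
    by_cases hi : i.val < k
    · rw [hlt i.val hi, hz, if_pos hi, depth_inr]
      simp only
      omega
    · rw [hge' i (by omega), if_neg hi, depth_inl]

/-- The submonoid of permutations given by words in the simple reflections. -/
def wordMonoid (n : ℕ) : Submonoid (Equiv.Perm (Fin n ⊕ Fin n)) where
  carrier := Set.range wordPerm
  one_mem' := ⟨[], rfl⟩
  mul_mem' := by
    rintro _ _ ⟨l, rfl⟩ ⟨l', rfl⟩
    exact ⟨l ++ l', wordPerm_append l l'⟩

theorem sumCongr_mem_wordMonoid (σ : Equiv.Perm (Fin n)) : Equiv.sumCongr σ σ ∈ wordMonoid n := by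
  rcases n with - | m
  · exact ⟨[], by ext1 p; rcases p with i | i <;> exact i.elim0⟩
  have h : σ ∈ Submonoid.closure
      (Set.range fun i : Fin m ↦ Equiv.swap i.castSucc i.succ) := by
    rw [Equiv.Perm.mclosure_swap_castSucc_succ]; trivial
  induction h using Submonoid.closure_induction with
  | mem x hx =>
    obtain ⟨i, rfl⟩ := hx
    refine ⟨[i.castSucc], ?_⟩
    simp [simpleRefl, Fin.succ]
  | one => simp
  | mul x y _ _ hx hy =>
    have := (wordMonoid (m + 1)).mul_mem hx hy
    convert this using 1
    ext1 p
    rcases p with i | i <;> rfl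

/-- A single sign change is the conjugate of the last simple reflection by the transposition of j
with the last index. -/
theorem swap_mem_wordMonoid (j : Fin n) :
    Equiv.swap (Sum.inl j) (Sum.inr j) ∈ wordMonoid n := by
  have hn : n - 1 < n := by have := j.isLt; omega
  set e : Fin n := ⟨n - 1, hn⟩
  have h1 : Equiv.swap (Sum.inl e) (Sum.inr e) ∈ wordMonoid n :=
    ⟨[e], by simp [simpleRefl, e, show n - 1 + 1 = n by omega]⟩
  have h2 := sumCongr_mem_wordMonoid (Equiv.swap j e)
  convert (wordMonoid n).mul_mem ((wordMonoid n).mul_mem h2 h1) h2 using 1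
  have hinv : (Equiv.sumCongr (Equiv.swap j e) (Equiv.swap j e) : Equiv.Perm (Fin n ⊕ Fin n)) =
      (Equiv.sumCongr (Equiv.swap j e) (Equiv.swap j e) : Equiv.Perm (Fin n ⊕ Fin n))⁻¹ := by
    ext1 p
    rcases p with i | i <;> rfl
  nth_rewrite 2 [hinv]
  rw [Equiv.mul_swap_eq_swap_mul, mul_assoc, mul_inv_cancel, mul_one]
  simp

theorem signChange_mem_wordMonoid (m : ℕ) : ∃ w ∈ wordMonoid n, ∀ i : Fin n,
    w (Sum.inl i) = (if i.val < m then Sum.inr i else Sum.inl i) ∧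
    w (Sum.inr i) = (if i.val < m then Sum.inl i else Sum.inr i) := by
  induction m with
  | zero => exact ⟨1, one_mem _, by simp⟩
  | succ m ih =>
    obtain ⟨w, hw, h⟩ := ih
    by_cases hm : m < n
    · refine ⟨_, mul_mem (swap_mem_wordMonoid ⟨m, hm⟩) hw, fun i => ?_⟩
      rw [Equiv.Perm.mul_apply, Equiv.Perm.mul_apply, (h i).1, (h i).2]
      by_cases h1 : i.val < m
      · have h2 : i ≠ ⟨m, hm⟩ := fun e => by rw [e] at h1; simp at h1
        simp [h1, h1.trans (Nat.lt_succ_self m), Equiv.swap_apply_def, h2]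
      · by_cases h2 : i = ⟨m, hm⟩
        · subst h2
          simp
        · have h3 : ¬ i.val < m + 1 := fun h3 => h2 (Fin.ext (by simp; omega))
          simp [h1, h3, Equiv.swap_apply_def, h2]
    · refine ⟨w, hw, fun i => ?_⟩
      rw [(h i).1, (h i).2]
      simp [show i.val < m by omega, show i.val < m + 1 by omega]

/-- The reversal of the first `k` indices. -/
def reversePerm (hkn : k ≤ n) : Equiv.Perm (Fin n) :=
  Function.Involutive.toPerm (fun i => if i.val < k then ⟨k - 1 - i.val, by omega⟩ else i) (by
    intro i
    by_cases h : i.val < k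
    · have : k - 1 - i.val < k := by omega
      simp only [h, this, if_true, Fin.ext_iff]
      omega
    · simp [h])

theorem weylPerm_mem_wordMonoid (hkn : k ≤ n) : weylPerm hkn ∈ wordMonoid n := by
  obtain ⟨w, hw, h⟩ := signChange_mem_wordMonoid (n := n) k
  convert mul_mem hw (sumCongr_mem_wordMonoid (reversePerm hkn)) using 1
  have hr : ∀ i, reversePerm hkn i = if i.val < k then ⟨k - 1 - i.val, by omega⟩ else i :=
    fun _ => rfl
  ext1 p
  rcases p with i | i <;> by_cases hi : i.val < k
  · have : k - 1 - i.val < k := by omega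
    simp [hr, h, hi, this]
  · simp [hr, h, hi]
  · have : k - 1 - i.val < k := by omega
    simp [hr, h, hi, this]
  · simp [hr, h, hi]

theorem exists_isReducedWord_weylPerm (hkn : k ≤ n) :
    ∃ l, IsReducedWord l ∧ wordPerm l = weylPerm hkn := by
  obtain ⟨l, hl⟩ := weylPerm_mem_wordMonoid hkn
  rw [← hl]
  exact exists_isReducedWord_of_wordPerm l

end RelativeWeylElement

/-! ### Monomial matrices -/

section Monomial

variable {κ F G : Type*} [DecidableEq κ] [Field F] [Group G]

/-- The monomial matrix mapping the `j`-th basis vector to `c j` times the `π j`-th one. -/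
def monomialMatrix (π : Equiv.Perm κ) (c : κ → F) : Matrix κ κ F :=
  Matrix.of fun i j => if i = π j then c j else 0

theorem monomialMatrix_apply (π : Equiv.Perm κ) (c : κ → F) (i j : κ) :
    monomialMatrix π c i j = if i = π j then c j else 0 := rfl

theorem monomialMatrix_one : monomialMatrix (1 : Equiv.Perm κ) (fun _ => (1 : F)) = 1 := by
  ext i j
  rw [monomialMatrix_apply, Matrix.one_apply]
  rfl

variable [Fintype κ]

theorem monomialMatrix_mul_apply (π : Equiv.Perm κ) (c : κ → F) (A : Matrix κ κ F) (i j : κ) :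
    (monomialMatrix π c * A) (π i) j = c i * A i j := by
  simp [Matrix.mul_apply, monomialMatrix_apply]

theorem mul_monomialMatrix_apply (π : Equiv.Perm κ) (c : κ → F) (A : Matrix κ κ F) (i j : κ) :
    (A * monomialMatrix π c) i j = A i (π j) * c j := by
  simp [Matrix.mul_apply, monomialMatrix_apply]

theorem monomialMatrix_mul (π π' : Equiv.Perm κ) (c c' : κ → F) :
    monomialMatrix π c * monomialMatrix π' c' =
      monomialMatrix (π * π') fun j => c (π' j) * c' j := by
  ext i j
  rw [mul_monomialMatrix_apply, monomialMatrix_apply, monomialMatrix_apply, ite_mul, zero_mul]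
  rfl

theorem transpose_mul_mul_monomialMatrix_apply (π : Equiv.Perm κ) (c : κ → F) (A : Matrix κ κ F)
    (i j : κ) : ((monomialMatrix π c)ᵀ * A * monomialMatrix π c) i j =
      c i * A (π i) (π j) * c j := by
  rw [mul_monomialMatrix_apply]
  simp [Matrix.mul_apply, monomialMatrix_apply]

variable {ρ : G →* Matrix κ κ F}

theorem map_mul_map_inv (ρ : G →* Matrix κ κ F) (g : G) : ρ g * ρ g⁻¹ = 1 := by
  rw [← map_mul, mul_inv_cancel, map_one]

theorem coef_ne_zero {g : G} {π : Equiv.Perm κ} {c : κ → F} (h : ρ g = monomialMatrix π c) (j : κ) :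
    c j ≠ 0 := by
  intro hc
  have h1 := congrFun (congrFun (map_mul_map_inv ρ g) (π j)) (π j)
  rw [h, monomialMatrix_mul_apply, hc, zero_mul, Matrix.one_apply_eq] at h1
  exact zero_ne_one h1

theorem map_inv_eq_monomialMatrix {g : G} {π : Equiv.Perm κ} {c : κ → F}
    (h : ρ g = monomialMatrix π c) :
    ρ g⁻¹ = monomialMatrix π⁻¹ fun i => (c (π⁻¹ i))⁻¹ := by
  have h1 : ρ g * monomialMatrix π⁻¹ (fun i => (c (π⁻¹ i))⁻¹) = 1 := by
    rw [h, monomialMatrix_mul, ← monomialMatrix_one, mul_inv_cancel]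
    congr 1
    ext j
    exact mul_inv_cancel₀ (coef_ne_zero h _)
  have h2 : ρ g⁻¹ * ρ g = 1 := by rw [← map_mul, inv_mul_cancel, map_one]
  rw [← mul_one (ρ g⁻¹), ← h1, ← mul_assoc, h2, one_mul]

theorem conj_apply {g : G} {π : Equiv.Perm κ} {c : κ → F} (h : ρ g = monomialMatrix π c)
    (A : Matrix κ κ F) (i j : κ) :
    (ρ g * A * ρ g⁻¹) (π i) (π j) = c i * A i j * (c j)⁻¹ := by
  rw [map_inv_eq_monomialMatrix h, mul_monomialMatrix_apply, h, monomialMatrix_mul_apply]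
  simp

/-- Modulo the diagonal elements of `G`, a monomial element retains exactly its permutation. -/
theorem coset_eq_iff {g g' : G} {π π' : Equiv.Perm κ} {c c' : κ → F}
    (h : ρ g = monomialMatrix π c) (h' : ρ g' = monomialMatrix π' c') :
    ((g : G ⧸ blockSubgroup ρ id) = g') ↔ π = π' := by
  rw [QuotientGroup.eq]
  constructor
  · intro hmem
    ext1 j
    by_contra hne
    have h1 := (hmem (π⁻¹ (π' j)) j (fun e => hne (by
      simp only [id_eq, Equiv.Perm.inv_eq_iff_eq] at e; exact e.symm))).1
    rw [map_mul, h', mul_monomialMatrix_apply, map_inv_eq_monomialMatrix h, monomialMatrix_apply,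
      if_pos rfl] at h1
    exact mul_ne_zero (inv_ne_zero (coef_ne_zero h _)) (coef_ne_zero h' j) h1
  · rintro rfl i j hij
    constructor
    · rw [map_mul, map_inv_eq_monomialMatrix h, h', monomialMatrix_mul, monomialMatrix_apply,
        inv_mul_cancel, if_neg (by simpa using hij)]
    · rw [mul_inv_rev, inv_inv, map_mul, map_inv_eq_monomialMatrix h', h, monomialMatrix_mul,
        monomialMatrix_apply, inv_mul_cancel, if_neg (by simpa using hij)]

theorem mem_normalizer_blockSubgroup {μ : Type*} {lab : κ → μ} {g : G} {π : Equiv.Perm κ}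
    {c : κ → F} (h : ρ g = monomialMatrix π c)
    (hlab : ∀ i j, lab (π i) = lab (π j) ↔ lab i = lab j) :
    g ∈ Subgroup.normalizer (blockSubgroup ρ lab : Set G) := by
  rw [Subgroup.mem_normalizer_iff]
  intro a
  have key : ∀ b : G, ∀ i j, ρ (g * b * g⁻¹) (π i) (π j) = c i * ρ b i j * (c j)⁻¹ := by
    intro b i j
    rw [map_mul, map_mul, conj_apply h]
  have hinv : (g * a * g⁻¹)⁻¹ = g * a⁻¹ * g⁻¹ := by group
  constructor
  · intro ha i j hij
    obtain ⟨i, rfl⟩ := π.surjective i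
    obtain ⟨j, rfl⟩ := π.surjective j
    have h1 := ha i j (fun e => hij ((hlab _ _).2 e))
    rw [hinv, key, key, h1.1, h1.2]
    simp
  · intro ha i j hij
    have h1 := ha (π i) (π j) (fun e => hij ((hlab _ _).1 e))
    rw [hinv, key, key] at h1
    simpa [coef_ne_zero h] using h1

/-- Conjugating the regular element t by ν gives a diagonal matrix τ', and ν τ = τ' ν. A nonzero
entry (i, j) of ν forces τ'_i = τ_j, so distinctness of the τ_j leaves at most one nonzero entry in
each row, while every column has one by invertibility. -/
theorem exists_eq_monomialMatrix_of_mem_normalizer {t ν : G} {τ : κ → F}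
    (hτ : Function.Injective τ) (ht : ρ t = Matrix.diagonal τ) (htT : t ∈ blockSubgroup ρ id)
    (hν : ν ∈ Subgroup.normalizer (blockSubgroup ρ id : Set G)) :
    ∃ π c, ρ ν = monomialMatrix π c := by
  rw [Subgroup.mem_normalizer_iff] at hν
  have hmem := (hν t).1 htT
  set τ' : κ → F := fun i => ρ (ν * t * ν⁻¹) i i
  have hd : ρ (ν * t * ν⁻¹) = Matrix.diagonal τ' := by
    ext i j
    by_cases hij : i = j
    · subst hij; simp [τ']
    · rw [Matrix.diagonal_apply_ne _ hij]
      exact (hmem i j hij).1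
  have hcomm : ρ ν * Matrix.diagonal τ = Matrix.diagonal τ' * ρ ν := by
    rw [← ht, ← hd, ← map_mul, ← map_mul]
    congr 1
    group
  have hent : ∀ i j, ρ ν i j ≠ 0 → τ' i = τ j := by
    intro i j hij
    have := congrFun (congrFun hcomm i) j
    rw [Matrix.mul_diagonal, Matrix.diagonal_mul, mul_comm] at this
    exact (mul_right_cancel₀ hij this).symm
  have hex : ∀ j, ∃ i, ρ ν i j ≠ 0 := by
    intro j
    by_contra hcon
    push Not at hcon
    have h2 : ρ ν⁻¹ * ρ ν = 1 := by rw [← map_mul, inv_mul_cancel, map_one]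
    have := congrFun (congrFun h2 j) j
    simp [Matrix.mul_apply, hcon] at this
  choose f hf using hex
  have hfinj : Function.Injective f := by
    intro j j' h
    have h1 := hent _ _ (hf j)
    have h2 := hent _ _ (hf j')
    rw [h, h2] at h1
    exact (hτ h1).symm
  refine ⟨Equiv.ofBijective f (Finite.injective_iff_bijective.1 hfinj), fun j => ρ ν (f j) j, ?_⟩
  ext i j
  rw [monomialMatrix_apply, Equiv.ofBijective_apply]
  split_ifs with hi
  · rw [hi]
  · by_contra hne
    obtain ⟨j', rfl⟩ := (Finite.injective_iff_surjective.1 hfinj) i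
    have h1 := hent _ _ hne
    have h2 := hent _ _ (hf j')
    rw [h2] at h1
    exact hi (by rw [hτ h1])

/-- Words in monomial representatives of the simple reflections: reduced decompositions of `ν` are
the reduced words for the permutation of `ν`. -/
theorem isReducedDecomposition_iff {n : ℕ} {φ : Equiv.Perm (Fin n ⊕ Fin n) →* Equiv.Perm κ}
    (hφ : Function.Injective φ) {ω : Fin n → G} {c : Fin n → κ → F}
    (hω : ∀ i, ρ (ω i) = monomialMatrix (φ (simpleRefl i)) (c i)) {ν : G}
    {w : Equiv.Perm (Fin n ⊕ Fin n)} {d : κ → F} (hν : ρ ν = monomialMatrix (φ w) d)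
    (l : List (Fin n)) :
    IsReducedDecomposition (blockSubgroup ρ id) ω l ν ↔ IsReducedWord l ∧ wordPerm l = w := by
  have hl : ∀ l : List (Fin n), ∃ e, ρ (l.map ω).prod = monomialMatrix (φ (wordPerm l)) e := by
    intro l
    induction l with
    | nil => exact ⟨fun _ => 1, by simp [monomialMatrix_one]⟩
    | cons i l ih =>
      obtain ⟨e, he⟩ := ih
      rw [List.map_cons, List.prod_cons, map_mul, hω, he, monomialMatrix_mul, wordPerm_cons,
        map_mul]
      exact ⟨_, rfl⟩
  have key : ∀ l : List (Fin n), (((l.map ω).prod : G) : G ⧸ blockSubgroup ρ id) = ν ↔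
      wordPerm l = w := by
    intro l
    obtain ⟨e, he⟩ := hl l
    rw [coset_eq_iff he hν, hφ.eq_iff]
  unfold IsReducedDecomposition IsReducedWord
  simp only [key]
  constructor
  · rintro ⟨h1, h2⟩
    exact ⟨fun l' hl' => h2 l' (hl'.trans h1), h1⟩
  · rintro ⟨h1, h2⟩
    exact ⟨h2, fun l' hl' => h1 l' (hl'.trans h2.symm)⟩

end Monomial

/-! ### Weyl group representatives in the symplectic group -/

section SymplecticRepresentatives

variable {n k : ℕ} {F : Type*} [Field F]

theorem neg_one_pow_add_two_mul (R : Type*) [CommRing R] (a b : ℕ) :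
    (-1 : R) ^ (a + 2 * b) = (-1) ^ a := by
  simp [pow_add, pow_mul]

theorem spRootVector_apply (i : Fin n) (p q : Fin n ⊕ Fin n) : spRootVector n F i p q =
    if depth p = i.val ∧ depth q = i.val + 1 then 1
    else if depth p = 2 * n - 2 - i.val ∧ depth q = 2 * n - 1 - i.val then -1 else 0 := by
  unfold spRootVector
  split_ifs with h <;> rcases p with a | a <;> rcases q with b | b <;>
    simp [Matrix.single_apply, Fin.ext_iff] at * <;>
    (try split_ifs) <;> omega

theorem spMatrix_spOmega [CharZero F] (i : Fin n) :
    spMatrix n F (spOmega n F i) = monomialMatrix (simpleRefl i) (spStep F i) := by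
  have h2 := spRootVector_sq n F i
  have h2' : (-spNegRootVector n F i) ^ 2 = 0 := by
    rw [neg_sq, spNegRootVector, ← Matrix.transpose_pow, spRootVector_sq, Matrix.transpose_zero]
  change tripleExp _ _ = _
  rw [tripleExp, exp_eq_of_cube_eq_zero _ (by rw [pow_succ, h2, zero_mul]),
    exp_eq_of_cube_eq_zero _ (by rw [pow_succ, h2', zero_mul]), h2, h2', smul_zero, add_zero,
    add_zero, ← Matrix.fromBlocks_one]
  unfold spNegRootVector spRootVector
  by_cases h : i.val + 1 < n
  · have h1 : i ≠ ⟨i.val + 1, h⟩ := fun e => by simpa using congrArg Fin.val e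
    simp only [dif_pos h, Matrix.fromBlocks_transpose, Matrix.fromBlocks_neg,
      Matrix.fromBlocks_add, Matrix.fromBlocks_multiply, add_mul, mul_add]
    ext p q
    have h3 := simpleRefl_eq_iff i q p
    simp only [below, dif_pos h] at h3
    rw [monomialMatrix_apply]
    simp only [h3, spStep, h, true_and]
    rcases p with a | a <;> rcases q with b | b <;>
      simp [Matrix.single_apply, Matrix.one_apply, h1, h1.symm] <;> grind
  · simp only [dif_neg h, Matrix.fromBlocks_transpose, Matrix.fromBlocks_neg,
      Matrix.fromBlocks_add, Matrix.fromBlocks_multiply, add_mul, mul_add]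
    ext p q
    have h3 := simpleRefl_eq_iff i q p
    simp only [below, dif_neg h] at h3
    rw [monomialMatrix_apply]
    simp only [h3, spStep, h, false_and, or_false]
    rcases p with a | a <;> rcases q with b | b <;>
      simp [Matrix.single_apply, Matrix.one_apply] <;> grind

/-- The right side involves l only through its permutation, so all reduced words of one element have
the same product. The induction uses that every letter added on the left of a reduced word is an
ascent. -/
theorem spMatrix_prod_spOmega [CharZero F] (l : List (Fin n)) (hl : IsReducedWord l) :
    spMatrix n F (l.map (spOmega n F)).prod =
      monomialMatrix (wordPerm l) (spCoef F (wordPerm l)) := by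
  refine IsReducedWord.rec_on (motive := fun l => spMatrix n F (l.map (spOmega n F)).prod =
      monomialMatrix (wordPerm l) (spCoef F (wordPerm l))) ?_ ?_ l hl
  · simp [monomialMatrix_one, funext (spCoef_one (n := n) F)]
  · intro i l ha ih
    rw [List.map_cons, List.prod_cons, map_mul, ih, spMatrix_spOmega, monomialMatrix_mul,
      wordPerm_cons]
    congr 1
    ext a
    rw [spCoef_simpleRefl_mul F (wordPerm_inv_swap l) ha]

theorem monomialMatrix_spCoef_weylPerm (hkn : k ≤ n) :
    monomialMatrix (weylPerm hkn) (spCoef F (weylPerm hkn)) = wMMatrix n k F := by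
  ext p q
  rw [monomialMatrix_apply, wMMatrix, Matrix.smul_apply, smul_eq_mul]
  rcases q with b | b <;> by_cases hb : b.val < k <;> rcases p with a | a <;>
    simp only [weylPerm_inl, weylPerm_inr, spCoef_weylPerm_inl, spCoef_weylPerm_inr, hb, if_true,
      if_false, Matrix.fromBlocks_apply₁₁, Matrix.fromBlocks_apply₁₂, Matrix.fromBlocks_apply₂₁,
      Matrix.fromBlocks_apply₂₂, lastProj, antidiagJ, Matrix.diagonal_apply, Matrix.neg_apply,
      Matrix.of_apply, Sum.inl.injEq, Sum.inr.injEq, reduceCtorEq, Fin.ext_iff]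
  · simp; grind
  -- On the antidiagonal, k + n + a + 1 and n + b differ by the even number 2(a+1).
  · by_cases h : a.val + b.val + 1 = k
    · rw [if_pos h, if_pos (by omega), ← pow_add, ← h,
        show a.val + b.val + 1 + (n + a.val + 1) = n + b.val + 2 * (a.val + 1) by ring,
        neg_one_pow_add_two_mul]
      simp [pow_succ]
    · rw [if_neg h, if_neg (by omega), mul_zero]
  · split_ifs with h1 h2 <;> first | omega | simp
  · rw [if_neg (by omega), mul_zero]
  · by_cases h : a.val + b.val + 1 = k
    · rw [if_pos h, if_pos (by omega), mul_neg, ← pow_add, ← h,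
        show a.val + b.val + 1 + (n + a.val + 1) = n + b.val + 2 * (a.val + 1) by ring,
        neg_one_pow_add_two_mul]
      simp [pow_succ]
    · rw [if_neg h, if_neg (by omega), neg_zero, mul_zero]
  · simp; grind
  · rw [if_neg (by omega), neg_zero, mul_zero]
  · split_ifs with h1 h2 <;> first | omega | simp

end SymplecticRepresentatives

/-! ### Uniqueness of the Weyl element in `Sp(W)` -/

section SymplecticUniqueness

variable {n k : ℕ} {F : Type*} [Field F]

theorem depth_weylPerm (hkn : k ≤ n) (p : Fin n ⊕ Fin n) : depth (weylPerm hkn p) =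
    if depth p < k then 2 * n - k + depth p
    else if 2 * n - k ≤ depth p then depth p - (2 * n - k) else depth p := by
  rcases p with i | i <;> by_cases hi : i.val < k
  · rw [weylPerm_inl, if_pos hi, depth_inl, depth_inr, if_pos (by omega)]
    simp only
    omega
  · rw [weylPerm_inl, if_neg hi, depth_inl, if_neg (by omega), if_neg (by omega)]
  · rw [weylPerm_inr, if_pos hi, depth_inl, depth_inr, if_neg (by omega), if_pos (by omega)]
    simp only
    omega
  · rw [weylPerm_inr, if_neg hi, depth_inr, if_neg (by omega), if_neg (by omega)]

theorem spCoef_weylPerm (hkn : k ≤ n) (p : Fin n ⊕ Fin n) : spCoef F (weylPerm hkn) p =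
    if depth p < k then (-1) ^ (n + (depth p).toNat)
    else if 2 * n - k ≤ depth p then (-1) ^ (n + (depth p).toNat) else (-1) ^ k := by
  rcases p with i | i <;> by_cases hi : i.val < k
  · rw [spCoef_weylPerm_inl, if_pos hi, depth_inl, if_pos (by omega)]
    simp [pow_succ]
  · rw [spCoef_weylPerm_inl, if_neg hi, depth_inl, if_neg (by omega), if_neg (by omega)]
  · rw [spCoef_weylPerm_inr, if_pos hi, depth_inr, if_neg (by omega), if_pos (by omega),
      ← neg_one_pow_add_two_mul F _ (n - 1 - i.val)]
    congr 1
    omega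
  · rw [spCoef_weylPerm_inr, if_neg hi, depth_inr, if_neg (by omega), if_neg (by omega)]

/-- The first k vectors are reversed and starred, so the GL root between i and i+1 goes to the one
between k-2-i and k-1-i (indices from 0); the signs alternate along the block and match the root
vectors with scalar exactly 1. The roots with i ≥ k are fixed, since the element is scalar on
W_{n-k}. -/
theorem exists_spRootVector_weylPerm (hkn : k ≤ n) (i : Fin n) (hi : i.val + 1 ≠ k) :
    ∃ j : Fin n, j.val + 1 ≠ k ∧ (j.val + 1 < n ↔ i.val + 1 < n) ∧ ∀ p q : Fin n ⊕ Fin n,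
      spRootVector n F j (weylPerm hkn p) (weylPerm hkn q) = spCoef F (weylPerm hkn) p *
        spRootVector n F i p q * (spCoef F (weylPerm hkn) q)⁻¹ := by
  by_cases hik : i.val < k
  · refine ⟨⟨k - 2 - i.val, by omega⟩, by simp; omega, by simp; omega, fun p q => ?_⟩
    simp only [spRootVector_apply]
    have hp := depth_weylPerm hkn p
    have hq := depth_weylPerm hkn q
    have hp0 := depth_nonneg p
    have hp1 := depth_lt p
    have hq0 := depth_nonneg q
    have hq1 := depth_lt q
    by_cases h1 : depth p = i.val ∧ depth q = i.val + 1
    · rw [if_pos h1, if_neg, if_pos, spCoef_weylPerm, spCoef_weylPerm, h1.1, h1.2, if_pos,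
        if_pos]
      · rw [mul_one, ← div_eq_mul_inv, eq_div_iff (pow_ne_zero _ (by simp)),
          show n + ((i.val : ℤ) + 1).toNat = n + (i.val : ℤ).toNat + 1 by omega]
        simp [pow_succ]
      all_goals split_ifs at hp hq <;> (try simp only [hp, hq]) <;> omega
    · by_cases h2 : depth p = 2 * n - 2 - i.val ∧ depth q = 2 * n - 1 - i.val
      · rw [if_neg h1, if_pos h2, if_pos, spCoef_weylPerm, spCoef_weylPerm, h2.1, h2.2, if_neg,
          if_pos, if_neg, if_pos]
        · rw [← div_eq_mul_inv, eq_div_iff (pow_ne_zero _ (by simp)),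
            show n + (2 * (n : ℤ) - 1 - i.val).toNat =
              n + (2 * (n : ℤ) - 2 - i.val).toNat + 1 by omega]
          simp [pow_succ]
        all_goals split_ifs at hp hq <;> (try simp only [hp, hq]) <;> omega
      · rw [if_neg h1, if_neg h2, if_neg, if_neg]
        · simp
        all_goals split_ifs at hp hq <;> (try simp only [hp, hq]) <;> omega
  · refine ⟨i, hi, Iff.rfl, fun p q => ?_⟩
    simp only [spRootVector_apply]
    have hp := depth_weylPerm hkn p
    have hq := depth_weylPerm hkn q
    have hp0 := depth_nonneg p
    have hp1 := depth_lt p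
    have hq0 := depth_nonneg q
    have hq1 := depth_lt q
    by_cases h1 : depth p = i.val ∧ depth q = i.val + 1
    · rw [if_pos h1, if_pos, spCoef_weylPerm, spCoef_weylPerm, h1.1, h1.2, if_neg, if_neg,
        if_neg, if_neg]
      · rw [mul_one, mul_inv_cancel₀ (pow_ne_zero _ (by simp))]
      all_goals split_ifs at hp hq <;> (try simp only [hp, hq]) <;> omega
    · by_cases h2 : depth p = 2 * n - 2 - i.val ∧ depth q = 2 * n - 1 - i.val
      · rw [if_neg h1, if_pos h2, if_neg, if_pos, spCoef_weylPerm, spCoef_weylPerm, h2.1, h2.2,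
          if_neg, if_neg, if_neg, if_neg]
        · rw [mul_assoc, mul_comm, mul_assoc, inv_mul_cancel₀ (pow_ne_zero _ (by simp)), mul_one]
        all_goals split_ifs at hp hq <;> (try simp only [hp, hq]) <;> omega
      · rw [if_neg h1, if_neg h2, if_neg, if_neg]
        · simp
        all_goals split_ifs at hp hq <;> (try simp only [hp, hq]) <;> omega

theorem representsRelativeWeylElement_sp (hk : 1 ≤ k) (hkn : k ≤ n) {ν : SpGroup n F}
    (hν : spMatrix n F ν = monomialMatrix (weylPerm hkn) (spCoef F (weylPerm hkn))) :
    RepresentsRelativeWeylElement (spMatrix n F) (spTorus n F) (spLevi n k F)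
      (spRootVector n F) {i | i.val + 1 ≠ k} ν := by
  have hn : 0 < n := by omega
  refine ⟨mem_normalizer_blockSubgroup hν ?_, mem_normalizer_blockSubgroup hν ?_, ?_, ?_⟩
  · exact fun i j => (weylPerm hkn).injective.eq_iff
  · have hlab : ∀ p, spLabel n k (weylPerm hkn p) = 2 - spLabel n k p := by
      rintro (i | i) <;> by_cases hi : i.val < k
      · simp [spLabel, hi, show k - 1 - i.val < k by omega]
      · simp [spLabel, hi]
      · simp [spLabel, hi, show k - 1 - i.val < k by omega]
      · simp [spLabel, hi]
    intro p q
    rw [hlab, hlab, sub_right_inj]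
  · intro hM
    have h1 := (hM (weylPerm hkn (Sum.inl ⟨0, hn⟩)) (Sum.inl ⟨0, hn⟩) (by
      simp [spLabel, show 0 < k by omega, show k - 1 < k by omega])).1
    rw [hν, monomialMatrix_apply, if_pos rfl] at h1
    exact coef_ne_zero hν _ h1
  · intro i hi
    obtain ⟨j, hj, -, h⟩ := exists_spRootVector_weylPerm (F := F) hkn i hi
    refine ⟨j, hj, 1, ?_⟩
    ext p q
    obtain ⟨p, rfl⟩ := (weylPerm hkn).surjective p
    obtain ⟨q, rfl⟩ := (weylPerm hkn).surjective q
    rw [conj_apply hν, one_smul, h]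

theorem two_zpow_injective (F : Type*) [Field F] [CharZero F] :
    Function.Injective fun m : ℤ => (2 : F) ^ m := by
  intro a b h
  have h1 : (((2 : ℚ) ^ a : ℚ) : F) = (((2 : ℚ) ^ b : ℚ) : F) := by
    push_cast
    exact h
  exact zpow_right_injective₀ (by norm_num) (by norm_num) (Rat.cast_injective h1)

/-- Powers of 2 with the exponents ±1, …, ±n are pairwise distinct in characteristic 0. -/
theorem exists_regular_mem_spTorus (n : ℕ) (F : Type*) [Field F] [CharZero F] :
    ∃ (t : SpGroup n F) (τ : Fin n ⊕ Fin n → F), Function.Injective τ ∧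
      spMatrix n F t = Matrix.diagonal τ ∧ t ∈ spTorus n F := by
  set e : Fin n → F := fun i => 2 ^ (i.val + 1 : ℤ)
  have he : ∀ i, e i ≠ 0 := fun i => zpow_ne_zero _ two_ne_zero
  have hd : Matrix.diagonal (Sum.elim e fun i => (e i)⁻¹) =
      Matrix.fromBlocks (Matrix.diagonal e) 0 0 (Matrix.diagonal fun i => (e i)⁻¹) :=
    (Matrix.fromBlocks_diagonal _ _).symm
  have hmem : Matrix.diagonal (Sum.elim e fun i => (e i)⁻¹) ∈ Matrix.symplecticGroup (Fin n) F := by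
    rw [SymplecticGroup.mem_iff, hd, Matrix.J]
    simp [-Matrix.fromBlocks_diagonal, Matrix.fromBlocks_multiply, Matrix.fromBlocks_transpose, he]
    rw [← Matrix.diagonal_one, Matrix.diagonal_neg]
  refine ⟨⟨_, hmem⟩, _, ?_, rfl, ?_⟩
  · have hz : (Sum.elim e fun i => (e i)⁻¹) = (fun m : ℤ => (2 : F) ^ m) ∘
        Sum.elim (fun i : Fin n => (i.val + 1 : ℤ)) (fun i : Fin n => -(i.val + 1 : ℤ)) := by
      ext p
      rcases p with i | i <;> simp [e, ← zpow_neg]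
    rw [hz]
    refine (two_zpow_injective F).comp ?_
    rintro (i | i) (j | j) h <;> simp [Fin.ext_iff] at * <;> omega
  · intro p q hpq
    have hinv : spMatrix n F (⟨_, hmem⟩ : SpGroup n F)⁻¹ =
        Matrix.diagonal (Sum.elim (fun i => (e i)⁻¹) e) := by
      have h1 := map_mul_map_inv (spMatrix n F) (⟨_, hmem⟩ : SpGroup n F)
      have h2 : Matrix.diagonal (Sum.elim (fun i => (e i)⁻¹) e) *
          spMatrix n F (⟨_, hmem⟩ : SpGroup n F) = 1 := by
        change _ * Matrix.diagonal _ = 1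
        rw [Matrix.diagonal_mul_diagonal, ← Matrix.diagonal_one]
        congr 1
        ext p
        rcases p with i | i <;> simp [he]
      rw [← one_mul (spMatrix n F _), ← h2, mul_assoc, h1, mul_one]
    refine ⟨Matrix.diagonal_apply_ne _ hpq, ?_⟩
    rw [hinv]
    exact Matrix.diagonal_apply_ne _ hpq

theorem J_apply_ne_zero_iff (p q : Fin n ⊕ Fin n) : Matrix.J (Fin n) F p q ≠ 0 ↔ q = p.swap := by
  rcases p with i | i <;> rcases q with j | j <;> simp [Matrix.J, Matrix.one_apply, eq_comm]

/-- The regular element makes ν monomial, and invariance of J makes its permutation commute with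
`Sum.swap`. From the condition on the roots only the supports of the root vectors are kept; they
feed `eq_inl_or_eq_weylPerm`. -/
theorem eq_monomialMatrix_of_representsRelativeWeylElement_sp [CharZero F] (hkn : k ≤ n)
    {ν : SpGroup n F}
    (h : RepresentsRelativeWeylElement (spMatrix n F) (spTorus n F) (spLevi n k F)
      (spRootVector n F) {i | i.val + 1 ≠ k} ν) :
    ∃ c, spMatrix n F ν = monomialMatrix (weylPerm hkn) c := by
  obtain ⟨hT, -, hM, hroot⟩ := h
  obtain ⟨t, τ, hτ, ht, htT⟩ := exists_regular_mem_spTorus n F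
  obtain ⟨π, c, hν⟩ := exists_eq_monomialMatrix_of_mem_normalizer hτ ht htT hT
  have hc := coef_ne_zero hν
  have hswap : ∀ p, π p.swap = (π p).swap := by
    intro p
    have h1 := SymplecticGroup.mem_iff'.1 ν.2
    change (spMatrix n F ν)ᵀ * _ * spMatrix n F ν = _ at h1
    have h2 := congrFun (congrFun h1 p) p.swap
    rw [hν, transpose_mul_mul_monomialMatrix_apply] at h2
    rw [← J_apply_ne_zero_iff (F := F)]
    intro h0
    rw [h0, mul_zero, zero_mul] at h2
    exact (J_apply_ne_zero_iff (F := F) p p.swap).2 rfl h2.symm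
  have hX : ∀ (i j : Fin n) (d : F), spMatrix n F ν * spRootVector n F i * spMatrix n F ν⁻¹ =
      d • spRootVector n F j → ∀ p q, spRootVector n F i p q ≠ 0 ↔
        spRootVector n F j (π p) (π q) ≠ 0 := by
    intro i j d hd
    have h1 : ∀ p q, c p * spRootVector n F i p q * (c q)⁻¹ =
        d * spRootVector n F j (π p) (π q) := by
      intro p q
      rw [← conj_apply hν, hd, Matrix.smul_apply, smul_eq_mul]
    have hd0 : d ≠ 0 := by
      rintro rfl
      have := h1 (Sum.inl i) (below i)
      simp [spRootVector_apply, hc] at this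
    intro p q
    have := h1 p q
    constructor
    · intro h2 h3
      rw [h3, mul_zero] at this
      exact mul_ne_zero (mul_ne_zero (hc p) h2) (inv_ne_zero (hc q)) this
    · intro h2 h3
      rw [h3, mul_zero, zero_mul] at this
      exact mul_ne_zero hd0 h2 this.symm
  have hne : ∀ (i : Fin n) p q, spRootVector n F i p q ≠ 0 ↔
      (p = Sum.inl i ∧ q = below i) ∨ (p = (below i).swap ∧ q = Sum.inr i) := by
    intro i p q
    simp only [spRootVector_apply, ← depth_injective.eq_iff, depth_swap, depth_below, depth_inl,
      depth_inr]
    split_ifs <;> simp <;> omega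
  have hlen : ∀ i : Fin n, ¬ i.val + 1 < n → below i = Sum.inr i := fun i h => by simp [below, h]
  have hlen' : ∀ (i : Fin n) (h : i.val + 1 < n), below i = Sum.inl ⟨i.val + 1, h⟩ :=
    fun i h => by simp [below, h]
  have hU := eq_inl_or_eq_weylPerm hkn (fun i => π (Sum.inl i))
    (fun i j hij => by simpa using hij)
    (fun i j hij => by
      rw [← hswap] at hij
      simpa using π.injective hij)
    (fun i hi hik => by
      obtain ⟨j, -, d, hd⟩ := hroot i hik
      have h1 := hX i j d hd
      simp only [hne] at h1
      have h2 := (h1 (Sum.inl i) (below i)).1 (Or.inl ⟨rfl, rfl⟩)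
      have h3 := (h1 (below i).swap (Sum.inr i)).1 (Or.inr ⟨rfl, rfl⟩)
      -- A long root vector has one nonzero entry and a short one has two, so short roots go to
      -- short roots; the same count treats the long root below.
      have hj : j.val + 1 < n := by
        by_contra hj
        rw [hlen j hj] at h2 h3
        have e1 : π (Sum.inl i) = Sum.inl j := by rcases h2 with h2 | h2 <;> exact h2.1
        have e2 : π (below i).swap = Sum.inl j := by rcases h3 with h3 | h3 <;> exact h3.1
        have := π.injective (e1.trans e2.symm)
        rw [hlen' i hi] at this
        simp at this
      rw [hlen' i hi, hlen' j hj] at h2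
      exact ⟨j, hj, h2⟩)
    (fun i hi hik => by
      obtain ⟨j, -, d, hd⟩ := hroot i hik
      have h1 := hX i j d hd
      simp only [hne] at h1
      rw [hlen i hi] at h1
      have h2 := (h1 (Sum.inl i) (Sum.inr i)).1 (Or.inl ⟨rfl, rfl⟩)
      have hj : ¬ j.val + 1 < n := by
        intro hj
        have e1 := h1 (π⁻¹ (Sum.inl j)) (π⁻¹ (below j))
        have e2 := h1 (π⁻¹ (below j).swap) (π⁻¹ (Sum.inr j))
        have hπ : ∀ p, π (π⁻¹ p) = p := π.apply_symm_apply
        simp only [hπ, and_self, true_or, or_true, iff_true, Sum.swap_inr, or_self]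
          at e1 e2
        have := (π⁻¹).injective (e1.1.trans e2.1.symm)
        rw [hlen' j hj] at this
        simp at this
      have hji : j = i := Fin.ext (by omega)
      subst hji
      rw [hlen j hj] at h2
      rcases h2 with h2 | h2 <;> exact h2.1)
  rcases hU with hU | hU
  · exfalso
    -- A trivial permutation makes ν diagonal, hence an element of the Levi subgroup.
    apply hM
    have hπ : π = 1 := by
      ext1 p
      rcases p with i | i
      · exact hU i
      · rw [← Sum.swap_inl, hswap, hU]; rfl
    subst hπ
    intro p q hpq
    have hpq' : p ≠ q := fun e => hpq (by rw [e])
    rw [map_inv_eq_monomialMatrix hν, hν]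
    simp [monomialMatrix_apply, hpq']
  · have hπ : π = weylPerm hkn := by
      ext1 p
      rcases p with i | i
      · exact hU i
      · rw [← Sum.swap_inl, hswap, hU, weylPerm_swap]
    exact ⟨c, hπ ▸ hν⟩

end SymplecticUniqueness

/-! ### Hilbert symbols and Ranga Rao's `x`-function -/

section HilbertSymbol

variable {F : Type*} [Field F]

theorem hilbertSymbol_comm (a b : F) : hilbertSymbol a b = hilbertSymbol b a := by
  have h : ∀ a b : F, (∃ x y z : F, (x ≠ 0 ∨ y ≠ 0 ∨ z ≠ 0) ∧ z ^ 2 = a * x ^ 2 + b * y ^ 2) →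
      ∃ x y z : F, (x ≠ 0 ∨ y ≠ 0 ∨ z ≠ 0) ∧ z ^ 2 = b * x ^ 2 + a * y ^ 2 := by
    rintro a b ⟨x, y, z, h0, h⟩
    exact ⟨y, x, z, by tauto, by rw [h, add_comm]⟩
  unfold hilbertSymbol
  rw [propext ⟨h a b, h b a⟩]

theorem hilbertSymbol_sq_mul_left {s : F} (hs : s ≠ 0) (a b : F) :
    hilbertSymbol (s ^ 2 * a) b = hilbertSymbol a b := by
  have h : ∀ (s a b : F), s ≠ 0 →
      (∃ x y z : F, (x ≠ 0 ∨ y ≠ 0 ∨ z ≠ 0) ∧ z ^ 2 = s ^ 2 * a * x ^ 2 + b * y ^ 2) →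
      ∃ x y z : F, (x ≠ 0 ∨ y ≠ 0 ∨ z ≠ 0) ∧ z ^ 2 = a * x ^ 2 + b * y ^ 2 := by
    rintro s a b hs ⟨x, y, z, h0, h⟩
    refine ⟨s * x, y, z, ?_, by rw [h]; ring⟩
    simpa [hs] using h0
  have h' := h s⁻¹ (s ^ 2 * a) b (inv_ne_zero hs)
  rw [← mul_assoc, ← mul_pow, inv_mul_cancel₀ hs, one_pow, one_mul] at h'
  unfold hilbertSymbol
  rw [propext ⟨h s a b hs, h'⟩]

theorem hilbertSymbol_sq_mul_right {s : F} (hs : s ≠ 0) (a b : F) :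
    hilbertSymbol a (s ^ 2 * b) = hilbertSymbol a b := by
  rw [hilbertSymbol_comm, hilbertSymbol_sq_mul_left hs, hilbertSymbol_comm]

theorem hilbertSymbol_one_left (b : F) : hilbertSymbol 1 b = 1 :=
  if_pos ⟨1, 0, 1, Or.inl one_ne_zero, by ring⟩

theorem hilbertSymbol_one_right (a : F) : hilbertSymbol a 1 = 1 := by
  rw [hilbertSymbol_comm, hilbertSymbol_one_left]

theorem hilbertSymbol_neg_self (a : F) : hilbertSymbol (-a) a = 1 :=
  if_pos ⟨1, 1, 0, Or.inl one_ne_zero, by ring⟩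

end HilbertSymbol

/-! ### Determinants of parabolic factors modulo squares -/

section RaoX

variable {n : ℕ} {F : Type*} [Field F]

theorem mul_apply_eq_of_mem_siegelParabolic {p : SpGroup n F} (hp : p ∈ siegelParabolic n F) :
    ((spMatrix n F p).toBlocks₂₂)ᵀ * (spMatrix n F p).toBlocks₁₁ = 1 := by
  have h1 := SymplecticGroup.mem_iff'.1 p.2
  change (spMatrix n F p)ᵀ * _ * spMatrix n F p = _ at h1
  have hp' : (spMatrix n F p).toBlocks₂₁ = 0 := hp
  rw [← Matrix.fromBlocks_toBlocks (spMatrix n F p), hp', Matrix.J, Matrix.fromBlocks_transpose,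
    Matrix.fromBlocks_multiply, Matrix.fromBlocks_multiply, Matrix.fromBlocks_inj] at h1
  simpa using h1.2.2.1

theorem det_toBlocks₁₁_ne_zero {p : SpGroup n F} (hp : p ∈ siegelParabolic n F) :
    (spMatrix n F p).toBlocks₁₁.det ≠ 0 := by
  intro h
  have := congrArg Matrix.det (mul_apply_eq_of_mem_siegelParabolic hp)
  rw [Matrix.det_mul, h, mul_zero, Matrix.det_one] at this
  exact zero_ne_one this

theorem one_mem_siegelParabolic : (1 : SpGroup n F) ∈ siegelParabolic n F := by
  change (spMatrix n F 1).toBlocks₂₁ = 0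
  rw [map_one, ← Matrix.fromBlocks_one, Matrix.toBlocks_fromBlocks₂₁]

theorem toBlocks_mul {p p' : SpGroup n F} (hp' : p' ∈ siegelParabolic n F) :
    (spMatrix n F (p * p')).toBlocks₁₁ =
        (spMatrix n F p).toBlocks₁₁ * (spMatrix n F p').toBlocks₁₁ ∧
      (spMatrix n F (p * p')).toBlocks₂₁ =
        (spMatrix n F p).toBlocks₂₁ * (spMatrix n F p').toBlocks₁₁ := by
  have h : (spMatrix n F p').toBlocks₂₁ = 0 := hp'
  rw [map_mul]
  constructor
  · conv_lhs => rw [← Matrix.fromBlocks_toBlocks (spMatrix n F p),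
      ← Matrix.fromBlocks_toBlocks (spMatrix n F p'), Matrix.fromBlocks_multiply]
    simp [h]
  · conv_lhs => rw [← Matrix.fromBlocks_toBlocks (spMatrix n F p),
      ← Matrix.fromBlocks_toBlocks (spMatrix n F p'), Matrix.fromBlocks_multiply]
    simp [h]

theorem mul_mem_siegelParabolic {p p' : SpGroup n F} (hp : p ∈ siegelParabolic n F)
    (hp' : p' ∈ siegelParabolic n F) : p * p' ∈ siegelParabolic n F := by
  change (spMatrix n F (p * p')).toBlocks₂₁ = 0
  rw [(toBlocks_mul hp').2, show (spMatrix n F p).toBlocks₂₁ = 0 from hp, zero_mul]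

theorem inv_mem_siegelParabolic {p : SpGroup n F} (hp : p ∈ siegelParabolic n F) :
    p⁻¹ ∈ siegelParabolic n F := by
  change (spMatrix n F p⁻¹).toBlocks₂₁ = 0
  have h := map_mul_map_inv (spMatrix n F) p
  have hp' : (spMatrix n F p).toBlocks₂₁ = 0 := hp
  rw [← Matrix.fromBlocks_toBlocks (spMatrix n F p),
    ← Matrix.fromBlocks_toBlocks (spMatrix n F p⁻¹),
    ← Matrix.fromBlocks_one, Matrix.fromBlocks_multiply, Matrix.fromBlocks_inj] at h
  have h1 := h.2.2.1
  rw [hp', zero_mul, zero_add] at h1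
  have h3 : (spMatrix n F p).toBlocks₁₁ᵀ * (spMatrix n F p).toBlocks₂₂ = 1 := by
    have := congrArg Matrix.transpose (mul_apply_eq_of_mem_siegelParabolic hp)
    simpa using this
  rw [← one_mul (spMatrix n F p⁻¹).toBlocks₂₁, ← h3, mul_assoc, h1, mul_zero]

/-- The two parabolic factors of an identity `p σ_S = σ_{S'} p'` have the same determinant modulo
squares. -/
theorem exists_det_mul_det_eq_sq {p p' : SpGroup n F} (hp : p ∈ siegelParabolic n F)
    (hp' : p' ∈ siegelParabolic n F) (S S' : Finset (Fin n))
    (h : spMatrix n F p * sigmaMatrix F S = sigmaMatrix F S' * spMatrix n F p') :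
    ∃ u : F, (spMatrix n F p).toBlocks₁₁.det * (spMatrix n F p').toBlocks₁₁.det = u ^ 2 := by
  have had := mul_apply_eq_of_mem_siegelParabolic hp
  have hdet := det_toBlocks₁₁_ne_zero hp
  have hdet' := det_toBlocks₁₁_ne_zero hp'
  rw [← Matrix.fromBlocks_toBlocks (spMatrix n F p), ← Matrix.fromBlocks_toBlocks (spMatrix n F p'),
    show (spMatrix n F p).toBlocks₂₁ = 0 from hp, show (spMatrix n F p').toBlocks₂₁ = 0 from hp',
    sigmaMatrix, sigmaMatrix, Matrix.fromBlocks_multiply, Matrix.fromBlocks_multiply,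
    Matrix.fromBlocks_inj] at h
  obtain ⟨h11, -, h21, -⟩ := h
  set a := (spMatrix n F p).toBlocks₁₁
  set b := (spMatrix n F p).toBlocks₁₂
  set d := (spMatrix n F p).toBlocks₂₂
  set a' := (spMatrix n F p').toBlocks₁₁
  rw [zero_mul, zero_add, mul_zero, add_zero] at h21
  rw [mul_zero, add_zero] at h11
  -- The lower left blocks of the two sides have ranks |S| and |S'|.
  have hcard : S.card = S'.card := by
    classical
    have hd : IsUnit d.det := by
      have := congrArg Matrix.det had
      rw [Matrix.det_mul, Matrix.det_transpose, Matrix.det_one] at this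
      exact IsUnit.of_mul_eq_one _ this
    have h1 := congrArg Matrix.rank h21
    rw [Matrix.rank_mul_eq_right_of_isUnit_det _ _ hd,
      Matrix.rank_mul_eq_left_of_isUnit_det _ _ (isUnit_iff_ne_zero.2 hdet'),
      Matrix.rank_diagonal, Matrix.rank_diagonal] at h1
    simpa using h1
  obtain ⟨e⟩ : Nonempty ({i // i ∈ S} ≃ {i // i ∈ S'}) :=
    Fintype.card_eq.1 (by simpa using hcard)
  -- Permuting the rows by a permutation that carries S to S' makes both a and a' block triangular
  -- for the same subset S. The sign of τ enters twice and drops out.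
  set τ := e.extendSubtype
  have hτ : ∀ i, τ i ∈ S' ↔ i ∈ S := by
    intro i
    by_cases hi : i ∈ S
    · simp [hi, τ, e.extendSubtype_mem i hi]
    · simp [hi, τ, e.extendSubtype_not_mem i hi]
  have h11' : ∀ i j, j ∉ S → (if i ∈ S then 0 else a' (τ i) j) = a (τ i) j := by
    intro i j hj
    have := congrFun (congrFun h11 (τ i)) j
    simp only [Matrix.add_apply, Matrix.mul_diagonal, Matrix.diagonal_mul, hj, if_false, mul_zero,
      mul_one, add_zero, hτ] at this
    rw [this]
    split_ifs <;> simp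
  have h21' : ∀ i j, (if i ∈ S then a' (τ i) j else 0) = if j ∈ S then d (τ i) j else 0 := by
    intro i j
    have := congrFun (congrFun h21 (τ i)) j
    simp only [Matrix.mul_diagonal, Matrix.diagonal_mul, hτ] at this
    simpa using this.symm
  have t1 : ∀ i, ¬ i ∉ S → ∀ j, j ∉ S → a.submatrix τ id i j = 0 := by
    intro i hi j hj
    have := h11' i j hj
    rw [if_pos (not_not.1 hi)] at this
    exact this.symm
  have t2 : ∀ i, ¬ i ∉ S → ∀ j, j ∉ S → a'.submatrix τ id i j = 0 := by
    intro i hi j hj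
    have := h21' i j
    rw [if_pos (not_not.1 hi), if_neg hj] at this
    exact this
  have e1 := Matrix.det_permute τ a
  have e2 := Matrix.det_permute τ a'
  rw [Matrix.twoBlockTriangular_det _ (fun i => i ∉ S) t1] at e1
  rw [Matrix.twoBlockTriangular_det _ (fun i => i ∉ S) t2] at e2
  -- The diagonal blocks off S are equal, and by `b2` those on S are inverse transposes of each
  -- other. The product of the two determinants is therefore the square of the common block
  -- determinant x.
  have b1 : (a'.submatrix τ id).toSquareBlockProp (fun i => i ∉ S) =
      (a.submatrix τ id).toSquareBlockProp (fun i => i ∉ S) := by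
    ext ⟨i, hi⟩ ⟨j, hj⟩
    have := h11' i j hj
    rw [if_neg hi] at this
    exact this
  have b2 : ((a'.submatrix τ id).toSquareBlockProp (fun i => ¬ i ∉ S))ᵀ *
      (a.submatrix τ id).toSquareBlockProp (fun i => ¬ i ∉ S) = 1 := by
    ext ⟨i, hi⟩ ⟨j, hj⟩
    have hx := congrFun (congrFun had i) j
    rw [Matrix.mul_apply, ← Equiv.sum_comp τ,
      ← Fintype.sum_subtype_add_sum_subtype (fun i => i ∉ S)] at hx
    rw [Finset.sum_eq_zero, zero_add] at hx
    · rw [Matrix.mul_apply, show (1 : Matrix {i // ¬ i ∉ S} {i // ¬ i ∉ S} F) ⟨i, hi⟩ ⟨j, hj⟩ =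
        (1 : Matrix (Fin n) (Fin n) F) i j by simp [Matrix.one_apply], ← hx]
      refine Finset.sum_congr rfl ?_
      rintro ⟨x, hxS⟩ -
      have := h21' x i
      rw [if_pos (not_not.1 hxS), if_pos (not_not.1 hi)] at this
      simp only [Matrix.transpose_apply, ← this]
      rfl
    · rintro ⟨x, hxS⟩ -
      have := h21' x i
      rw [if_neg hxS, if_pos (not_not.1 hi)] at this
      simp [← this]
  have b3 := congrArg Matrix.det b2
  rw [Matrix.det_mul, Matrix.det_transpose, Matrix.det_one] at b3
  rw [b1] at e2
  have hs : ((Equiv.Perm.sign τ : ℤ) : F) * ((Equiv.Perm.sign τ : ℤ) : F) = 1 := by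
    rcases Int.units_eq_one_or (Equiv.Perm.sign τ) with h | h <;> rw [h] <;> simp
  set x := ((a.submatrix τ id).toSquareBlockProp (fun i => i ∉ S)).det
  set y := ((a.submatrix τ id).toSquareBlockProp (fun i => ¬ i ∉ S)).det
  refine ⟨x, ?_⟩
  linear_combination (-(a.det * a'.det)) * hs - (((Equiv.Perm.sign τ : ℤ) : F) * a'.det) * e1 -
    x * y * e2 + x ^ 2 * b3

end RaoX

/-! ### Ranga Rao's `x`-function on monomial elements -/

section RaoXMonomial

variable {n : ℕ} {F : Type*} [Field F]

theorem sigmaMatrix_mem_symplecticGroup (S : Finset (Fin n)) :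
    sigmaMatrix F S ∈ Matrix.symplecticGroup (Fin n) F := by
  rw [SymplecticGroup.mem_iff, sigmaMatrix, Matrix.J, Matrix.fromBlocks_transpose,
    Matrix.fromBlocks_multiply, Matrix.fromBlocks_multiply, Matrix.fromBlocks_inj]
  refine ⟨?_, ?_, ?_, ?_⟩ <;> ext i j <;> by_cases hi : i ∈ S <;>
    simp [Matrix.diagonal_apply, Matrix.one_apply, hi] <;> aesop

/-- Two decompositions `p₁ σ_S p₂` of the same element have the same determinant modulo squares. -/
theorem exists_det_eq_sq_mul_det {p₁ p₂ p₁' p₂' : SpGroup n F} (h₁ : p₁ ∈ siegelParabolic n F)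
    (h₂ : p₂ ∈ siegelParabolic n F) (h₁' : p₁' ∈ siegelParabolic n F)
    (h₂' : p₂' ∈ siegelParabolic n F) (S S' : Finset (Fin n))
    (h : spMatrix n F p₁ * sigmaMatrix F S * spMatrix n F p₂ =
      spMatrix n F p₁' * sigmaMatrix F S' * spMatrix n F p₂') :
    ∃ s : F, s ≠ 0 ∧ (spMatrix n F (p₁ * p₂)).toBlocks₁₁.det =
      s ^ 2 * (spMatrix n F (p₁' * p₂')).toBlocks₁₁.det := by
  have hq₁ := mul_mem_siegelParabolic (inv_mem_siegelParabolic h₁') h₁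
  have hq₂ := mul_mem_siegelParabolic h₂' (inv_mem_siegelParabolic h₂)
  have hinv₁ : spMatrix n F p₁'⁻¹ * spMatrix n F p₁' = 1 := by
    rw [← map_mul, inv_mul_cancel, map_one]
  obtain ⟨u, hu⟩ := exists_det_mul_det_eq_sq hq₁ hq₂ S S' (by
    rw [map_mul, map_mul]
    have := congrArg (fun M => spMatrix n F p₁'⁻¹ * M * spMatrix n F p₂⁻¹) h
    simp only [Matrix.mul_assoc, map_mul_map_inv, mul_one] at this
    rw [← Matrix.mul_assoc (spMatrix n F p₁'⁻¹) (spMatrix n F p₁'), hinv₁, one_mul] at this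
    rw [Matrix.mul_assoc, this])
  have e₁ := congrArg Matrix.det (toBlocks_mul (p := p₁') hq₁).1
  have e₂ := congrArg Matrix.det (toBlocks_mul (p := p₂' * p₂⁻¹) h₂).1
  rw [mul_inv_cancel_left, Matrix.det_mul] at e₁
  rw [inv_mul_cancel_right, Matrix.det_mul] at e₂
  rw [(toBlocks_mul h₂).1, (toBlocks_mul h₂').1, Matrix.det_mul, Matrix.det_mul, e₁, e₂]
  have hd := det_toBlocks₁₁_ne_zero hq₂
  have hd₁ := det_toBlocks₁₁_ne_zero hq₁
  refine ⟨u / (spMatrix n F (p₂' * p₂⁻¹)).toBlocks₁₁.det, div_ne_zero ?_ hd, ?_⟩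
  · rintro rfl
    rw [zero_pow two_ne_zero] at hu
    exact mul_ne_zero hd₁ hd hu
  · rw [div_pow, ← hu]
    field_simp

/-- `raoX` is computed from an unspecified decomposition. The exhibited one shows that the choice is
not vacuous, and any two decompositions agree modulo squares. -/
theorem raoX_eq {p₁ p₂ g : SpGroup n F} (h₁ : p₁ ∈ siegelParabolic n F)
    (h₂ : p₂ ∈ siegelParabolic n F) (S : Finset (Fin n))
    (h : spMatrix n F g = spMatrix n F p₁ * sigmaMatrix F S * spMatrix n F p₂) :
    ∃ s : F, s ≠ 0 ∧ raoX g = s ^ 2 * (spMatrix n F (p₁ * p₂)).toBlocks₁₁.det := by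
  obtain ⟨p₁', h₁', p₂', h₂', S', h', hx⟩ : ∃ p₁ ∈ siegelParabolic n F,
      ∃ p₂ ∈ siegelParabolic n F, ∃ S : Finset (Fin n),
      spMatrix n F g = spMatrix n F p₁ * sigmaMatrix F S * spMatrix n F p₂ ∧
      raoX g = (spMatrix n F (p₁ * p₂)).toBlocks₁₁.det :=
    Classical.epsilon_spec (p := fun x => ∃ p₁ ∈ siegelParabolic n F,
      ∃ p₂ ∈ siegelParabolic n F, ∃ S : Finset (Fin n),
      spMatrix n F g = spMatrix n F p₁ * sigmaMatrix F S * spMatrix n F p₂ ∧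
      x = (spMatrix n F (p₁ * p₂)).toBlocks₁₁.det) ⟨_, p₁, h₁, p₂, h₂, S, h, rfl⟩
  rw [hx]
  exact exists_det_eq_sq_mul_det h₁' h₂' h₁ h₂ S' S (h'.symm.trans h)

/-- Take S to be the rows in which the lower left block C is nonzero; the upper left block A
vanishes in exactly these rows. Then g = σ_S p, where p in P_n has upper left block A + C. -/
theorem raoX_eq_of_monomialMatrix {g : SpGroup n F} {π : Equiv.Perm (Fin n ⊕ Fin n)}
    {c : Fin n ⊕ Fin n → F} (hg : spMatrix n F g = monomialMatrix π c)
    (hπ : ∀ p, π p.swap = (π p).swap) :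
    ∃ s : F, s ≠ 0 ∧ raoX g =
      s ^ 2 * ((spMatrix n F g).toBlocks₁₁ + (spMatrix n F g).toBlocks₂₁).det := by
  classical
  set S : Finset (Fin n) := Finset.univ.filter fun j => ∃ i, π (Sum.inl i) = Sum.inr j
  have hA : ∀ i j, i ∈ S → (spMatrix n F g).toBlocks₁₁ i j = 0 := by
    intro i j hi
    obtain ⟨i', hi'⟩ : ∃ i', π (Sum.inl i') = Sum.inr i := by simpa [S] using hi
    rw [Matrix.toBlocks₁₁, Matrix.of_apply, hg, monomialMatrix_apply, if_neg]
    intro h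
    have := hπ (Sum.inl i')
    rw [hi', Sum.swap_inr, h] at this
    simpa using π.injective this
  have hC : ∀ i j, i ∉ S → (spMatrix n F g).toBlocks₂₁ i j = 0 := by
    intro i j hi
    rw [Matrix.toBlocks₂₁, Matrix.of_apply, hg, monomialMatrix_apply, if_neg]
    intro h
    exact hi (by simpa [S] using ⟨j, h.symm⟩)
  set σ : SpGroup n F := ⟨sigmaMatrix F S, sigmaMatrix_mem_symplecticGroup S⟩
  have hσ : spMatrix n F σ⁻¹ = Matrix.fromBlocks (Matrix.diagonal fun i => if i ∈ S then 0 else 1)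
      (Matrix.diagonal fun i => if i ∈ S then 1 else 0)
      (Matrix.diagonal fun i => if i ∈ S then -1 else 0)
      (Matrix.diagonal fun i => if i ∈ S then 0 else 1) := by
    have h1 := map_mul_map_inv (spMatrix n F) σ
    refine (left_inv_eq_right_inv (a := spMatrix n F σ) ?_ h1).symm
    change _ * sigmaMatrix F S = 1
    rw [sigmaMatrix, Matrix.fromBlocks_multiply, ← Matrix.fromBlocks_one, Matrix.fromBlocks_inj]
    refine ⟨?_, ?_, ?_, ?_⟩ <;> ext i j <;> by_cases hi : i ∈ S <;>
      simp [Matrix.diagonal_apply, Matrix.one_apply, hi]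
  have hblocks : spMatrix n F (σ⁻¹ * g) = spMatrix n F σ⁻¹ *
      Matrix.fromBlocks (spMatrix n F g).toBlocks₁₁ (spMatrix n F g).toBlocks₁₂
        (spMatrix n F g).toBlocks₂₁ (spMatrix n F g).toBlocks₂₂ := by
    rw [map_mul, Matrix.fromBlocks_toBlocks]
  rw [hσ, Matrix.fromBlocks_multiply] at hblocks
  have hmem : σ⁻¹ * g ∈ siegelParabolic n F := by
    change (spMatrix n F (σ⁻¹ * g)).toBlocks₂₁ = 0
    rw [hblocks, Matrix.toBlocks_fromBlocks₂₁]
    ext i j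
    rw [Matrix.add_apply, Matrix.diagonal_mul, Matrix.diagonal_mul]
    by_cases hi : i ∈ S
    · simp [hi, hA i j hi]
    · simp [hi, hC i j hi]
  obtain ⟨s, hs, h⟩ := raoX_eq (g := g) one_mem_siegelParabolic hmem S (by
    rw [map_one, one_mul]
    change spMatrix n F g = spMatrix n F σ * _
    rw [← map_mul, mul_inv_cancel_left])
  refine ⟨s, hs, ?_⟩
  rw [h, one_mul, hblocks, Matrix.toBlocks_fromBlocks₁₁]
  congr 2
  ext i j
  rw [Matrix.add_apply, Matrix.add_apply, Matrix.diagonal_mul, Matrix.diagonal_mul]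
  by_cases hi : i ∈ S
  · simp [hi, hA i j hi]
  · simp [hi, hC i j hi]

end RaoXMonomial

/-! ### The Leray invariant of coordinate Lagrangians -/

section Leray

variable {n : ℕ} {F : Type*} [Field F]

theorem lagrangianY_apply_inr {v : Fin n ⊕ Fin n → F} (hv : v ∈ lagrangianY n F) (j : Fin n) :
    v (Sum.inr j) = 0 := by
  induction hv using Submodule.span_induction with
  | mem x hx => obtain ⟨i, rfl⟩ := hx; simp
  | zero => rfl
  | add x y _ _ hx hy => simp [hx, hy]
  | smul a x _ hx => simp [hx]

theorem translateY_apply_inr {g : SpGroup n F} {π : Equiv.Perm (Fin n ⊕ Fin n)}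
    {c : Fin n ⊕ Fin n → F} (hg : spMatrix n F g = monomialMatrix π c)
    {v : Fin n ⊕ Fin n → F} (hv : v ∈ translateY g) (j : Fin n) : v (π (Sum.inr j)) = 0 := by
  obtain ⟨u, hu, rfl⟩ := hv
  rw [Matrix.toLin'_apply, Matrix.mulVec, dotProduct]
  refine Finset.sum_eq_zero fun q _ => ?_
  rw [hg, monomialMatrix_apply]
  split_ifs with h
  · rw [← π.injective h, lagrangianY_apply_inr hu, mul_zero]
  · rw [zero_mul]

/-- A monomial translate of Y_n is a coordinate Lagrangian: all its vectors vanish at one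
coordinate, the same for all of them, out of each pair y_j, y*_j. -/
theorem apply_mul_apply_eq_zero {g : SpGroup n F} {π : Equiv.Perm (Fin n ⊕ Fin n)}
    {c : Fin n ⊕ Fin n → F} (hg : spMatrix n F g = monomialMatrix π c)
    (hπ : ∀ p, π p.swap = (π p).swap) {v w : Fin n ⊕ Fin n → F} (hv : v ∈ translateY g)
    (hw : w ∈ translateY g) (p : Fin n ⊕ Fin n) : v p = 0 ∨ w p.swap = 0 := by
  obtain ⟨q, rfl⟩ := π.surjective p
  rcases q with q | q
  · right
    rw [← hπ]
    exact translateY_apply_inr hg hw q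
  · left
    exact translateY_apply_inr hg hv q

/-- In ⟨a, w⟩ each term is a(y*_j) w(y_j) up to sign. If one of the two Lagrangians vanishes at
y*_j, then a(y*_j) = 0, because a + b has no y*_j-coordinate. Otherwise both vanish at y_j, and so
does w. -/
theorem lerayDiagonal_eq_zero {g₁ g₂ : SpGroup n F} {π₁ π₂ : Equiv.Perm (Fin n ⊕ Fin n)}
    {c₁ c₂ : Fin n ⊕ Fin n → F} (hg₁ : spMatrix n F g₁⁻¹ = monomialMatrix π₁ c₁)
    (hg₂ : spMatrix n F g₂ = monomialMatrix π₂ c₂) (hπ₁ : ∀ p, π₁ p.swap = (π₁ p).swap)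
    (hπ₂ : ∀ p, π₂ p.swap = (π₂ p).swap) : lerayDiagonal g₁ g₂ = 0 := by
  have key : ∀ a b v w : Fin n ⊕ Fin n → F, a ∈ translateY g₁⁻¹ → b ∈ translateY g₂ →
      v = a + b → v ∈ leraySpace g₁ g₂ → w ∈ leraySpace g₁ g₂ → sympForm a w = 0 := by
    intro a b v w ha hb hvab hv hw
    refine Finset.sum_eq_zero fun j _ => ?_
    rw [lagrangianY_apply_inr hw.1, mul_zero, zero_sub, neg_eq_zero, mul_eq_zero]
    obtain ⟨a', ha', b', hb', rfl⟩ := Submodule.mem_sup.1 hw.2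
    have hv0 := lagrangianY_apply_inr hv.1 j
    rw [hvab, Pi.add_apply] at hv0
    have h1 := apply_mul_apply_eq_zero hg₁ hπ₁ ha ha' (Sum.inr j)
    have h2 := apply_mul_apply_eq_zero hg₂ hπ₂ hb hb' (Sum.inr j)
    rcases h1 with h1 | h1
    · exact Or.inl h1
    rcases h2 with h2 | h2
    · left
      rwa [h2, add_zero] at hv0
    · right
      rw [Sum.swap_inr] at h1 h2
      rw [Pi.add_apply, h1, h2, add_zero]
  -- The form being zero, any basis is orthogonal. Existence is needed so that the chosen
  -- `lerayDiagonal` is a genuine diagonalization.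
  have hex : ∃ d, IsLerayDiagonalization g₁ g₂ d := by
    set v := Module.finBasis F (leraySpace g₁ g₂)
    have hab : ∀ i, ∃ a b : Fin n ⊕ Fin n → F, a ∈ translateY g₁⁻¹ ∧ b ∈ translateY g₂ ∧
        (v i : Fin n ⊕ Fin n → F) = a + b := by
      intro i
      obtain ⟨a, ha, b, hb, h⟩ := Submodule.mem_sup.1 (v i).2.2
      exact ⟨a, b, ha, hb, h.symm⟩
    choose a b h using hab
    refine ⟨0, v, a, b, h, fun i j => ?_⟩
    rw [key _ _ _ _ (h i).1 (h i).2.1 (h i).2.2 (v i).2 (v j).2, Pi.zero_apply, ite_self]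
  obtain ⟨v, a, b, h, hd⟩ := Classical.epsilon_spec hex
  ext i
  have := hd i i
  rw [if_pos rfl, key _ _ _ _ (h i).1 (h i).2.1 (h i).2.2 (v i).2 (v i).2] at this
  exact this.symm

/-- With zero Leray form the last three factors depend only on l. The two bounds on j leave at most
1 to be halved, and natural division gives l = 0. -/
theorem raoCocycle_eq {g₁ g₂ : SpGroup n F} {π₁ π₂ : Equiv.Perm (Fin n ⊕ Fin n)}
    {c₁ c₂ : Fin n ⊕ Fin n → F} (hg₁ : spMatrix n F g₁⁻¹ = monomialMatrix π₁ c₁)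
    (hg₂ : spMatrix n F g₂ = monomialMatrix π₂ c₂) (hπ₁ : ∀ p, π₁ p.swap = (π₁ p).swap)
    (hπ₂ : ∀ p, π₂ p.swap = (π₂ p).swap) (hj₁ : raoJ g₁ ≤ 1) (hj₂ : raoJ g₂ ≤ raoJ (g₁ * g₂)) :
    raoCocycle g₁ g₂ = hilbertSymbol (raoX g₁) (raoX g₂) *
      hilbertSymbol (-(raoX g₁ * raoX g₂)) (raoX (g₁ * g₂)) := by
  have h := lerayDiagonal_eq_zero hg₁ hg₂ hπ₁ hπ₂
  have hl : raoL g₁ g₂ = 0 := by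
    unfold raoL
    omega
  simp [raoCocycle, hl, lerayDet, lerayHasse, h, hilbertSymbol_one_left]

end Leray

/-! ### Products of representatives in the metaplectic group -/

section MetaplecticProducts

variable {n : ℕ} {F : Type*} [Field F]

theorem det_monomialMatrix {κ : Type*} [Fintype κ] [DecidableEq κ] (π : Equiv.Perm κ) (c : κ → F) :
    (monomialMatrix π c).det = ((Equiv.Perm.sign π : ℤ) : F) * ∏ i, c i := by
  have h : monomialMatrix π c = (Matrix.diagonal c).submatrix (π⁻¹ : Equiv.Perm κ) id := by
    ext i j
    rw [monomialMatrix_apply, Matrix.submatrix_apply, Matrix.diagonal_apply]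
    simp only [id_eq, Equiv.Perm.inv_eq_iff_eq]
    split_ifs with h
    · rw [h]
      exact congrArg c (π.symm_apply_apply j).symm
    · rfl
  rw [h, Matrix.det_permute, Matrix.det_diagonal, Equiv.Perm.sign_inv]

variable [CharZero F]

/-- The matrix of a simple root representative of the Levi subgroup `GL(Y_n)` on `Y_n`. -/
noncomputable def stepMatrix (F : Type*) [Field F] (i : Fin n) (h : i.val + 1 < n) :
    Matrix (Fin n) (Fin n) F :=
  monomialMatrix (Equiv.swap i ⟨i.val + 1, h⟩) fun j => if j = i then -1 else 1

omit [CharZero F] in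
theorem det_stepMatrix (i : Fin n) (h : i.val + 1 < n) : (stepMatrix F i h).det = 1 := by
  have h1 : i ≠ ⟨i.val + 1, h⟩ := fun e => by simpa using congrArg Fin.val e
  rw [stepMatrix, det_monomialMatrix, Equiv.Perm.sign_swap h1]
  simp

theorem toBlocks_spOmega_mul (i : Fin n) (h : i.val + 1 < n) (g : SpGroup n F) :
    (spMatrix n F (spOmega n F i * g)).toBlocks₁₁ =
        stepMatrix F i h * (spMatrix n F g).toBlocks₁₁ ∧
      (spMatrix n F (spOmega n F i * g)).toBlocks₂₁ =
        stepMatrix F i h * (spMatrix n F g).toBlocks₂₁ := by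
  rw [map_mul, spMatrix_spOmega]
  have hl : ∀ a, simpleRefl i (Sum.inl a) = Sum.inl (Equiv.swap i ⟨i.val + 1, h⟩ a) := by
    intro a; simp [simpleRefl, h]
  have hr : ∀ a, simpleRefl i (Sum.inr a) = Sum.inr (Equiv.swap i ⟨i.val + 1, h⟩ a) := by
    intro a; simp [simpleRefl, h]
  constructor
  · ext a b
    obtain ⟨a, rfl⟩ := (Equiv.swap i ⟨i.val + 1, h⟩).surjective a
    rw [stepMatrix, monomialMatrix_mul_apply, Matrix.toBlocks₁₁, Matrix.of_apply, ← hl,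
      monomialMatrix_mul_apply]
    simp [spStep, Matrix.toBlocks₁₁]
  · ext a b
    obtain ⟨a, rfl⟩ := (Equiv.swap i ⟨i.val + 1, h⟩).surjective a
    rw [stepMatrix, monomialMatrix_mul_apply, Matrix.toBlocks₂₁, Matrix.of_apply, ← hr,
      monomialMatrix_mul_apply]
    simp [spStep, Matrix.toBlocks₂₁, h]

theorem spOmega_mul_apply_last (i : Fin n) (h : ¬ i.val + 1 < n) (g : SpGroup n F) (j a : Fin n) :
    (spMatrix n F (spOmega n F i * g)).toBlocks₁₁ j a =
        (if j = i then (spMatrix n F g).toBlocks₂₁ j a else (spMatrix n F g).toBlocks₁₁ j a) ∧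
      (spMatrix n F (spOmega n F i * g)).toBlocks₂₁ j a =
        if j = i then -(spMatrix n F g).toBlocks₁₁ j a else (spMatrix n F g).toBlocks₂₁ j a := by
  rw [map_mul, spMatrix_spOmega]
  have e : simpleRefl i = Equiv.swap (Sum.inl i) (Sum.inr i) := by simp [simpleRefl, h]
  constructor
  · by_cases hj : j = i
    · subst hj
      rw [Matrix.toBlocks₁₁, Matrix.of_apply,
        show (Sum.inl j : Fin n ⊕ Fin n) = simpleRefl j (Sum.inr j) by simp [e],
        monomialMatrix_mul_apply]
      simp [spStep, h, Matrix.toBlocks₂₁]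
    · rw [Matrix.toBlocks₁₁, Matrix.of_apply,
        show (Sum.inl j : Fin n ⊕ Fin n) = simpleRefl i (Sum.inl j) by
          simp [e, Equiv.swap_apply_def, hj],
        monomialMatrix_mul_apply]
      simp [spStep, hj, Matrix.toBlocks₁₁]
  · by_cases hj : j = i
    · subst hj
      rw [Matrix.toBlocks₂₁, Matrix.of_apply,
        show (Sum.inr j : Fin n ⊕ Fin n) = simpleRefl j (Sum.inl j) by simp [e],
        monomialMatrix_mul_apply]
      simp [spStep, Matrix.toBlocks₁₁]
    · rw [Matrix.toBlocks₂₁, Matrix.of_apply,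
        show (Sum.inr j : Fin n ⊕ Fin n) = simpleRefl i (Sum.inr j) by
          simp [e, Equiv.swap_apply_def, hj],
        monomialMatrix_mul_apply]
      simp [spStep, hj, Matrix.toBlocks₂₁]

omit [CharZero F] in
theorem IsAscent.toBlocks₂₁_apply_eq_zero {i : Fin n} {w : Equiv.Perm (Fin n ⊕ Fin n)}
    (hw : ∀ p, w⁻¹ p.swap = (w⁻¹ p).swap) (h : IsAscent i w) (hn : ¬ i.val + 1 < n)
    {g : SpGroup n F} {c : Fin n ⊕ Fin n → F} (hg : spMatrix n F g = monomialMatrix w c)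
    (a : Fin n) : (spMatrix n F g).toBlocks₂₁ i a = 0 := by
  obtain ⟨j, -, hj⟩ := h.isLeft hw hn
  rw [Matrix.toBlocks₂₁, Matrix.of_apply, hg, monomialMatrix_apply, ← hj, if_neg]
  intro hh
  simpa using w.injective hh

theorem raoJ_spOmega_le_one (i : Fin n) : raoJ (spOmega n F i) ≤ 1 := by
  classical
  have h : (spMatrix n F (spOmega n F i)).toBlocks₂₁ =
      Matrix.diagonal (fun j => if j = i then 1 else 0) *
        (spMatrix n F (spOmega n F i)).toBlocks₂₁ := by
    ext a b
    rw [Matrix.diagonal_mul]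
    by_cases ha : a = i
    · simp [ha]
    · rw [if_neg ha, zero_mul]
      by_cases hn : i.val + 1 < n
      · rw [spMatrix_spOmega]
        simp [Matrix.toBlocks₂₁, monomialMatrix_apply, simpleRefl, hn]
      · have := (spOmega_mul_apply_last (F := F) i hn 1 a b).2
        rw [mul_one, if_neg ha, map_one] at this
        rw [this]
        simp [Matrix.toBlocks₂₁]
  rw [raoJ, h]
  refine (Matrix.rank_mul_le_left _ _).trans ?_
  rw [Matrix.rank_diagonal]
  simp

theorem raoJ_le_raoJ_spOmega_mul {i : Fin n} {w : Equiv.Perm (Fin n ⊕ Fin n)}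
    (hw : ∀ p, w⁻¹ p.swap = (w⁻¹ p).swap) (h : IsAscent i w)
    {g : SpGroup n F} {c : Fin n ⊕ Fin n → F} (hg : spMatrix n F g = monomialMatrix w c) :
    raoJ g ≤ raoJ (spOmega n F i * g) := by
  by_cases hn : i.val + 1 < n
  · rw [raoJ, raoJ, (toBlocks_spOmega_mul i hn g).2, Matrix.rank_mul_eq_right_of_isUnit_det _ _
      (by rw [det_stepMatrix]; exact isUnit_one)]
  · have hC : (spMatrix n F g).toBlocks₂₁ = Matrix.diagonal (fun j => if j = i then 0 else 1) *
        (spMatrix n F (spOmega n F i * g)).toBlocks₂₁ := by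
      ext a b
      rw [Matrix.diagonal_mul, (spOmega_mul_apply_last i hn g a b).2]
      by_cases ha : a = i
      · subst ha
        simp [h.toBlocks₂₁_apply_eq_zero hw hn hg]
      · simp [ha]
    rw [raoJ, raoJ, hC]
    exact Matrix.rank_mul_le_right _ _

/-- A short letter multiplies A and C by the same matrix of determinant 1. The last letter exchanges
their last rows up to sign; at an ascent that row of C is zero, so A + C just has its last row
negated. -/
theorem det_toBlocks_add_spOmega_mul {i : Fin n} {w : Equiv.Perm (Fin n ⊕ Fin n)}
    (hw : ∀ p, w⁻¹ p.swap = (w⁻¹ p).swap) (h : IsAscent i w)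
    {g : SpGroup n F} {c : Fin n ⊕ Fin n → F} (hg : spMatrix n F g = monomialMatrix w c) :
    ((spMatrix n F (spOmega n F i * g)).toBlocks₁₁ +
        (spMatrix n F (spOmega n F i * g)).toBlocks₂₁).det =
      (if i.val + 1 < n then 1 else -1) *
        ((spMatrix n F g).toBlocks₁₁ + (spMatrix n F g).toBlocks₂₁).det := by
  by_cases hn : i.val + 1 < n
  · rw [(toBlocks_spOmega_mul i hn g).1, (toBlocks_spOmega_mul i hn g).2, ← mul_add,
      Matrix.det_mul, det_stepMatrix, if_pos hn]
  · have : (spMatrix n F (spOmega n F i * g)).toBlocks₁₁ +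
        (spMatrix n F (spOmega n F i * g)).toBlocks₂₁ =
        Matrix.diagonal (fun j => if j = i then -1 else 1) *
          ((spMatrix n F g).toBlocks₁₁ + (spMatrix n F g).toBlocks₂₁) := by
      ext a b
      rw [Matrix.diagonal_mul, Matrix.add_apply, Matrix.add_apply,
        (spOmega_mul_apply_last i hn g a b).1, (spOmega_mul_apply_last i hn g a b).2]
      by_cases ha : a = i
      · subst ha
        simp [h.toBlocks₂₁_apply_eq_zero hw hn hg]
      · simp [ha]
    rw [this, Matrix.det_mul, Matrix.det_diagonal, if_neg hn]
    simp

theorem det_toBlocks_add_prod_spOmega (l : List (Fin n)) (hl : IsReducedWord l) :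
    ((spMatrix n F (l.map (spOmega n F)).prod).toBlocks₁₁ +
      (spMatrix n F (l.map (spOmega n F)).prod).toBlocks₂₁).det = (-1) ^ numNeg (wordPerm l) := by
  induction l with
  | nil =>
    simp only [List.map_nil, List.prod_nil, map_one, wordPerm_nil, numNeg_one, pow_zero]
    rw [← Matrix.fromBlocks_one, Matrix.toBlocks_fromBlocks₁₁, Matrix.toBlocks_fromBlocks₂₁,
      add_zero, Matrix.det_one]
  | cons i l ih =>
    rw [List.map_cons, List.prod_cons, det_toBlocks_add_spOmega_mul (wordPerm_inv_swap l)
      hl.isAscent (spMatrix_prod_spOmega l hl.tail), ih hl.tail, wordPerm_cons,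
      numNeg_simpleRefl_mul (wordPerm_inv_swap l) hl.isAscent]
    split_ifs <;> simp [pow_add]

theorem exists_raoX_prod_spOmega (l : List (Fin n)) (hl : IsReducedWord l) :
    ∃ s : F, s ≠ 0 ∧ raoX (l.map (spOmega n F)).prod = s ^ 2 * (-1) ^ numNeg (wordPerm l) := by
  rw [← det_toBlocks_add_prod_spOmega l hl]
  exact raoX_eq_of_monomialMatrix (spMatrix_prod_spOmega l hl) (wordPerm_swap l)

theorem isAscent_one (i : Fin n) : IsAscent i 1 := by
  simp [IsAscent]

omit [CharZero F] in
theorem isReducedWord_singleton (i : Fin n) : IsReducedWord [i] := by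
  rintro (- | ⟨j, l⟩) h
  · have h1 := Equiv.congr_fun h (Sum.inl i)
    have h2 := congrArg depth h1
    simp [depth_simpleRefl] at h2
  · simp

/-- For a short letter both x-values to be compared agree modulo squares, and (-x, x) = 1. For the
last letter the value is (-1, (-1)^m) ((-1)^m, (-1)^(m+1)), which is 1 for even m and (-1, -1) for
odd m. -/
theorem raoCocycle_spOmega (i : Fin n) (l : List (Fin n)) (hl : IsReducedWord (i :: l)) :
    raoCocycle (spOmega n F i) (l.map (spOmega n F)).prod =
      hilbertSymbol (-1 : F) (-1) ^ ((if i.val + 1 < n then 0 else 1) * numNeg (wordPerm l)) := by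
  have hg := spMatrix_prod_spOmega (F := F) l hl.tail
  rw [raoCocycle_eq (map_inv_eq_monomialMatrix (spMatrix_spOmega (F := F) i)) hg
    (by rw [simpleRefl_inv]; exact simpleRefl_swap i) (wordPerm_swap l) (raoJ_spOmega_le_one i)
    (raoJ_le_raoJ_spOmega_mul (wordPerm_inv_swap l) hl.isAscent hg)]
  obtain ⟨s₁, hs₁, h₁⟩ := exists_raoX_prod_spOmega (F := F) [i] (isReducedWord_singleton i)
  obtain ⟨s₂, hs₂, h₂⟩ := exists_raoX_prod_spOmega (F := F) l hl.tail
  obtain ⟨s₃, hs₃, h₃⟩ := exists_raoX_prod_spOmega (F := F) (i :: l) hl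
  rw [wordPerm_cons, numNeg_simpleRefl_mul (wordPerm_inv_swap l) hl.isAscent, List.map_cons,
    List.prod_cons] at h₃
  rw [wordPerm_cons, wordPerm_nil, numNeg_simpleRefl_mul (fun _ => rfl) (isAscent_one i),
    List.map_singleton, List.prod_singleton, numNeg_one, add_zero] at h₁
  generalize numNeg (wordPerm l) = m at *
  rw [h₁, h₂, h₃]
  have e : ∀ x y : F, -(s₁ ^ 2 * x * (s₂ ^ 2 * y)) = (s₁ * s₂) ^ 2 * -(x * y) :=
    fun x y => by ring
  rw [hilbertSymbol_sq_mul_left hs₁, hilbertSymbol_sq_mul_right hs₂, e,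
    hilbertSymbol_sq_mul_left (mul_ne_zero hs₁ hs₂), hilbertSymbol_sq_mul_right hs₃]
  split_ifs
  · rw [pow_zero, hilbertSymbol_one_left, one_mul, one_mul, zero_add, hilbertSymbol_neg_self,
      zero_mul, pow_zero]
  · rw [pow_one, one_mul, neg_one_mul, neg_neg, pow_add, pow_one]
    rcases Nat.even_or_odd m with hm | hm
    · rw [hm.neg_one_pow, hilbertSymbol_one_right, hilbertSymbol_one_left]
      obtain ⟨j, rfl⟩ := hm
      rw [← two_mul, pow_mul, Int.units_pow_two, one_pow, one_mul]
    · rw [hm.neg_one_pow, neg_mul_neg, one_mul, hilbertSymbol_one_right, mul_one]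
      obtain ⟨j, rfl⟩ := hm
      rw [pow_succ, pow_mul, Int.units_pow_two, one_pow, one_mul]

/-- The list product is nested to the right, so each step multiplies one letter with the product of
a reduced tail and no associativity is used. The exponents add up as 0 + 1 + … + (m-1). -/
theorem prod_spOmega_mp (l : List (Fin n)) (hl : IsReducedWord l) :
    (l.map fun i => (⟨spOmega n F i, 1⟩ : MpGroup n F)).prod =
      ⟨(l.map (spOmega n F)).prod,
        hilbertSymbol (-1 : F) (-1) ^ (numNeg (wordPerm l) * (numNeg (wordPerm l) - 1) / 2)⟩ := by
  induction l with
  | nil => simp [numNeg_one]; rfl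
  | cons i l ih =>
    rw [List.map_cons, List.prod_cons, ih hl.tail, List.map_cons, List.prod_cons]
    refine MpGroup.ext rfl ?_
    change 1 * _ * raoCocycle _ _ = _
    rw [raoCocycle_spOmega i l hl, one_mul, ← pow_add, wordPerm_cons,
      numNeg_simpleRefl_mul (wordPerm_inv_swap l) hl.isAscent]
    simp only
    congr 1
    split_ifs
    · simp
    · rw [← Nat.choose_two_right, ← Nat.choose_two_right, add_comm 1, Nat.choose_succ_succ' _ 1]
      simp [add_comm]

variable {k : ℕ}

theorem isLSRepresentativeMp_iff (hk : 1 ≤ k) (hkn : k ≤ n) (g : MpGroup n F) :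
    IsLSRepresentativeMp n k F g ↔ ∃ l : List (Fin n), IsReducedWord l ∧
      wordPerm l = weylPerm hkn ∧ g = (l.map fun i => (⟨spOmega n F i, 1⟩ : MpGroup n F)).prod := by
  constructor
  · rintro ⟨ν, hν, l, hl, rfl⟩
    obtain ⟨c, hc⟩ := eq_monomialMatrix_of_representsRelativeWeylElement_sp hkn hν
    have := (isReducedDecomposition_iff (φ := MonoidHom.id _) Function.injective_id
      spMatrix_spOmega hc l).1 hl
    exact ⟨l, this.1, this.2, rfl⟩
  · rintro ⟨l, hl, hw, rfl⟩
    have h := spMatrix_prod_spOmega (F := F) l hl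
    rw [hw] at h
    exact ⟨_, representsRelativeWeylElement_sp hk hkn h, l,
      (isReducedDecomposition_iff (φ := MonoidHom.id _) Function.injective_id
        spMatrix_spOmega h l).2 ⟨hl, hw⟩, rfl⟩

theorem existsUnique_isLSRepresentativeMp (F : Type*) [Field F] [CharZero F] (hk : 1 ≤ k)
    (hkn : k ≤ n) : ∃ w : MpGroup n F,
      spMatrix n F w.toSp = wMMatrix n k F ∧
      w.sign = hilbertSymbol (-1 : F) (-1) ^ (k * (k - 1) / 2) ∧
      ∀ g : MpGroup n F, IsLSRepresentativeMp n k F g ↔ g = w := by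
  have key : ∀ l : List (Fin n), IsReducedWord l → wordPerm l = weylPerm hkn →
      spMatrix n F (l.map fun i => (⟨spOmega n F i, 1⟩ : MpGroup n F)).prod.toSp =
        wMMatrix n k F ∧
      (l.map fun i => (⟨spOmega n F i, 1⟩ : MpGroup n F)).prod.sign =
        hilbertSymbol (-1 : F) (-1) ^ (k * (k - 1) / 2) := by
    intro l hl hw
    rw [prod_spOmega_mp l hl, spMatrix_prod_spOmega l hl, hw, numNeg_weylPerm,
      monomialMatrix_spCoef_weylPerm]
    exact ⟨rfl, rfl⟩
  obtain ⟨l, hl, hw⟩ := exists_isReducedWord_weylPerm hkn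
  refine ⟨_, (key l hl hw).1, (key l hl hw).2, fun g => ?_⟩
  rw [isLSRepresentativeMp_iff hk hkn]
  constructor
  · rintro ⟨l', hl', hw', rfl⟩
    refine MpGroup.ext (Subtype.ext ?_) ((key l' hl' hw').2.trans (key l hl hw).2.symm)
    exact (key l' hl' hw').1.trans (key l hl hw).1.symm
  · rintro rfl
    exact ⟨l, hl, hw, rfl⟩

end MetaplecticProducts

/-! ### Weyl group representatives in the split orthogonal group -/

section OrthogonalRepresentatives

variable {n k : ℕ} {F : Type*} [Field F]

/-- The index of `x_i` or `x*_i`. -/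
def orthPoint (p : Fin n ⊕ Fin n) : OrthIndex n := Sum.elim ix ixs p

@[simp] theorem orthPoint_inl (i : Fin n) : orthPoint (Sum.inl i) = ix i := rfl

@[simp] theorem orthPoint_inr (i : Fin n) : orthPoint (Sum.inr i) = ixs i := rfl

theorem orthPoint_injective : Function.Injective (orthPoint : Fin n ⊕ Fin n → OrthIndex n) := by
  rintro (i | i) (j | j) h <;> simp_all

theorem orthIndex_cases {motive : OrthIndex n → Prop} (h : ∀ p, motive (orthPoint p))
    (h0 : motive ix0) (a : OrthIndex n) : motive a := by
  rcases a with i | (⟨⟩ | i)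
  · exact h (Sum.inl i)
  · exact h0
  · exact h (Sum.inr i)

/-- The index set of the basis of `V` as the set of `±i` and one more point. -/
def orthEquiv (n : ℕ) : (Fin n ⊕ Fin n) ⊕ Unit ≃ OrthIndex n :=
  (Equiv.sumAssoc _ _ _).trans (Equiv.sumCongr (Equiv.refl _) (Equiv.sumComm _ _))

/-- The permutation of the basis vectors of `V` given by a signed permutation. -/
def orthPerm : Equiv.Perm (Fin n ⊕ Fin n) →* Equiv.Perm (OrthIndex n) where
  toFun π := (orthEquiv n).permCongr (Equiv.sumCongr π 1)
  map_one' := by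
    ext1 a
    rcases a with i | (⟨⟩ | i) <;> rfl
  map_mul' π π' := by
    ext1 a
    rcases a with i | (⟨⟩ | i) <;> simp [Equiv.permCongr_apply, orthEquiv]

@[simp] theorem orthPerm_orthPoint (π : Equiv.Perm (Fin n ⊕ Fin n)) (p : Fin n ⊕ Fin n) :
    orthPerm π (orthPoint p) = orthPoint (π p) := by
  have h : ∀ q : Fin n ⊕ Fin n, orthEquiv n (Sum.inl q) = orthPoint q := by
    rintro (i | i) <;> rfl
  change (orthEquiv n).permCongr (Equiv.sumCongr π 1) _ = _
  rw [Equiv.permCongr_apply, ← h p, Equiv.symm_apply_apply]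
  exact h (π p)

@[simp] theorem orthPerm_ix0 (π : Equiv.Perm (Fin n ⊕ Fin n)) : orthPerm π ix0 = ix0 := rfl

theorem orthPerm_injective :
    Function.Injective (orthPerm : Equiv.Perm (Fin n ⊕ Fin n) → Equiv.Perm (OrthIndex n)) := by
  intro π π' h
  ext1 p
  apply orthPoint_injective
  rw [← orthPerm_orthPoint, h, orthPerm_orthPoint]

/-- Coefficients on the basis of `V`. -/
def orthCoef {R : Type*} (c : Fin n ⊕ Fin n → R) (c₀ : R) : OrthIndex n → R :=
  Sum.elim (fun i => c (Sum.inl i)) (Sum.elim (fun _ => c₀) fun i => c (Sum.inr i))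

@[simp] theorem orthCoef_orthPoint {R : Type*} (c : Fin n ⊕ Fin n → R) (c₀ : R)
    (p : Fin n ⊕ Fin n) :
    orthCoef c c₀ (orthPoint p) = c p := by
  rcases p with i | i <;> rfl

@[simp] theorem orthCoef_ix0 {R : Type*} (c : Fin n ⊕ Fin n → R) (c₀ : R) :
    orthCoef c c₀ ix0 = c₀ := rfl

theorem soMatrix_soOmega [CharZero F] (i : Fin n) :
    soMatrix (splitForm n F) (soOmega n F i) = monomialMatrix (orthPerm (simpleRefl i))
      (orthCoef (soStep F i) (if i.val + 1 < n then 1 else -1)) := by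
  obtain ⟨h3, h3'⟩ := soRootVector_cube n F i
  change tripleExp _ _ = _
  rw [tripleExp, exp_eq_of_cube_eq_zero _ h3, exp_eq_of_cube_eq_zero _ (by
    rw [Odd.neg_pow (by decide), h3', neg_zero]), neg_sq]
  unfold soNegRootVector soRootVector
  by_cases h : i.val + 1 < n
  · have h1 : i ≠ ⟨i.val + 1, h⟩ := fun e => by simpa using congrArg Fin.val e
    have h2 : (Matrix.single (ix i) (ix ⟨i.val + 1, h⟩) (1 : F) -
        Matrix.single (ixs ⟨i.val + 1, h⟩) (ixs i) 1) ^ 2 = 0 := by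
      simp [pow_two, mul_sub, sub_mul, h1, h1.symm]
    have h2' : (Matrix.single (ix ⟨i.val + 1, h⟩) (ix i) (1 : F) -
        Matrix.single (ixs i) (ixs ⟨i.val + 1, h⟩) 1) ^ 2 = 0 := by
      simp [pow_two, mul_sub, sub_mul, h1, h1.symm]
    simp only [dif_pos h, if_pos h, h2, h2', smul_zero, add_zero]
    simp only [mul_add, add_mul, mul_sub, sub_mul, mul_one, one_mul, neg_sub]
    ext p q
    rw [monomialMatrix_apply]
    have hl : ∀ a, orthPerm (simpleRefl i) (ix a) = ix (Equiv.swap i ⟨i.val + 1, h⟩ a) := by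
      intro a
      rw [← orthPoint_inl, orthPerm_orthPoint]
      simp [simpleRefl, h]
    have hr : ∀ a, orthPerm (simpleRefl i) (ixs a) = ixs (Equiv.swap i ⟨i.val + 1, h⟩ a) := by
      intro a
      rw [← orthPoint_inr, orthPerm_orthPoint]
      simp [simpleRefl, h]
    rcases q with b | (⟨⟩ | b)
    · rw [hl]
      rcases p with a | (⟨⟩ | a) <;>
        simp [orthCoef, soStep, Matrix.one_apply, Matrix.single_apply, Equiv.swap_apply_def, h1,
          h1.symm]
      grind
    · rw [orthPerm_ix0]
      rcases p with a | (⟨⟩ | a) <;>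
        simp [orthCoef, h1, h1.symm]
    · rw [hr]
      rcases p with a | (⟨⟩ | a) <;>
        simp [orthCoef, soStep, Matrix.one_apply, Matrix.single_apply, Equiv.swap_apply_def, h1,
          h1.symm]
      grind
  · have h2 : (2⁻¹ : F) • (Matrix.single (ix i) ix0 (2 : F) - Matrix.single ix0 (ixs i) 1) ^ 2 =
        -Matrix.single (ix i) (ixs i) 1 := by
      simp [pow_two, mul_sub, sub_mul]
    have h2' : (2⁻¹ : F) • (Matrix.single ix0 (ix i) (1 : F) - Matrix.single (ixs i) ix0 2) ^ 2 =
        -Matrix.single (ixs i) (ix i) 1 := by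
      simp [pow_two, mul_sub, sub_mul]
    have two : ∀ a b : OrthIndex n,
        Matrix.single a b (2 : F) = Matrix.single a b 1 + Matrix.single a b 1 := by
      intro a b
      rw [← Matrix.single_add, one_add_one_eq_two]
    -- For the last root the squares of the root vectors are nonzero, so each exponential has a
    -- quadratic term. The product sends x_n to -x*_n, x*_n to -x_n and x_0 to -x_0.
    have hprod : (1 + (Matrix.single (ix i) ix0 (2 : F) - Matrix.single ix0 (ixs i) 1) +
        -Matrix.single (ix i) (ixs i) 1) *
        (1 + -(Matrix.single ix0 (ix i) (1 : F) - Matrix.single (ixs i) ix0 2) +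
        -Matrix.single (ixs i) (ix i) 1) *
        (1 + (Matrix.single (ix i) ix0 (2 : F) - Matrix.single ix0 (ixs i) 1) +
        -Matrix.single (ix i) (ixs i) 1) =
        1 - Matrix.single (ix i) (ix i) 1 - Matrix.single (ixs i) (ixs i) 1 -
          Matrix.single ix0 ix0 2 - Matrix.single (ixs i) (ix i) 1 -
          Matrix.single (ix i) (ixs i) 1 := by
      simp only [mul_add, add_mul, mul_sub, sub_mul, mul_neg, neg_mul, mul_one, one_mul, neg_sub,
        two]
      simp
      abel
    simp only [dif_neg h, if_neg h, h2, h2', hprod]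
    ext p q
    rw [monomialMatrix_apply]
    have hl : ∀ a, orthPerm (simpleRefl i) (ix a) = if a = i then ixs i else ix a := by
      intro a
      rw [← orthPoint_inl, orthPerm_orthPoint]
      by_cases ha : a = i <;> simp [simpleRefl, h, Equiv.swap_apply_def, ha]
    have hr : ∀ a, orthPerm (simpleRefl i) (ixs a) = if a = i then ix i else ixs a := by
      intro a
      rw [← orthPoint_inr, orthPerm_orthPoint]
      by_cases ha : a = i <;> simp [simpleRefl, h, Equiv.swap_apply_def, ha]
    rcases q with b | (⟨⟩ | b)
    · rw [hl]
      by_cases hb : b = i <;> rcases p with a | (⟨⟩ | a) <;>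
        simp [orthCoef, soStep, Matrix.one_apply, Matrix.single_apply, hb]
      all_goals grind
    · rw [orthPerm_ix0]
      rcases p with a | (⟨⟩ | a) <;>
        simp [orthCoef]
      all_goals grind
    · rw [hr]
      by_cases hb : b = i <;> rcases p with a | (⟨⟩ | a) <;>
        simp [orthCoef, soStep, Matrix.one_apply, Matrix.single_apply, hb]
      all_goals grind

theorem soMatrix_prod_soOmega [CharZero F] (l : List (Fin n)) (hl : IsReducedWord l) :
    soMatrix (splitForm n F) (l.map (soOmega n F)).prod = monomialMatrix (orthPerm (wordPerm l))
      (orthCoef (soCoef F (wordPerm l)) ((-1) ^ numNeg (wordPerm l))) := by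
  refine IsReducedWord.rec_on
    (motive := fun l => soMatrix (splitForm n F) (l.map (soOmega n F)).prod =
      monomialMatrix (orthPerm (wordPerm l))
        (orthCoef (soCoef F (wordPerm l)) ((-1) ^ numNeg (wordPerm l)))) ?_ ?_ l hl
  · simp only [List.map_nil, List.prod_nil, map_one, wordPerm_nil, numNeg_one, pow_zero]
    rw [← monomialMatrix_one]
    congr 1
    ext a
    induction a using orthIndex_cases with
    | h p => rw [orthCoef_orthPoint, soCoef_one]
    | h0 => rfl
  · intro i l ha ih
    rw [List.map_cons, List.prod_cons, map_mul, ih, soMatrix_soOmega, monomialMatrix_mul,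
      wordPerm_cons, map_mul]
    congr 1
    ext a
    induction a using orthIndex_cases with
    | h p =>
      rw [orthPerm_orthPoint, orthCoef_orthPoint, orthCoef_orthPoint, orthCoef_orthPoint,
        soCoef_simpleRefl_mul F (wordPerm_inv_swap l) ha]
    | h0 =>
      rw [orthPerm_ix0, orthCoef_ix0, orthCoef_ix0, orthCoef_ix0,
        numNeg_simpleRefl_mul (wordPerm_inv_swap l) ha, pow_add]
      split_ifs <;> simp

theorem monomialMatrix_soCoef_weylPerm (hkn : k ≤ n) :
    monomialMatrix (orthPerm (weylPerm hkn)) (orthCoef (soCoef F (weylPerm hkn)) ((-1) ^ k)) =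
      wLMatrix n k F := by
  ext p q
  rw [monomialMatrix_apply, wLMatrix, Matrix.smul_apply, smul_eq_mul]
  induction q using orthIndex_cases with
  | h0 => rcases p with a | (⟨⟩ | a) <;> simp
  | h q =>
    rw [orthPerm_orthPoint, orthCoef_orthPoint]
    rcases q with b | b <;> by_cases hb : b.val < k <;> rcases p with a | (⟨⟩ | a) <;>
      simp only [weylPerm_inl, weylPerm_inr, soCoef_weylPerm_inl, soCoef_weylPerm_inr, hb, if_true,
        if_false, Matrix.fromBlocks_apply₁₁, Matrix.fromBlocks_apply₁₂, Matrix.fromBlocks_apply₂₁,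
        Matrix.fromBlocks_apply₂₂, lastProj, antidiagJ, Matrix.diagonal_apply, orthPoint_inl,
        Matrix.fromCols_apply_inr, Matrix.fromRows_apply_inl,
        Matrix.fromRows_apply_inr, orthPoint_inr, Matrix.zero_apply, mul_zero,
        Matrix.of_apply, Sum.inl.injEq, Sum.inr.injEq, reduceCtorEq, Fin.ext_iff]
    · simp; grind
    · by_cases h : a.val + b.val + 1 = k
      · rw [if_pos h, if_pos (by omega), ← pow_add, ← h,
          show a.val + b.val + 1 + (n + a.val + 1) = n + b.val + 2 * (a.val + 1) by ring,
          neg_one_pow_add_two_mul]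
        simp [pow_succ]
      · rw [if_neg h, if_neg (by omega), mul_zero]
    · split_ifs with h1 h2 <;> first | omega | simp
    · rw [if_neg (by omega), mul_zero]
    · by_cases h : a.val + b.val + 1 = k
      · rw [if_pos h, if_pos (by omega), ← pow_add, ← h,
          show a.val + b.val + 1 + (n + a.val + 1) = n + b.val + 2 * (a.val + 1) by ring,
          neg_one_pow_add_two_mul]
        simp [pow_succ]
      · rw [if_neg h, if_neg (by omega), mul_zero]
    · simp; grind
    · rw [if_neg (by omega), mul_zero]
    · split_ifs with h1 h2 <;> first | omega | simp

end OrthogonalRepresentatives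

/-! ### Gram matrices, root vectors and a regular element for `SO(V^+)` -/

section OrthogonalUniqueness

variable {n k : ℕ} {F : Type*} [Field F]

theorem gramMatrix_eq_toMatrix₂' (q : QuadraticForm F (OrthIndex n → F)) :
    gramMatrix q = LinearMap.toMatrix₂' F q.polarBilin := by
  ext a b
  rw [LinearMap.toMatrix₂'_apply]
  rfl

theorem transpose_mul_gramMatrix_mul {q : QuadraticForm F (OrthIndex n → F)} (g : SOGroup q) :
    (soMatrix q g)ᵀ * gramMatrix q * soMatrix q g = gramMatrix q := by
  have h := LinearMap.toMatrix₂'_compl₁₂ (R := F) q.polarBilin (Matrix.toLin' (soMatrix q g))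
    (Matrix.toLin' (soMatrix q g))
  rw [LinearMap.toMatrix'_toLin', ← gramMatrix_eq_toMatrix₂'] at h
  rw [← h, gramMatrix_eq_toMatrix₂']
  congr 1
  refine LinearMap.ext fun v => LinearMap.ext fun w => ?_
  have hq : ∀ v, q (soMatrix q g *ᵥ v) = q v := g.2
  simp only [LinearMap.compl₁₂_apply, Matrix.toLin'_apply, QuadraticMap.polarBilin_apply_apply,
    QuadraticMap.polar, ← Matrix.mulVec_add, hq]

theorem quadraticForm_mulVec_eq [CharZero F] {q : QuadraticForm F (OrthIndex n → F)}
    {A : Matrix (OrthIndex n) (OrthIndex n) F} (hA : Aᵀ * gramMatrix q * A = gramMatrix q)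
    (v : OrthIndex n → F) : q (A *ᵥ v) = q v := by
  have h := LinearMap.toMatrix₂'_compl₁₂ (R := F) q.polarBilin (Matrix.toLin' A) (Matrix.toLin' A)
  rw [LinearMap.toMatrix'_toLin', ← gramMatrix_eq_toMatrix₂', hA, gramMatrix_eq_toMatrix₂'] at h
  have h1 := (LinearMap.toMatrix₂' F).injective h
  have h2 := congrArg (fun B => B v v) h1
  simp only [LinearMap.compl₁₂_apply, Matrix.toLin'_apply, QuadraticMap.polarBilin_apply_apply,
    QuadraticMap.polar_self] at h2
  simpa using h2

/-- The involution `x_i ↔ x*_i` of the basis of `V`. -/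
def orthSwap (a : OrthIndex n) : OrthIndex n :=
  Sum.elim (fun i => ixs i) (Sum.elim (fun _ => ix0) fun i => ix i) a

@[simp] theorem orthSwap_orthPoint (p : Fin n ⊕ Fin n) :
    orthSwap (orthPoint p) = orthPoint p.swap := by
  rcases p with i | i <;> rfl

theorem gramMatrix_splitForm_apply (a b : OrthIndex n) : gramMatrix (splitForm n F) a b =
    if b = orthSwap a then (if a = ix0 then 2 else 1) else 0 := by
  rw [gramMatrix, Matrix.of_apply, polar_splitForm]
  rcases a with i | (⟨⟩ | i) <;> rcases b with j | (⟨⟩ | j) <;>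
    simp [orthSwap, Pi.single_apply, eq_comm]

theorem orthPoint_ne_ix0 (p : Fin n ⊕ Fin n) : orthPoint p ≠ ix0 := by
  rcases p with i | i <;> simp

theorem soRootVector_orthPoint (i : Fin n) (h : i.val + 1 < n) (p q : Fin n ⊕ Fin n) :
    soRootVector n F i (orthPoint p) (orthPoint q) = spRootVector n F i p q := by
  simp only [soRootVector, spRootVector, dif_pos h]
  rcases p with a | a <;> rcases q with b | b <;> simp [Matrix.single_apply]

theorem soRootVector_ix0 (i : Fin n) (h : i.val + 1 < n) (a : OrthIndex n) :
    soRootVector n F i a ix0 = 0 ∧ soRootVector n F i ix0 a = 0 := by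
  simp [soRootVector, dif_pos h]

theorem soRootVector_last (i : Fin n) (h : ¬ i.val + 1 < n) (a b : OrthIndex n) :
    soRootVector n F i a b =
      if a = ix i ∧ b = ix0 then 2 else if a = ix0 ∧ b = ixs i then -1 else 0 := by
  rw [soRootVector, dif_neg h, Matrix.sub_apply, Matrix.single_apply, Matrix.single_apply]
  rcases a with a | (⟨⟩ | a) <;> rcases b with b | (⟨⟩ | b) <;> simp [eq_comm]
  split_ifs <;> simp

theorem spRootVector_ne_zero_iff [CharZero F] (i : Fin n) (p q : Fin n ⊕ Fin n) :
    spRootVector n F i p q ≠ 0 ↔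
      (p = Sum.inl i ∧ q = below i) ∨ (p = (below i).swap ∧ q = Sum.inr i) := by
  simp only [spRootVector_apply, ← depth_injective.eq_iff, depth_swap, depth_below, depth_inl,
    depth_inr]
  split_ifs <;> simp <;> omega

/-- For a GL-type root the symplectic result applies: the extra sign in `soCoef` is equal at the two
indices of each entry and cancels. The last root involves only x_n, x_0, x*_n, on which the element
is the scalar (-1)^k when k < n. -/
theorem soRootVector_weylPerm [CharZero F] (hkn : k ≤ n) (i : Fin n) (hi : i.val + 1 ≠ k) :
    ∃ j : Fin n, j.val + 1 ≠ k ∧ ∀ a b : OrthIndex n,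
      soRootVector n F j (orthPerm (weylPerm hkn) a) (orthPerm (weylPerm hkn) b) =
        orthCoef (soCoef F (weylPerm hkn)) ((-1) ^ k) a * soRootVector n F i a b *
          (orthCoef (soCoef F (weylPerm hkn)) ((-1) ^ k) b)⁻¹ := by
  by_cases h : i.val + 1 < n
  · obtain ⟨j, hj, hjn, hroot⟩ := exists_spRootVector_weylPerm (F := F) hkn i hi
    have hj' := hjn.2 h
    refine ⟨j, hj, fun a b => ?_⟩
    induction a using orthIndex_cases with
    | h0 => simp [(soRootVector_ix0 (F := F) j hj' _).2, (soRootVector_ix0 (F := F) i h _).2]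
    | h p =>
    induction b using orthIndex_cases with
    | h0 => simp [(soRootVector_ix0 (F := F) j hj' _).1, (soRootVector_ix0 (F := F) i h _).1]
    | h q =>
      rw [orthPerm_orthPoint, orthPerm_orthPoint, soRootVector_orthPoint j hj',
        soRootVector_orthPoint i h, hroot, orthCoef_orthPoint, orthCoef_orthPoint]
      by_cases h0 : spRootVector n F i p q = 0
      · rw [h0, mul_zero, mul_zero, zero_mul, zero_mul]
      have hb : below i = Sum.inl ⟨i.val + 1, h⟩ := by simp [below, h]
      rcases (spRootVector_ne_zero_iff i p q).1 h0 with ⟨rfl, rfl⟩ | ⟨rfl, rfl⟩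
      · simp [hb, soCoef]
      · rw [hb]
        by_cases hik : i.val + 1 < k
        · simp [soCoef, hik, show i.val < k by omega]
        · simp [soCoef, hik, show ¬ i.val < k by omega]
  · refine ⟨i, hi, fun a b => ?_⟩
    have hk : k ≤ i.val := by omega
    have hl : orthPerm (weylPerm hkn) (ix i) = ix i := by
      rw [← orthPoint_inl, orthPerm_orthPoint, weylPerm_inl, if_neg (by omega)]
    have hr : orthPerm (weylPerm hkn) (ixs i) = ixs i := by
      rw [← orthPoint_inr, orthPerm_orthPoint, weylPerm_inr, if_neg (by omega)]
    have e1 : ∀ a, orthPerm (weylPerm hkn) a = ix i ↔ a = ix i := fun a => by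
      rw [← (orthPerm (weylPerm hkn)).injective.eq_iff (a := a), hl]
    have e2 : ∀ a, orthPerm (weylPerm hkn) a = ixs i ↔ a = ixs i := fun a => by
      rw [← (orthPerm (weylPerm hkn)).injective.eq_iff (a := a), hr]
    have e3 : ∀ a, orthPerm (weylPerm hkn) a = ix0 ↔ a = ix0 := fun a => by
      rw [← (orthPerm (weylPerm hkn)).injective.eq_iff (a := a), orthPerm_ix0]
    have c1 : orthCoef (soCoef F (weylPerm hkn)) ((-1) ^ k) (ix i) = (-1) ^ k := by
      rw [← orthPoint_inl, orthCoef_orthPoint, soCoef_weylPerm_inl, if_neg (by omega)]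
    have c2 : orthCoef (soCoef F (weylPerm hkn)) ((-1) ^ k) (ixs i) = (-1) ^ k := by
      rw [← orthPoint_inr, orthCoef_orthPoint, soCoef_weylPerm_inr, if_neg (by omega)]
    have c0 : (-1 : F) ^ k * ((-1) ^ k)⁻¹ = 1 := mul_inv_cancel₀ (pow_ne_zero _ (by simp))
    simp only [soRootVector_last i h, e1, e2, e3]
    split_ifs with h1 h2
    · rw [h1.1, h1.2, c1, orthCoef_ix0]
      linear_combination -2 * c0
    · rw [h2.1, h2.2, c2, orthCoef_ix0]
      linear_combination c0
    · simp

theorem representsRelativeWeylElement_so [CharZero F] (hk : 1 ≤ k) (hkn : k ≤ n)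
    {ν : SOGroup (splitForm n F)}
    (hν : soMatrix (splitForm n F) ν = monomialMatrix (orthPerm (weylPerm hkn))
      (orthCoef (soCoef F (weylPerm hkn)) ((-1) ^ k))) :
    RepresentsRelativeWeylElement (soMatrix (splitForm n F)) (soTorus n F) (soLevi n k F)
      (soRootVector n F) {i | i.val + 1 ≠ k} ν := by
  have hn : 0 < n := by omega
  refine ⟨mem_normalizer_blockSubgroup hν ?_, mem_normalizer_blockSubgroup hν ?_, ?_, ?_⟩
  · exact fun i j => (orthPerm (weylPerm hkn)).injective.eq_iff
  · have hlab : ∀ a, soLabel n k (orthPerm (weylPerm hkn) a) = 2 - soLabel n k a := by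
      intro a
      induction a using orthIndex_cases with
      | h0 => simp [soLabel]
      | h p =>
        rw [orthPerm_orthPoint]
        rcases p with i | i <;> by_cases hi : i.val < k
        · simp [soLabel, hi, show k - 1 - i.val < k by omega]
        · simp [soLabel, hi]
        · simp [soLabel, hi, show k - 1 - i.val < k by omega]
        · simp [soLabel, hi]
    intro p q
    rw [hlab, hlab, sub_right_inj]
  · intro hM
    have h1 := (hM (orthPerm (weylPerm hkn) (orthPoint (Sum.inl ⟨0, hn⟩)))
      (orthPoint (Sum.inl ⟨0, hn⟩)) (by
      rw [orthPerm_orthPoint]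
      simp [soLabel, show 0 < k by omega, show k - 1 < k by omega])).1
    rw [hν, monomialMatrix_apply, if_pos rfl] at h1
    exact coef_ne_zero hν _ h1
  · intro i hi
    obtain ⟨j, hj, h⟩ := soRootVector_weylPerm (F := F) hkn i hi
    refine ⟨j, hj, 1, ?_⟩
    ext p q
    obtain ⟨p, rfl⟩ := (orthPerm (weylPerm hkn)).surjective p
    obtain ⟨q, rfl⟩ := (orthPerm (weylPerm hkn)).surjective q
    rw [conj_apply hν, one_smul, h]

theorem exists_regular_mem_soTorus (n : ℕ) (F : Type*) [Field F] [CharZero F] :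
    ∃ (t : SOGroup (splitForm n F)) (τ : OrthIndex n → F), Function.Injective τ ∧
      soMatrix (splitForm n F) t = Matrix.diagonal τ ∧ t ∈ soTorus n F := by
  set e : Fin n → F := fun i => 2 ^ (i.val + 1 : ℤ)
  have he : ∀ i, e i ≠ 0 := fun i => zpow_ne_zero _ two_ne_zero
  set τ : OrthIndex n → F := Sum.elim e (Sum.elim (fun _ => 1) fun i => (e i)⁻¹)
  have hdet : (Matrix.diagonal τ).det = 1 := by
    rw [Matrix.det_diagonal, Fintype.prod_sum_type, Fintype.prod_sum_type]
    simp [τ, Finset.prod_ne_zero_iff, he]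
  have hmem : (⟨_, hdet⟩ : Matrix.SpecialLinearGroup (OrthIndex n) F) ∈
      SOGroup (splitForm n F) := by
    intro v
    change splitForm n F (Matrix.diagonal τ *ᵥ v) = _
    simp only [splitForm_apply, Matrix.mulVec_diagonal]
    congr 1
    · refine Finset.sum_congr rfl fun i _ => ?_
      simp only [τ, Sum.elim_inl, Sum.elim_inr]
      have := he i
      field_simp
    · simp [τ]
  refine ⟨⟨_, hmem⟩, τ, ?_, rfl, ?_⟩
  · have hz : τ = (fun m : ℤ => (2 : F) ^ m) ∘ Sum.elim (fun i : Fin n => (i.val + 1 : ℤ))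
        (Sum.elim (fun _ => 0) (fun i : Fin n => -(i.val + 1 : ℤ))) := by
      ext p
      rcases p with i | (⟨⟩ | i) <;> simp [τ, e, ← zpow_neg]
    rw [hz]
    refine (two_zpow_injective F).comp ?_
    rintro (i | (⟨⟩ | i)) (j | (⟨⟩ | j)) h <;> simp [Fin.ext_iff] at * <;> omega
  · intro p q hpq
    set t : SOGroup (splitForm n F) := ⟨_, hmem⟩
    have hinv : soMatrix (splitForm n F) t⁻¹ = Matrix.diagonal fun a => (τ a)⁻¹ := by
      refine (left_inv_eq_right_inv (a := soMatrix (splitForm n F) t) ?_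
        (map_mul_map_inv (soMatrix (splitForm n F)) t)).symm
      change _ * Matrix.diagonal τ = 1
      rw [Matrix.diagonal_mul_diagonal, ← Matrix.diagonal_one]
      congr 1
      ext p
      rcases p with i | (⟨⟩ | i) <;> simp [τ, he]
    refine ⟨Matrix.diagonal_apply_ne _ hpq, ?_⟩
    rw [hinv]
    exact Matrix.diagonal_apply_ne _ hpq

end OrthogonalUniqueness

/-! ### The representative in `SO(V^+)` and its uniqueness -/

section OrthogonalMain

variable {n k : ℕ} {F : Type*} [Field F] [CharZero F]

theorem eq_monomialMatrix_of_representsRelativeWeylElement_so (hkn : k ≤ n)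
    {ν : SOGroup (splitForm n F)}
    (h : RepresentsRelativeWeylElement (soMatrix (splitForm n F)) (soTorus n F) (soLevi n k F)
      (soRootVector n F) {i | i.val + 1 ≠ k} ν) :
    ∃ c, soMatrix (splitForm n F) ν = monomialMatrix (orthPerm (weylPerm hkn)) c := by
  obtain ⟨hT, -, hM, hroot⟩ := h
  obtain ⟨t, τ, hτ, ht, htT⟩ := exists_regular_mem_soTorus n F
  obtain ⟨π, c, hν⟩ := exists_eq_monomialMatrix_of_mem_normalizer hτ ht htT hT
  have hc := coef_ne_zero hν
  have hgram : ∀ a b, gramMatrix (splitForm n F) a b ≠ 0 ↔ b = orthSwap a := by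
    intro a b
    rw [gramMatrix_splitForm_apply]
    split_ifs <;> simp_all
  have hswap : ∀ a, π (orthSwap a) = orthSwap (π a) := by
    intro a
    have h2 := congrFun (congrFun (transpose_mul_gramMatrix_mul ν) a) (orthSwap a)
    rw [hν, transpose_mul_mul_monomialMatrix_apply] at h2
    rw [← hgram]
    intro h0
    rw [h0, mul_zero, zero_mul] at h2
    exact (hgram a _).2 rfl h2.symm
  -- The permutation commutes with `orthSwap`, whose only fixed point is the index of x_0.
  have hπ0 : π ix0 = ix0 := by
    have h1 : π ix0 = orthSwap (π ix0) := hswap ix0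
    generalize π ix0 = a at h1
    rcases a with i | (⟨⟩ | i)
    · simp [orthSwap] at h1
    · rfl
    · simp [orthSwap] at h1
  have hU : ∀ i : Fin n, ∃ p, π (ix i) = orthPoint p := by
    intro i
    have h1 : π (ix i) ≠ ix0 := by
      rw [← hπ0, π.injective.ne_iff]
      simp
    generalize π (ix i) = a at h1
    induction a using orthIndex_cases with
    | h p => exact ⟨p, rfl⟩
    | h0 => exact absurd rfl h1
  choose U hU using hU
  have hU' : ∀ i : Fin n, π (ixs i) = orthPoint (U i).swap := by
    intro i
    rw [← orthSwap_orthPoint, ← hU, ← hswap]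
    rfl
  have hX : ∀ (i j : Fin n) (d : F), soMatrix (splitForm n F) ν * soRootVector n F i *
      soMatrix (splitForm n F) ν⁻¹ = d • soRootVector n F j → ∀ a b, soRootVector n F i a b ≠ 0 →
        soRootVector n F j (π a) (π b) ≠ 0 := by
    intro i j d hd a b h2 h3
    have h1 : c a * soRootVector n F i a b * (c b)⁻¹ = d * soRootVector n F j (π a) (π b) := by
      rw [← conj_apply hν, hd, Matrix.smul_apply, smul_eq_mul]
    rw [h3, mul_zero] at h1
    exact mul_ne_zero (mul_ne_zero (hc a) h2) (inv_ne_zero (hc b)) h1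
  have hmain := eq_inl_or_eq_weylPerm hkn U
    (fun i j hij => by
      have := (hU i).trans ((congrArg orthPoint hij).trans (hU j).symm)
      simpa using π.injective this)
    (fun i j hij => by
      have := (hU i).trans ((congrArg orthPoint hij).trans (hU' j).symm)
      simpa using π.injective this)
    (fun i hi hik => by
      obtain ⟨j, -, d, hd⟩ := hroot i hik
      have h1 := hX i j d hd (orthPoint (Sum.inl i)) (orthPoint (below i)) (by
        rw [soRootVector_orthPoint i hi, spRootVector_ne_zero_iff]
        exact Or.inl ⟨rfl, rfl⟩)
      rw [show below i = Sum.inl ⟨i.val + 1, hi⟩ by simp [below, hi], orthPoint_inl, orthPoint_inl,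
        hU, hU] at h1
      -- Every nonzero entry of the last root vector lies in the row or column of x_0, which π
      -- fixes; so a root of GL type cannot go to the last root.
      by_cases hj : j.val + 1 < n
      · rw [soRootVector_orthPoint j hj, spRootVector_ne_zero_iff] at h1
        simp only [below, dif_pos hj, Sum.swap_inl] at h1
        exact ⟨j, hj, h1⟩
      · exfalso
        rw [soRootVector_last j hj, if_neg (fun h => orthPoint_ne_ix0 _ h.2),
          if_neg (fun h => orthPoint_ne_ix0 _ h.1)] at h1
        exact h1 rfl)
    (fun i hi hik => by
      obtain ⟨j, -, d, hd⟩ := hroot i hik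
      have h1 := hX i j d hd (ix i) ix0 (by
        rw [soRootVector_last i hi, if_pos ⟨rfl, rfl⟩]
        exact two_ne_zero)
      rw [hπ0, hU] at h1
      by_cases hj : j.val + 1 < n
      · exact absurd (soRootVector_ix0 j hj _).1 h1
      · have hji : j = i := Fin.ext (by omega)
        subst hji
        rw [soRootVector_last j hj] at h1
        split_ifs at h1 with h2 h3
        · exact orthPoint_injective h2.1
        · simp at h3
        · exact absurd rfl h1)
  have hπ : ∀ w : Equiv.Perm (Fin n ⊕ Fin n), (∀ p, w p.swap = (w p).swap) →
      (∀ i, U i = w (Sum.inl i)) → π = orthPerm w := by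
    intro w hw h
    ext1 a
    induction a using orthIndex_cases with
    | h0 => exact hπ0
    | h p =>
      rw [orthPerm_orthPoint]
      rcases p with i | i
      · rw [orthPoint_inl, hU, h]
      · rw [orthPoint_inr, hU', h, ← hw, Sum.swap_inl]
  rcases hmain with hmain | hmain
  · exfalso
    apply hM
    have h1 : π = 1 := by rw [hπ 1 (fun _ => rfl) hmain, map_one]
    subst h1
    intro p q hpq
    have hpq' : p ≠ q := fun e => hpq (by rw [e])
    rw [map_inv_eq_monomialMatrix hν, hν]
    simp [monomialMatrix_apply, hpq']
  · exact ⟨c, hπ (weylPerm hkn) (weylPerm_swap hkn) hmain ▸ hν⟩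

theorem isLSRepresentativeSO_iff (hk : 1 ≤ k) (hkn : k ≤ n) (g : SOGroup (splitForm n F)) :
    IsLSRepresentativeSO n k F g ↔ ∃ l : List (Fin n), IsReducedWord l ∧
      wordPerm l = weylPerm hkn ∧ g = (l.map (soOmega n F)).prod := by
  constructor
  · rintro ⟨ν, hν, l, hl, rfl⟩
    obtain ⟨c, hc⟩ := eq_monomialMatrix_of_representsRelativeWeylElement_so hkn hν
    have := (isReducedDecomposition_iff orthPerm_injective soMatrix_soOmega hc l).1 hl
    exact ⟨l, this.1, this.2, rfl⟩
  · rintro ⟨l, hl, hw, rfl⟩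
    have h := soMatrix_prod_soOmega (F := F) l hl
    rw [hw, numNeg_weylPerm] at h
    exact ⟨_, representsRelativeWeylElement_so hk hkn h, l,
      (isReducedDecomposition_iff orthPerm_injective soMatrix_soOmega h l).2 ⟨hl, hw⟩, rfl⟩

omit [CharZero F] in
theorem soMatrix_injective (q : QuadraticForm F (OrthIndex n → F)) :
    Function.Injective (soMatrix q) :=
  fun _ _ h => Subtype.ext (Subtype.ext h)

theorem existsUnique_isLSRepresentativeSO (F : Type*) [Field F] [CharZero F] (hk : 1 ≤ k)
    (hkn : k ≤ n) : ∃ w : SOGroup (splitForm n F),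
      soMatrix (splitForm n F) w = wLMatrix n k F ∧
      ∀ g : SOGroup (splitForm n F), IsLSRepresentativeSO n k F g ↔ g = w := by
  have key : ∀ l : List (Fin n), IsReducedWord l → wordPerm l = weylPerm hkn →
      soMatrix (splitForm n F) (l.map (soOmega n F)).prod = wLMatrix n k F := by
    intro l hl hw
    rw [soMatrix_prod_soOmega l hl, hw, numNeg_weylPerm, monomialMatrix_soCoef_weylPerm]
  obtain ⟨l, hl, hw⟩ := exists_isReducedWord_weylPerm hkn
  refine ⟨_, key l hl hw, fun g => ?_⟩
  rw [isLSRepresentativeSO_iff hk hkn]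
  constructor
  · rintro ⟨l', hl', hw', rfl⟩
    exact soMatrix_injective _ ((key l' hl' hw').trans (key l hl hw).symm)
  · rintro rfl
    exact ⟨l, hl, hw, rfl⟩

end OrthogonalMain

/-! ### Pure inner twists -/

section AlgebraicallyClosed

/-- Nondegenerate quadratic forms of equal rank over an algebraically closed field are equivalent;
this is the matrix form. -/
theorem exists_transpose_mul_mul_eq {J K : Type*} [Fintype J] [DecidableEq J] [Field K]
    [IsAlgClosed K] [CharZero K] {A B : Matrix J J K} (hA : A.IsSymm) (hB : B.IsSymm)
    (hA0 : A.det ≠ 0) (hB0 : B.det ≠ 0) : ∃ P : Matrix J J K, Pᵀ * A * P = B := by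
  let : Invertible (2 : K) := invertibleOfNonzero two_ne_zero
  have key : ∀ M : Matrix J J K, M.IsSymm → ∃ Q : QuadraticForm K (J → K),
      QuadraticMap.associated Q = Matrix.toLinearMap₂' K M := by
    intro M hM
    have hs : ∀ v w : J → K, Matrix.toLinearMap₂' K M v w = Matrix.toLinearMap₂' K M w v := by
      intro v w
      simp only [Matrix.toLinearMap₂'_apply']
      rw [Matrix.dotProduct_mulVec, ← Matrix.mulVec_transpose, hM.eq, dotProduct_comm]
    exact ⟨LinearMap.BilinMap.toQuadraticMap (Matrix.toLinearMap₂' K M),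
      QuadraticMap.associated_left_inverse K hs⟩
  obtain ⟨Q₁, h₁⟩ := key A hA
  obtain ⟨Q₂, h₂⟩ := key B hB
  have hm₁ : Q₁.toMatrix' = A := by
    rw [QuadraticForm.toMatrix', h₁, LinearMap.toMatrix'_toLinearMap₂']
  have hm₂ : Q₂.toMatrix' = B := by
    rw [QuadraticForm.toMatrix', h₂, LinearMap.toMatrix'_toLinearMap₂']
  have hs : ∀ M : Matrix J J K, M.det ≠ 0 →
      LinearMap.SeparatingLeft (Matrix.toLinearMap₂' K M : LinearMap.BilinForm K (J → K)) := by
    intro M hM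
    rw [Matrix.separatingLeft_toLinearMap₂'_iff, Matrix.separatingLeft_iff_det_ne_zero]
    exact hM
  obtain ⟨φ⟩ := QuadraticForm.equivalent_of_isAlgClosed Q₂ Q₁ (by rw [h₂]; exact hs B hB0)
    (by rw [h₁]; exact hs A hA0)
  refine ⟨LinearMap.toMatrix' φ.toLinearEquiv.toLinearMap, ?_⟩
  rw [← hm₁, ← QuadraticForm.toMatrix'_comp, ← hm₂]
  congr 1
  ext v
  exact φ.map_app v

end AlgebraicallyClosed

/-! ### Gram determinants and the shape of the Gram matrices -/

section GramMatrix

variable {n k : ℕ} {F : Type*} [Field F]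

theorem gramMatrix_isSymm (q : QuadraticForm F (OrthIndex n → F)) : (gramMatrix q).IsSymm := by
  ext a b
  exact QuadraticMap.polar_comm _ _ _

theorem det_gramMatrix_splitForm : (gramMatrix (splitForm n F)).det = 2 * (-1) ^ n := by
  have h : (gramMatrix (splitForm n F)).submatrix (orthEquiv n) (orthEquiv n) =
      Matrix.fromBlocks (Matrix.fromBlocks 0 1 1 0) 0 0
        (Matrix.of fun _ _ => 2 : Matrix Unit Unit F) := by
    have h1 : ∀ p, orthEquiv n (Sum.inl p) = orthPoint p := by rintro (i | i) <;> rfl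
    have h2 : ∀ u, orthEquiv n (Sum.inr u) = ix0 := fun _ => rfl
    ext (a | ⟨⟩) (b | ⟨⟩)
    · rw [Matrix.submatrix_apply, h1, h1, gramMatrix_splitForm_apply]
      rcases a with i | i <;> rcases b with j | j <;>
        simp [orthSwap, Matrix.one_apply, eq_comm]
    · rw [Matrix.submatrix_apply, h1, h2, gramMatrix_splitForm_apply]
      simp [(orthPoint_ne_ix0 _).symm]
    · rw [Matrix.submatrix_apply, h1, h2, gramMatrix_splitForm_apply]
      simp [orthSwap, orthPoint_ne_ix0]
    · rw [Matrix.submatrix_apply, h2, gramMatrix_splitForm_apply]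
      simp [orthSwap]
  have h3 : (Matrix.fromBlocks 1 1 0 1 : Matrix (Fin n ⊕ Fin n) (Fin n ⊕ Fin n) F).det = 1 := by
    rw [Matrix.det_fromBlocks_one₁₁]
    simp
  have h4 : (Matrix.fromBlocks 0 1 1 0 : Matrix (Fin n ⊕ Fin n) (Fin n ⊕ Fin n) F).det =
      (-1) ^ n := by
    rw [← one_mul (Matrix.det _), ← h3, ← Matrix.det_mul, Matrix.fromBlocks_multiply]
    simp only [mul_zero, mul_one, zero_add, add_zero]
    rw [Matrix.det_fromBlocks_one₁₁]
    simp [Matrix.det_neg]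
  rw [← Matrix.det_submatrix_equiv_self (orthEquiv n), h, Matrix.det_fromBlocks_zero₂₁, h4]
  simp [mul_comm]

/-- Both spaces have discriminant 1, so the ratio of their Gram determinants is a square in F
itself. This makes the determinant of an isometry rational. -/
theorem exists_det_gramMatrix_eq [CharZero F] {q : QuadraticForm F (OrthIndex n → F)}
    (hq : IsNonsplitSpace q) :
    ∃ r : F, (gramMatrix (splitForm n F)).det = r ^ 2 * (gramMatrix q).det := by
  obtain ⟨r, hr⟩ := hq.discriminant
  have hc : Fintype.card (OrthIndex n) = 2 * n + 1 := by
    simp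
    omega
  rw [Matrix.det_smul, hc] at hr
  have h2 : (2 : F) ≠ 0 := two_ne_zero
  have hs : ((-1 : F) ^ n) * (-1) ^ n = 1 := by rw [← mul_pow]; simp
  have hdet : (gramMatrix q).det = (-1) ^ n * 2 ^ (2 * n + 1) * r ^ 2 := by
    have h3 : (2 : F) ^ (2 * n + 1) * 2⁻¹ ^ (2 * n + 1) = 1 := by
      rw [← mul_pow, mul_inv_cancel₀ h2, one_pow]
    linear_combination (-1) ^ n * 2 ^ (2 * n + 1) * hr -
      (2 ^ (2 * n + 1) * 2⁻¹ ^ (2 * n + 1) * (gramMatrix q).det) * hs -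
      (gramMatrix q).det * h3
  have hr0 : r ≠ 0 := by
    rintro rfl
    exact hq.nondegenerate (by rw [hdet]; ring)
  refine ⟨(2 ^ n * r)⁻¹, ?_⟩
  rw [det_gramMatrix_splitForm, hdet]
  have : (2 : F) ^ (2 * n + 1) = 2 * (2 ^ n) ^ 2 := by ring
  rw [this]
  field_simp

theorem soLabel_orthSwap (a : OrthIndex n) :
    soLabel n k (orthSwap a) = 1 ↔ soLabel n k a = 1 := by
  rcases a with i | (⟨⟩ | i)
  · by_cases h : i.val < k <;> simp [orthSwap, soLabel, h]
  · rfl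
  · by_cases h : i.val < k <;> simp [orthSwap, soLabel, h]

theorem orthSwap_orthSwap (a : OrthIndex n) : orthSwap (orthSwap a) = a := by
  rcases a with i | (⟨⟩ | i) <;> rfl

theorem gramMatrix_apply_of_soLabel_ne_one {q : QuadraticForm F (OrthIndex n → F)}
    (hq : IsNonsplitSpace q) (hk : k + 1 ≤ n) {a : OrthIndex n} (ha : soLabel n k a ≠ 1)
    (b : OrthIndex n) : gramMatrix q a b = if b = orthSwap a then 1 else 0 := by
  rcases a with i | (⟨⟩ | i)
  · have h : i.val < k := by
      by_contra h
      simp [soLabel, h] at ha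
    exact hq.basis_left i b (by omega)
  · simp [soLabel] at ha
  · have h : i.val < k := by
      by_contra h
      simp [soLabel, h] at ha
    exact hq.basis_right i b (by omega)

theorem gramMatrix_splitForm_apply_of_soLabel_ne_one {a : OrthIndex n} (ha : soLabel n k a ≠ 1)
    (b : OrthIndex n) : gramMatrix (splitForm n F) a b = if b = orthSwap a then 1 else 0 := by
  rw [gramMatrix_splitForm_apply, if_neg (c := a = ix0)]
  rintro rfl
  simp [soLabel] at ha

end GramMatrix

/-! ### Existence of the pure inner twist -/

section PureInnerTwist

variable {n k : ℕ} {F : Type*} [Field F] [CharZero F]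

/-- An isometry over the algebraic closure which is the identity on `X_k ⊕ X_k^*`. -/
theorem exists_isometry {q : QuadraticForm F (OrthIndex n → F)} (hq : IsNonsplitSpace q)
    (hk : k + 1 ≤ n) :
    ∃ f : Matrix (OrthIndex n) (OrthIndex n) (AlgebraicClosure F),
      fᵀ * (gramMatrix q).map (algebraMap F (AlgebraicClosure F)) * f =
        (gramMatrix (splitForm n F)).map (algebraMap F (AlgebraicClosure F)) ∧
      ∀ a b, soLabel n k b ≠ 1 → f a b = if a = b then 1 else 0 := by
  set K := AlgebraicClosure F
  set ι := algebraMap F K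
  set e := Equiv.sumCompl fun a : OrthIndex n => soLabel n k a = 1
  have hblock : ∀ G : Matrix (OrthIndex n) (OrthIndex n) F, G.IsSymm →
      (∀ a, soLabel n k a ≠ 1 → ∀ b, G a b = if b = orthSwap a then 1 else 0) →
      (G.map ι).submatrix e e = Matrix.fromBlocks ((G.map ι).submatrix Subtype.val Subtype.val) 0 0
        (Matrix.of fun a b => if b.val = orthSwap a.val then 1 else 0) := by
    intro G hG hrow
    ext (⟨a, ha⟩ | ⟨a, ha⟩) (⟨b, hb⟩ | ⟨b, hb⟩)
    · rfl
    · simp only [e, Matrix.submatrix_apply, Matrix.map_apply, Equiv.sumCompl_apply_inl,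
        Equiv.sumCompl_apply_inr, Matrix.fromBlocks_apply₁₂, Matrix.zero_apply]
      rw [← hG.apply, hrow b hb, if_neg, map_zero]
      rintro rfl
      exact hb ((soLabel_orthSwap b).1 ha)
    · simp only [e, Matrix.submatrix_apply, Matrix.map_apply, Equiv.sumCompl_apply_inl,
        Equiv.sumCompl_apply_inr, Matrix.fromBlocks_apply₂₁, Matrix.zero_apply]
      rw [hrow a ha, if_neg, map_zero]
      rintro rfl
      exact ha ((soLabel_orthSwap a).1 hb)
    · simp only [e, Matrix.submatrix_apply, Matrix.map_apply,
        Equiv.sumCompl_apply_inr, Matrix.fromBlocks_apply₂₂, Matrix.of_apply]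
      rw [hrow a ha]
      split_ifs <;> simp
  have h₁ := hblock _ (gramMatrix_isSymm q) fun a ha => gramMatrix_apply_of_soLabel_ne_one hq hk ha
  have h₂ := hblock _ (gramMatrix_isSymm (splitForm n F)) fun a ha =>
    gramMatrix_splitForm_apply_of_soLabel_ne_one ha
  have hdet : ∀ G : Matrix (OrthIndex n) (OrthIndex n) F, G.det ≠ 0 → (G.map ι).det ≠ 0 := by
    intro G hG
    rw [← RingHom.mapMatrix_apply, ← RingHom.map_det]
    exact (map_ne_zero ι).2 hG
  have hd₁ := hdet _ hq.nondegenerate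
  have hd₂ := hdet (gramMatrix (splitForm n F)) (by
    rw [det_gramMatrix_splitForm]
    exact mul_ne_zero two_ne_zero (pow_ne_zero _ (by simp)))
  rw [← Matrix.det_submatrix_equiv_self e, h₁, Matrix.det_fromBlocks_zero₂₁] at hd₁
  rw [← Matrix.det_submatrix_equiv_self e, h₂, Matrix.det_fromBlocks_zero₂₁] at hd₂
  -- Both Gram matrices split off the same block on X_k ⊕ X_k^*, so any isometry P between the
  -- complements extends by the identity.
  obtain ⟨P, hP⟩ := exists_transpose_mul_mul_eq
    (((gramMatrix_isSymm q).map ι).submatrix Subtype.val)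
    (((gramMatrix_isSymm (splitForm n F)).map ι).submatrix Subtype.val)
    (left_ne_zero_of_mul hd₁) (left_ne_zero_of_mul hd₂)
  refine ⟨(Matrix.fromBlocks P 0 0 1).submatrix e.symm e.symm, ?_, ?_⟩
  · have hsub : ∀ G : Matrix (OrthIndex n) (OrthIndex n) K,
        G = (G.submatrix e e).submatrix e.symm e.symm := by
      intro G
      simp
    rw [hsub ((gramMatrix q).map ι), hsub ((gramMatrix (splitForm n F)).map ι), h₁, h₂,
      Matrix.transpose_submatrix, Matrix.submatrix_mul_equiv, Matrix.submatrix_mul_equiv,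
      Matrix.fromBlocks_transpose, Matrix.fromBlocks_multiply, Matrix.fromBlocks_multiply]
    simp [hP]
  · intro a b hb
    have hn : ∀ (c) (hc : soLabel n k c ≠ 1), e.symm c = Sum.inr ⟨c, hc⟩ := fun c hc =>
      e.symm_apply_eq.2 rfl
    rw [Matrix.submatrix_apply, hn b hb]
    by_cases ha : soLabel n k a = 1
    · rw [show e.symm a = Sum.inl ⟨a, ha⟩ from e.symm_apply_eq.2 rfl,
        Matrix.fromBlocks_apply₁₂, if_neg]
      · rfl
      · rintro rfl
        exact hb ha
    · rw [hn a ha, Matrix.fromBlocks_apply₂₂, Matrix.one_apply]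
      simp

/-- The determinant of the isometry has square r² with r in F, so it equals ±r. It is fixed by the
Galois group, and f⁻¹ σ(f) has determinant 1. -/
theorem exists_isPureInnerTwist {q : QuadraticForm F (OrthIndex n → F)} (hq : IsNonsplitSpace q)
    (hk : k + 1 ≤ n) :
    ∃ f : Matrix (OrthIndex n) (OrthIndex n) (AlgebraicClosure F), IsPureInnerTwist k q f := by
  obtain ⟨f, hf, hcol⟩ := exists_isometry hq hk
  obtain ⟨r, hr⟩ := exists_det_gramMatrix_eq hq
  have hd := congrArg Matrix.det hf
  rw [Matrix.det_mul, Matrix.det_mul, Matrix.det_transpose, ← RingHom.mapMatrix_apply,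
    ← RingHom.mapMatrix_apply, ← RingHom.map_det, ← RingHom.map_det, hr, map_mul, map_pow] at hd
  have hq0 : algebraMap F (AlgebraicClosure F) (gramMatrix q).det ≠ 0 :=
    (map_ne_zero _).2 hq.nondegenerate
  have hsq : f.det ^ 2 = (algebraMap F (AlgebraicClosure F) r) ^ 2 := by
    apply mul_right_cancel₀ hq0
    rw [← hd]
    ring
  have hr0 : r ≠ 0 := by
    rintro rfl
    rw [det_gramMatrix_splitForm] at hr
    simp at hr
  have hf0 : f.det ≠ 0 := by
    intro h
    rw [h, zero_pow two_ne_zero] at hsq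
    exact pow_ne_zero 2 ((map_ne_zero _).2 hr0) hsq.symm
  refine ⟨f, hf, fun i hi => ?_, fun i hi => ?_, fun σ => ?_⟩
  · ext a
    rw [Matrix.mulVec_single_one, Matrix.col_apply, hcol a _ (by simp [soLabel, hi]),
      Pi.single_apply]
  · ext a
    rw [Matrix.mulVec_single_one, Matrix.col_apply, hcol a _ (by simp [soLabel, hi]),
      Pi.single_apply]
  · have hσ : (f.map σ).det = f.det := by
      have h1 : (f.map σ).det = σ f.det := (AlgEquiv.map_det σ f).symm
      rw [h1]
      rcases sq_eq_sq_iff_eq_or_eq_neg.1 hsq with h | h <;> simp [h]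
    rw [Matrix.det_mul, hσ, ← Matrix.det_mul, Matrix.nonsing_inv_mul _ (isUnit_iff_ne_zero.2 hf0),
      Matrix.det_one]

end PureInnerTwist

/-! ### Transfer of the representative to `SO(V^-)` -/

section NonsplitRepresentative

variable {n k : ℕ} {F : Type*} [Field F]

theorem soLabel_orthPerm_weylPerm (hkn : k ≤ n) (a : OrthIndex n) :
    soLabel n k (orthPerm (weylPerm hkn) a) = 1 ↔ soLabel n k a = 1 := by
  induction a using orthIndex_cases with
  | h0 => rfl
  | h p =>
    rw [orthPerm_orthPoint]
    rcases p with i | i <;> by_cases hi : i.val < k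
    · simp [soLabel, hi, show k - 1 - i.val < k by omega]
    · simp [soLabel, hi]
    · simp [soLabel, hi, show k - 1 - i.val < k by omega]
    · simp [soLabel, hi]

theorem orthPerm_weylPerm_of_soLabel (hkn : k ≤ n) {a : OrthIndex n} (ha : soLabel n k a = 1) :
    orthPerm (weylPerm hkn) a = a ∧ orthCoef (soCoef F (weylPerm hkn)) ((-1) ^ k) a = (-1) ^ k := by
  induction a using orthIndex_cases with
  | h0 => exact ⟨rfl, rfl⟩
  | h p =>
    rw [orthPerm_orthPoint, orthCoef_orthPoint]
    rcases p with i | i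
    · have hi : ¬ i.val < k := by
        intro hi
        simp [soLabel, hi] at ha
      simp [soCoef_weylPerm_inl, hi]
    · have hi : ¬ i.val < k := by
        intro hi
        simp [soLabel, hi] at ha
      simp [soCoef_weylPerm_inr, hi]

/-- Here f is block diagonal and the identity on X_k ⊕ X_k^*, while the representative preserves the
two blocks and is a scalar on the other one, V_{n-k}. -/
theorem mul_map_wLMatrix {K : Type*} [Field K] (ι : F →+* K) (hkn : k ≤ n)
    {f : Matrix (OrthIndex n) (OrthIndex n) K}
    (hf : ∀ a b, soLabel n k b ≠ 1 → f a b = if a = b then 1 else 0)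
    (hf' : ∀ a b, soLabel n k a ≠ 1 → soLabel n k b = 1 → f a b = 0) :
    f * (wLMatrix n k F).map ι = (wLMatrix n k F).map ι * f := by
  rw [← monomialMatrix_soCoef_weylPerm hkn]
  set π := orthPerm (weylPerm hkn)
  set c : OrthIndex n → F := orthCoef (soCoef F (weylPerm hkn)) ((-1) ^ k)
  have hmap : (monomialMatrix π c).map ι = monomialMatrix π fun a => ι (c a) := by
    ext a b
    rw [Matrix.map_apply, monomialMatrix_apply, monomialMatrix_apply, apply_ite ι, map_zero]
  rw [hmap]
  ext a b
  obtain ⟨a, rfl⟩ := π.surjective a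
  rw [mul_monomialMatrix_apply, monomialMatrix_mul_apply]
  by_cases hb : soLabel n k b = 1
  · obtain ⟨hb1, hb2⟩ := orthPerm_weylPerm_of_soLabel (F := F) hkn hb
    by_cases ha : soLabel n k a = 1
    · obtain ⟨ha1, ha2⟩ := orthPerm_weylPerm_of_soLabel (F := F) hkn ha
      rw [ha1, hb1, show c a = (-1) ^ k from ha2, show c b = (-1) ^ k from hb2, mul_comm]
    · rw [hf' a b ha hb, hf' _ _ (mt (soLabel_orthPerm_weylPerm hkn a).1 ha)
        ((soLabel_orthPerm_weylPerm hkn b).2 hb), zero_mul, mul_zero]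
  · rw [hf a b hb, hf (π a) (π b) (mt (soLabel_orthPerm_weylPerm hkn b).1 hb)]
    by_cases hab : a = b
    · subst hab
      simp
    · rw [if_neg hab, if_neg fun h => hab (π.injective h), zero_mul, mul_zero]

theorem IsPureInnerTwist.det_ne_zero [CharZero F] {q : QuadraticForm F (OrthIndex n → F)}
    {f : Matrix (OrthIndex n) (OrthIndex n) (AlgebraicClosure F)} (hf : IsPureInnerTwist k q f) :
    f.det ≠ 0 := by
  intro h
  have hd := congrArg Matrix.det hf.isometry
  rw [Matrix.det_mul, h, mul_zero, ← RingHom.mapMatrix_apply, ← RingHom.map_det,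
    det_gramMatrix_splitForm] at hd
  exact (map_ne_zero (algebraMap F (AlgebraicClosure F))).2
    (mul_ne_zero two_ne_zero (pow_ne_zero n (by simp))) hd.symm

theorem IsPureInnerTwist.apply_of_soLabel_ne_one {q : QuadraticForm F (OrthIndex n → F)}
    {f : Matrix (OrthIndex n) (OrthIndex n) (AlgebraicClosure F)} (hf : IsPureInnerTwist k q f)
    (a : OrthIndex n) {b : OrthIndex n} (hb : soLabel n k b ≠ 1) :
    f a b = if a = b then 1 else 0 := by
  have key : f *ᵥ Pi.single b 1 = Pi.single b 1 := by
    rcases b with i | (⟨⟩ | i)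
    · exact hf.map_X i (by
        by_contra h
        simp [soLabel, h] at hb)
    · simp [soLabel] at hb
    · exact hf.map_Xs i (by
        by_contra h
        simp [soLabel, h] at hb)
  have h := congrFun key a
  rwa [Matrix.mulVec_single_one, Matrix.col_apply, Pi.single_apply] at h

/-- An isometry fixing X_k ⊕ X_k^* maps its orthogonal complement into its orthogonal complement;
the entry is read off by pairing with the dual vector `orthSwap a`. -/
theorem IsPureInnerTwist.apply_eq_zero {q : QuadraticForm F (OrthIndex n → F)}
    (hq : IsNonsplitSpace q) (hk : k + 1 ≤ n)
    {f : Matrix (OrthIndex n) (OrthIndex n) (AlgebraicClosure F)} (hf : IsPureInnerTwist k q f)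
    (a b : OrthIndex n) (ha : soLabel n k a ≠ 1) (hb : soLabel n k b = 1) : f a b = 0 := by
  have ha' : soLabel n k (orthSwap a) ≠ 1 := mt (soLabel_orthSwap a).1 ha
  have h := congrFun (congrFun hf.isometry (orthSwap a)) b
  rw [Matrix.map_apply, gramMatrix_splitForm_apply_of_soLabel_ne_one ha', orthSwap_orthSwap,
    if_neg (by rintro rfl; exact ha hb), map_zero, Matrix.mul_assoc, Matrix.mul_apply] at h
  simp only [Matrix.transpose_apply, hf.apply_of_soLabel_ne_one _ ha', ite_mul, one_mul, zero_mul,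
    Finset.sum_ite_eq', Finset.mem_univ, if_true] at h
  rw [Matrix.mul_apply] at h
  simpa [gramMatrix_apply_of_soLabel_ne_one hq hk ha', orthSwap_orthSwap, apply_ite] using h

theorem IsPureInnerTwist.mul_map_wLMatrix {q : QuadraticForm F (OrthIndex n → F)}
    (hq : IsNonsplitSpace q) (hk : k + 1 ≤ n)
    {f : Matrix (OrthIndex n) (OrthIndex n) (AlgebraicClosure F)} (hf : IsPureInnerTwist k q f) :
    f * (wLMatrix n k F).map (algebraMap F (AlgebraicClosure F)) =
      (wLMatrix n k F).map (algebraMap F (AlgebraicClosure F)) * f :=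
  _root_.mul_map_wLMatrix _ (by omega) (fun a _ hb => hf.apply_of_soLabel_ne_one a hb)
    (hf.apply_eq_zero hq hk)

theorem existsUnique_isLSRepresentativeNonsplit [CharZero F] (hk : 1 ≤ k) (hkn : k + 1 ≤ n)
    {q : QuadraticForm F (OrthIndex n → F)} (hq : IsNonsplitSpace q) :
    ∃ w : SOGroup q, soMatrix q w = wLMatrix n k F ∧
      ∀ g : SOGroup q, IsLSRepresentativeNonsplit n k q g ↔ g = w := by
  obtain ⟨w₀, hw₀, huniq⟩ := existsUnique_isLSRepresentativeSO F hk (by omega : k ≤ n)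
  obtain ⟨f, hf⟩ := exists_isPureInnerTwist hq hkn
  have hinj : Function.Injective fun A : Matrix (OrthIndex n) (OrthIndex n) F =>
      A.map (algebraMap F (AlgebraicClosure F)) :=
    Matrix.map_injective (algebraMap F (AlgebraicClosure F)).injective
  -- The matrix preserves the split form and commutes with f, which carries one form to the other.
  -- Invertibility of f and injectivity of F → F̄ bring the identity down to q.
  have hgram : (wLMatrix n k F)ᵀ * gramMatrix q * wLMatrix n k F = gramMatrix q := by
    have hu : IsUnit f := (Matrix.isUnit_iff_isUnit_det f).2 (isUnit_iff_ne_zero.2 hf.det_ne_zero)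
    have hut : IsUnit fᵀ := (Matrix.isUnit_iff_isUnit_det _).2 (by
      rw [Matrix.det_transpose]
      exact isUnit_iff_ne_zero.2 hf.det_ne_zero)
    apply hinj
    apply hu.mul_right_cancel
    apply hut.mul_left_cancel
    have h₀ := transpose_mul_gramMatrix_mul w₀
    rw [hw₀] at h₀
    have hc := hf.mul_map_wLMatrix hq hkn
    have hct := congrArg Matrix.transpose hc
    rw [Matrix.transpose_mul, Matrix.transpose_mul] at hct
    simp only [Matrix.map_mul]
    rw [← Matrix.mul_assoc fᵀ ((gramMatrix q).map _), hf.isometry, ← h₀]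
    simp only [Matrix.map_mul]
    rw [← hf.isometry, Matrix.mul_assoc, Matrix.mul_assoc, ← hc, Matrix.transpose_map]
    simp only [← Matrix.mul_assoc]
    rw [hct]
  -- The same matrix is already known to lie in `SO(V^+)`.
  have hdet : (wLMatrix n k F).det = 1 := by
    rw [← hw₀]
    exact w₀.1.2
  refine ⟨⟨⟨wLMatrix n k F, hdet⟩, quadraticForm_mulVec_eq hgram⟩, rfl, fun g => ⟨?_, ?_⟩⟩
  -- An arbitrary twist f commutes with the representative just as the chosen one does, so the
  -- result does not depend on f.
  · rintro ⟨f, hf, g₀, hg₀, h⟩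
    rw [(huniq g₀).1 hg₀, hw₀, hf.mul_map_wLMatrix hq hkn] at h
    have hu : IsUnit f := (Matrix.isUnit_iff_isUnit_det f).2 (isUnit_iff_ne_zero.2 hf.det_ne_zero)
    exact soMatrix_injective q (hinj (hu.mul_right_cancel h)).symm
  · rintro rfl
    refine ⟨f, hf, w₀, (huniq w₀).2 rfl, ?_⟩
    rw [hw₀]
    exact hf.mul_map_wLMatrix hq hkn

end NonsplitRepresentative

/-- The Langlands–Shelstad representatives of the nontrivial relative Weyl group element for the
maximal parabolic subgroups of `Mp(W)`, `SO(V^+)` and `SO(V^-)`. -/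
theorem mainTheorem4 (F : Type*) [Field F] [CharZero F] [ValuativeRel F] [TopologicalSpace F]
    [IsNonarchimedeanLocalField F] (n k : ℕ) (hk : 1 ≤ k) (hkn : k ≤ n) :
    (∃ w : MpGroup n F,
      spMatrix n F w.toSp = wMMatrix n k F ∧
      w.sign = hilbertSymbol (-1 : F) (-1) ^ (k * (k - 1) / 2) ∧
      ∀ g : MpGroup n F, IsLSRepresentativeMp n k F g ↔ g = w) ∧
    (∃ w : SOGroup (splitForm n F),
      soMatrix (splitForm n F) w = wLMatrix n k F ∧
      ∀ g : SOGroup (splitForm n F), IsLSRepresentativeSO n k F g ↔ g = w) ∧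
    (∀ q : QuadraticForm F (OrthIndex n → F), IsNonsplitSpace q → k ≤ n - 1 →
      ∃ w : SOGroup q,
        soMatrix q w = wLMatrix n k F ∧
        ∀ g : SOGroup q, IsLSRepresentativeNonsplit n k q g ↔ g = w) :=
  ⟨existsUnique_isLSRepresentativeMp F hk hkn, existsUnique_isLSRepresentativeSO F hk hkn,
    fun _ hq hk' => existsUnique_isLSRepresentativeNonsplit hk (by omega) hq⟩
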